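/- Let $N,k\in\mathbb N$ and let $V=\mathbb C[X_i^{(j)} : 0\le i\le N,\ j\ge 0]$ be the algebra of differential polynomials in $N+1$ variables. An invertible power series $\alpha\in\mathbb C[[T]]^\times$ acts on $V$ by the algebra map $X_i^{(m)}\mapsto\sum_{j=0}^m\binom mj\alpha^{(m-j)}(0)\,X_i^{(j)}$. A polynomial $P\in V$ is differentially homogeneous of degree $d$ if $\alpha\cdot P=\alpha(0)^dP$ for all $\alpha\in\mathbb C[[T]]^\times$; let $V^{\mathrm{Diff}}_d$ be the space of these, $V^{\mathrm{Diff}}=\bigoplus_d V^{\mathrm{Diff}}_d$, and let $(V^{\mathrm{Diff}})^{(k)}=V^{\mathrm{Diff}}\cap\mathbb C[X_i^{(j)}: j\le k]$. The order of $P$ is the largest $j$ such that some $X_i^{(j)}$ occurs in $P$. For $d\ge1$ let $\overline{\Sigma_d}$ be the set of sequences $\alpha=(\alpha_0,\dots,\alpha_N)$ of (possibly empty) tuples $\alpha_i=(\alpha_{i,1},\dots,\alpha_{i,r_i})$ of natural numbers such that, with $s_i:=r_0+\dots+r_i$: (a) $0\le\alpha_{i,1}<\dots<\alpha_{i,r_i}<s_i$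 whenever $r_i\ge1$; (b) $s_N=d$; (c) there is an $i$ with $r_i\ge1$, $\alpha_{i,1}=0$, with $\alpha_{i,r_i}<s_i-1$ if $r_i>1$, and with $\alpha_{j,r_j}<s_j-1$ for every $j>i$ with $r_j\ge1$. For such $\alpha$ let $W_\alpha$ be the $d\times d$ determinant with columns $$J^{\alpha_{0,1}}v_0,\dots,J^{\alpha_{0,r_0}}v_0,\ \dots,\ J^{\alpha_{N,1}}v_N,\dots,J^{\alpha_{N,r_N}}v_N,$$ where $v_i=(X_i^{(0)},\dots,X_i^{(d-1)})^{\top}$ and $J$ acts entrywise by $JX_i^{(j)}=jX_i^{(j-1)}$ (so $JX_i^{(0)}=0$). Put $\mathcal G_d=\{W_\alpha:\alpha\in\overline{\Sigma_d}\}$. Theorem. (1) The algebra $(V^{\mathrm{Diff}})^{(k)}$ is finitely generated, and $\mathcal G_1\cup\dots\cup\mathcal G_{k+1}$ is a minimal generating set of it (it generates, and no proper subset does). Here $|\mathcal G_1|=N+1$ and $|\mathcal G_i|=\frac{N(N+1)}2(N+1)^{i-2}$ for $2\le i\le k+1$, and the elements of $\mathcal G_i$ are differentially homogeneous of degree $i$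 and of order exactly $i-1$ for $1\le i\le k+1$. (2) Let $F$ be a $\mathbb C$-vector space of dimension $k+1$ with a nilpotent endomorphism $J$ such that $J^k\ne0$. Then $P\mapsto P(J)$ induces an isomorphism $(\mathbb C[T]/(T^{k+1}))^\times\simeq\mathbb C[J]^\times$, and $F$ has a basis $f_0,\dots,f_k$ with $Jf_0=0$ and $Jf_j=jf_{j-1}$ for $1\le j\le k$. Let $\mathbb C[J]^\times$ act diagonally on the symmetric algebra $S^\bullet(F^{\oplus(N+1)})$, and call $v$ quasi-invariant of degree $d$ if $P(J)\cdot v=P(0)^dv$ for all $P(J)\in\mathbb C[J]^\times$. For every such basis, the algebra of quasi-invariants (the sum over $d\in\mathbb N$ of the spaces of quasi-invariants of degree $d$) is finitely generated, and it is minimally generated by $\mathcal G_1\cup\dots\cup\mathcal G_{k+1}$, where $X_i^{(j)}$ now denotes the vector $f_j$ of the $i$-th copy of $F$ ($0\le i\le N$). The families have the same cardinalities as in (1), and the elements of $\mathcal G_i$ are non-zero quasi-invariants of degree $i$. -/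

import Mathlib

open MvPolynomial

noncomputable section

namespace DiffHom

/-- Differential polynomials in the variables `X_0, …, X_N`; the variable `X (i, j)` is the
formal derivative `X_i^{(j)}`. -/
abbrev V (N : ℕ) : Type := MvPolynomial (Fin (N + 1) × ℕ) ℂ

/-- The action of `α ∈ ℂ⟦T⟧ˣ` on differential polynomials: the algebra map substituting for
`X_i^{(k)}` the value at `T = 0` of the Leibniz expression
`∑_{j ≤ k} (k choose j) α^{(k - j)} X_i^{(j)}`. -/
def act {N : ℕ} (α : (PowerSeries ℂ)ˣ) : V N →ₐ[ℂ] V N :=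
  aeval fun p : Fin (N + 1) × ℕ =>
    ∑ j ∈ Finset.range (p.2 + 1),
      ((p.2.choose j : ℂ) *
        PowerSeries.constantCoeff ((PowerSeries.derivative ℂ)^[p.2 - j] (α : PowerSeries ℂ))) •
          (X (p.1, j) : V N)

/-- The space of differentially homogeneous polynomials of degree `d`. -/
def diffHom (N d : ℕ) : Submodule ℂ (V N) where
  carrier := {P | ∀ α : (PowerSeries ℂ)ˣ,
    act α P = (PowerSeries.constantCoeff (α : PowerSeries ℂ)) ^ d • P}
  add_mem' := by
    intro P Q hP hQ α
    rw [map_add, hP α, hQ α, smul_add]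
  zero_mem' := by
    intro α
    simp
  smul_mem' := by
    intro c P hP α
    rw [map_smul, hP α, smul_comm]

instance diffHom_gradedMonoid (N : ℕ) : SetLike.GradedMonoid (diffHom N) where
  one_mem := by
    intro α
    simp
  mul_mem := by
    intro i j P Q hP hQ α
    rw [map_mul, hP α, hQ α, smul_mul_smul_comm, pow_add]

/-- The algebra of differentially homogeneous polynomials: the sum of the spaces
`diffHom N d`, `d ∈ ℕ`. -/
def diffAlg (N : ℕ) : Subalgebra ℂ (V N) :=
  (DirectSum.coeAlgHom (diffHom N)).range

/-- The differential polynomials of order at most `k`. -/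
def orderLE (N k : ℕ) : Subalgebra ℂ (V N) :=
  supported ℂ {p : Fin (N + 1) × ℕ | p.2 ≤ k}

/-- The algebra of differentially homogeneous polynomials of order at most `k`. -/
def diffAlgLE (N k : ℕ) : Subalgebra ℂ (V N) :=
  diffAlg N ⊓ orderLE N k

/-- The order of a differential polynomial: the largest `j` such that some `X_i^{(j)}`
occurs in it. -/
def order {N : ℕ} (P : V N) : ℕ :=
  P.vars.sup Prod.snd

/-- `r_0 + ⋯ + r_i`, where `r_j` is the length of the `j`-th tuple. -/
def partialLength {N : ℕ} (α : Fin (N + 1) → List ℕ) (i : Fin (N + 1)) : ℕ :=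
  ∑ j ∈ Finset.Iic i, (α j).length

/-- The index set of the generators of degree `d`: sequences of (possibly empty) tuples
`α_0, …, α_N` of total length `d`, each one strictly increasing with entries less than
`r_0 + ⋯ + r_i`, with the additional condition `exists_head_zero`. -/
structure IsIndex {N : ℕ} (d : ℕ) (α : Fin (N + 1) → List ℕ) : Prop where
  increasing : ∀ i, (α i).Pairwise (· < ·)
  lt_partialLength : ∀ i, ∀ a ∈ α i, a < partialLength α i
  length_eq : ∑ i, (α i).length = d
  exists_head_zero : ∃ i, (α i).head? = some 0 ∧
    (1 < (α i).length → ∀ a ∈ (α i).getLast?, a + 1 < partialLength α i) ∧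
    ∀ j, i < j → ∀ a ∈ (α j).getLast?, a + 1 < partialLength α j

/-- The list of pairs `(i, α_{i,s})` in lexicographic order of `(i, s)`. -/
def columns {N : ℕ} (α : Fin (N + 1) → List ℕ) : List (Fin (N + 1) × ℕ) :=
  (List.finRange (N + 1)).flatMap fun i => (α i).map fun a => (i, a)

/-- Given elements `x i j` (playing the role of `X_i^{(j)}`) of a commutative algebra, the
determinant of the square matrix whose columns are the `J^a v_i`, for `(i, a)` in
`columns α`, where `v_i = (x i 0, x i 1, …)ᵀ` and `J` acts entrywise by
`J (x i j) = j • x i (j - 1)`, so that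
`J^a (x i j) = j (j - 1) ⋯ (j - a + 1) • x i (j - a)`, which is `0` for `a > j`. -/
def W {N : ℕ} {A : Type*} [CommRing A] (x : Fin (N + 1) → ℕ → A)
    (α : Fin (N + 1) → List ℕ) : A :=
  Matrix.det (Matrix.of fun j c : Fin (columns α).length =>
    (j : ℕ).descFactorial ((columns α).get c).2 •
      x ((columns α).get c).1 ((j : ℕ) - ((columns α).get c).2))

/-- The family of generators of degree `d`, written in the elements `x i j`. -/
def genFamily {N : ℕ} {A : Type*} [CommRing A] (x : Fin (N + 1) → ℕ → A) (d : ℕ) : Set A :=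
  {P | ∃ α : Fin (N + 1) → List ℕ, IsIndex d α ∧ P = W x α}

/-- The family `𝒢_d` of differentially homogeneous polynomials. -/
def G (N d : ℕ) : Set (V N) :=
  genFamily (fun i j => X (i, j)) d

/-- The number of generators of degree `d ≥ 1`. -/
def numGen (N d : ℕ) : ℕ :=
  if d = 1 then N + 1 else N * (N + 1) / 2 * (N + 1) ^ (d - 2)

section Invariants

variable {F : Type*} [AddCommGroup F] [Module ℂ F]

/-- The symmetric algebra of the direct sum of `N + 1` copies of `F`. -/
abbrev SymCopies (N : ℕ) (F : Type*) [AddCommGroup F] [Module ℂ F] : Type _ :=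
  SymmetricAlgebra ℂ (Fin (N + 1) → F)

/-- The diagonal action of an endomorphism of `F` on the symmetric algebra of
`N + 1` copies of `F`. -/
def symAct (N : ℕ) (g : Module.End ℂ F) : SymCopies N F →ₐ[ℂ] SymCopies N F :=
  SymmetricAlgebra.lift
    (SymmetricAlgebra.ι ℂ (Fin (N + 1) → F) ∘ₗ LinearMap.compLeft g (Fin (N + 1)))

/-- Quasi-invariants of degree `d` under `ℂ[J]ˣ`: the elements `v` such that
`P(J) · v = P(0)^d v` for every `P(J) ∈ ℂ[J]ˣ`. -/
def quasiInv (N : ℕ) (J : Module.End ℂ F) (d : ℕ) : Submodule ℂ (SymCopies N F) where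
  carrier := {v | ∀ (g : (Algebra.adjoin ℂ {J})ˣ) (P : Polynomial ℂ),
    Polynomial.aeval J P = ((g : Algebra.adjoin ℂ {J}) : Module.End ℂ F) →
      symAct N ((g : Algebra.adjoin ℂ {J}) : Module.End ℂ F) v = (P.eval 0) ^ d • v}
  add_mem' := by
    intro v w hv hw g P h
    rw [map_add, hv g P h, hw g P h, smul_add]
  zero_mem' := by
    intro g P h
    simp
  smul_mem' := by
    intro c v hv g P h
    rw [map_smul, hv g P h, smul_comm]

instance quasiInv_gradedMonoid (N : ℕ) (J : Module.End ℂ F) :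
    SetLike.GradedMonoid (quasiInv N J) where
  one_mem := by
    intro g P h
    simp
  mul_mem := by
    intro i j v w hv hw g P h
    rw [map_mul, hv g P h, hw g P h, smul_mul_smul_comm, pow_add]

/-- The algebra of quasi-invariants: the sum of the spaces `quasiInv N J d`, `d ∈ ℕ`. -/
def quasiInvAlg (N : ℕ) (J : Module.End ℂ F) : Subalgebra ℂ (SymCopies N F) :=
  (DirectSum.coeAlgHom (quasiInv N J)).range

/-- A basis `f_0, …, f_k` of `F` such that `J f_0 = 0` and `J f_j = j f_{j-1}` for `j ≥ 1`
(for `j = 0` the coefficient is `0`). -/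
def IsAdapted {k : ℕ} (J : Module.End ℂ F) (f : Module.Basis (Fin (k + 1)) ℂ F) : Prop :=
  ∀ j : Fin (k + 1), J (f j) = ((j : ℕ) : ℂ) • f (j - 1)

/-- The vector `f_j` of the `i`-th copy of `F`, as an element of the symmetric algebra
(`0` for `j > k`; such `j` do not occur in the generators of degree at most `k + 1`). -/
def copyVar (N : ℕ) {k : ℕ} (f : Module.Basis (Fin (k + 1)) ℂ F) (i : Fin (N + 1)) (j : ℕ) :
    SymCopies N F :=
  if h : j < k + 1 then SymmetricAlgebra.ι ℂ (Fin (N + 1) → F) (Pi.single i (f ⟨j, h⟩)) else 0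

end Invariants

end DiffHom

end

/-! Generation. Let `P` be differentially homogeneous of degree `d` and order at most `k`. The
constant unit 2 forces `P` to be homogeneous of degree `d`, so `P` is recovered from its full
polarization, one coefficient function on exponents `a : Fin d → ℕ` for each sequence of letters
`w`. Invariance under the units `1 + zT` says that this function, multiplied by `∏ (a l)!`, is
harmonic: it is killed by every elementary symmetric polynomial of positive degree in the shifts
(`isHarmonic_polar`). A leading-exponent argument in colex order shows that harmonic functions with
exponents at most `k` are spanned by derivatives of products of Vandermonde determinants in blocks
of size at most `k + 1` (`IsHarmonic.mem_span`). Putting the letters back turns these products into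
products of determinants with columns `J^a v_i` and sizes at most `k + 1` (`mem_span_blockDet`).
Such a determinant is itself harmonic in the exponents of `J`, because `J` is strictly triangular
(`isHarmonic_colDet`). Lexicographic rewriting with the complete symmetric polynomials reduces the
exponents either to those of an index in `IsIndex`, or to exponents with at most one zero. In the
latter case the determinant vanishes or splits off a factor `x i 0` (`colDet_mem_of_isIndex`), and
induction on the size gives `adjoin_G`.

Minimality is a dimension count. Reading indices as words bounds `diffHom N d` by `(N + 1)^d` and
the number of generators by `numGen N d`. For the opposite bounds, consider the products of the
values `X_i(c_l ε)` of the generic series at `d` points. Their span over `ℂ⟦ε⟧` has a limit at `ε =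
0` contained in `diffHom N d`; for distinct points the rank is `(N + 1)^d`, so the limit is
everything. If exactly two points collide, the span needs only `(N+2 choose 2) (N + 1)^(d-2)`
generators, yet its limit still contains every product of two elements of positive degree, since the
two colliding points can be given to different factors (`decomposable_le_limitSpace`). So the
decomposable elements have codimension at least `numGen N d`, no generator is redundant, and the
generators are distinct and nonzero. The exact order follows: a generator of degree `d` and smaller
order would be generated in degrees below `d`.

Part (2) is a transfer: polynomials of order at most `k` are the symmetric algebra of `F^(N+1)`, and
`P(J)` acts there as any power series with the same coefficients up to degree `k` (`symAct_toSym`,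
`toSym_mem_quasiInv_iff`). -/

open MvPolynomial

noncomputable section

namespace DiffHom

/-! ### Elementary symmetric polynomials in the shifts, and harmonic functions on exponents -/

section Indicator

variable {ι : Type*} [DecidableEq ι]

/-- The exponent vector of the squarefree monomial with support `T`. -/
def indic (T : Finset ι) : ι → ℕ := fun i => if i ∈ T then 1 else 0

lemma indic_empty : indic (∅ : Finset ι) = 0 := by
  funext i; simp [indic]

lemma indic_insert {i : ι} {T : Finset ι} (h : i ∉ T) :
    indic (insert i T) = Pi.single i 1 + indic T := by
  funext j
  by_cases hj : j = i
  · subst hj; simp [indic, h]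
  · simp [indic, hj]

end Indicator

section Harmonic

variable {ι M : Type*} [DecidableEq ι] [AddCommGroup M]

/-- The action of the `r`-th elementary symmetric polynomial in the shifts of the coordinates
in `S`. -/
def shiftSum (S : Finset ι) (r : ℕ) (φ : (ι → ℕ) → M) (a : ι → ℕ) : M :=
  ∑ T ∈ S.powersetCard r, φ (a + indic T)

/-- A function on exponents killed by all symmetric polynomials in the shifts without constant
term. -/
def IsHarmonic [Fintype ι] (φ : (ι → ℕ) → M) : Prop :=
  ∀ r a, shiftSum Finset.univ (r + 1) φ a = 0

lemma shiftSum_zero (S : Finset ι) (φ : (ι → ℕ) → M) (a : ι → ℕ) :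
    shiftSum S 0 φ a = φ a := by
  simp [shiftSum, indic_empty]

lemma shiftSum_of_card_lt {S : Finset ι} {r : ℕ} (h : S.card < r) (φ : (ι → ℕ) → M)
    (a : ι → ℕ) : shiftSum S r φ a = 0 := by
  simp [shiftSum, Finset.powersetCard_eq_empty.2 h]

lemma shiftSum_card (S : Finset ι) (φ : (ι → ℕ) → M) (a : ι → ℕ) :
    shiftSum S S.card φ a = φ (a + indic S) := by
  simp [shiftSum, Finset.powersetCard_self]

/-- The recursion `e_{r+1}(S ∪ {i}) = e_{r+1}(S) + x_i e_r(S)`: subsets are split by whether they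
contain `i`. The two lemmas after it solve for either term on the right and drive all later
inductions. -/
lemma shiftSum_insert {S : Finset ι} {i : ι} (h : i ∉ S) (r : ℕ) (φ : (ι → ℕ) → M)
    (a : ι → ℕ) : shiftSum (insert i S) (r + 1) φ a =
      shiftSum S (r + 1) φ a + shiftSum S r φ (a + Pi.single i 1) := by
  unfold shiftSum
  rw [Finset.powersetCard_succ_insert h, Finset.sum_union, Finset.sum_image]
  · congr 1
    refine Finset.sum_congr rfl fun T hT => ?_
    rw [indic_insert fun hi => h ((Finset.mem_powersetCard.1 hT).1 hi), add_assoc]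
  · intro T hT T' hT' e
    have h1 : i ∉ T := fun hi => h ((Finset.mem_powersetCard.1 hT).1 hi)
    have h2 : i ∉ T' := fun hi => h ((Finset.mem_powersetCard.1 hT').1 hi)
    rw [← Finset.erase_insert h1, ← Finset.erase_insert h2, e]
  · rw [Finset.disjoint_left]
    intro T hT hT'
    obtain ⟨T', -, rfl⟩ := Finset.mem_image.1 hT'
    exact h ((Finset.mem_powersetCard.1 hT).1 (Finset.mem_insert_self _ _))

lemma shiftSum_eq_sub {S : Finset ι} {i : ι} (h : i ∉ S) (r : ℕ) (φ : (ι → ℕ) → M)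
    (a : ι → ℕ) : shiftSum S r φ (a + Pi.single i 1) =
      shiftSum (insert i S) (r + 1) φ a - shiftSum S (r + 1) φ a := by
  rw [shiftSum_insert h]; abel

lemma shiftSum_succ_eq_sub {S : Finset ι} {i : ι} (h : i ∉ S) (r : ℕ) (φ : (ι → ℕ) → M)
    (a : ι → ℕ) : shiftSum S (r + 1) φ a =
      shiftSum (insert i S) (r + 1) φ a - shiftSum S r φ (a + Pi.single i 1) := by
  rw [shiftSum_insert h]; abel

end Harmonic

/-! ### Leading exponents of harmonic functions of bounded order -/

section LeadingExponent

variable {d : ℕ}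

/-- The first `m` coordinates. -/
def initSeg (d m : ℕ) : Finset (Fin d) := Finset.univ.filter fun i => (i : ℕ) < m

lemma mem_initSeg {m : ℕ} {i : Fin d} : i ∈ initSeg d m ↔ (i : ℕ) < m := by simp [initSeg]

lemma initSeg_succ (i : Fin d) : initSeg d (i + 1) = insert i (initSeg d i) := by
  ext j
  simp only [mem_initSeg, Finset.mem_insert, Fin.ext_iff]
  omega

lemma notMem_initSeg (i : Fin d) : i ∉ initSeg d i := by simp [mem_initSeg]

lemma initSeg_self (d : ℕ) : initSeg d d = Finset.univ := by
  ext j; simp [mem_initSeg]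

lemma card_initSeg {m : ℕ} (h : m ≤ d) : (initSeg d m).card = m := by
  induction m with
  | zero => simp [initSeg]
  | succ m ih =>
    have := initSeg_succ (⟨m, h⟩ : Fin d)
    simp only at this
    rw [this, Finset.card_insert_of_notMem (by simp [mem_initSeg]), ih (by omega)]

/-- After freezing the coordinates `≥ m` at the values of `b`, the function `φ` is killed by the
elementary symmetric polynomials attached to the partition with rows `ρ`. -/
def RowVanish (φ : (Fin d → ℕ) → ℂ) (b : Fin d → ℕ) (m : ℕ) (ρ : ℕ → ℕ) : Prop :=
  ∀ S ⊆ initSeg d m, ∀ c r, S.card + c = m → ∑ h ∈ Finset.range c, ρ h < r + c →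
    ∀ a, (∀ i : Fin d, m ≤ i → a i = b i) → shiftSum S r φ a = 0

/-- The degree `r` is one too small for `RowVanish` to apply to `insert i S`. The missing degree is
bought by the exponent `a i`: each unit of it trades `e_r(S)` for `e_{r+1}(S)`, and after `j ≥ ρ c`
trades the vanishing for `S` itself, with complement of size `c + 1`, takes over. -/
lemma RowVanish.shiftSum_eq_zero {φ : (Fin d → ℕ) → ℂ} {b : Fin d → ℕ} {i : Fin d} {ρ : ℕ → ℕ}
    (H : RowVanish φ b (i + 1) ρ) {S : Finset (Fin d)} (hS : S ⊆ initSeg d i) {c r j : ℕ}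
    (hc : S.card + c = i) (hr : ∑ h ∈ Finset.range c, ρ h = r + c) (hj : ρ c ≤ j)
    {a : Fin d → ℕ} (ha : ∀ i' : Fin d, i < i' → a i' = b i') (haj : j ≤ a i) :
    shiftSum S r φ a = 0 := by
  have hiS : i ∉ S := fun h => notMem_initSeg i (hS h)
  have hsub : insert i S ⊆ initSeg d (i + 1) := by
    rw [initSeg_succ]; exact Finset.insert_subset_insert _ hS
  have key : ∀ l ≤ j, ∀ a : Fin d → ℕ, (∀ i' : Fin d, i < i' → a i' = b i') → l ≤ a i →
      shiftSum S (r + j - l) φ a = 0 := by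
    intro l
    induction l with
    | zero =>
      intro _ a ha _
      refine H S ((Finset.subset_insert _ _).trans hsub) (c + 1) _ (by omega) ?_ a ?_
      · rw [Finset.sum_range_succ]; omega
      · intro i' hi'; exact ha i' (by rw [Fin.lt_def]; omega)
    | succ l ih =>
      intro hl a ha hla
      obtain ⟨a', rfl⟩ : ∃ a', a = a' + Pi.single i 1 := by
        refine ⟨a - Pi.single i 1, (tsub_add_cancel_of_le fun i' => ?_).symm⟩
        by_cases h : i' = i
        · subst h; rw [Pi.single_eq_same]; exact le_trans (Nat.le_add_left 1 l) hla
        · simp [h]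
      have ha' : ∀ i' : Fin d, i < i' → a' i' = b i' := by
        intro i' hi'
        have := ha i' hi'
        simpa [hi'.ne'] using this
      have e : r + j - l = (r + j - (l + 1)) + 1 := by omega
      rw [shiftSum_eq_sub hiS, ← e, ih (by omega) a' ha' (by simpa using hla), sub_zero]
      refine H _ hsub c _ ?_ (by omega) a' ?_
      · rw [Finset.card_insert_of_notMem hiS]; omega
      · intro i' hi'; exact ha' i' (by rw [Fin.lt_def]; omega)
  have := key j le_rfl a ha haj
  rwa [Nat.add_sub_cancel] at this

/-- Freezing the coordinate `i` at its leading value `b i` removes one box from the partition, in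
the last row longer than `b i`. This choice keeps the rows decreasing, and the vanishing conditions
for the smaller partition come from the maximality of `b`. -/
lemma RowVanish.exists_row {φ : (Fin d → ℕ) → ℂ} {b : Fin d → ℕ} {i : Fin d} {ρ : ℕ → ℕ}
    (H : RowVanish φ b (i + 1) ρ) (hρ : Antitone ρ)
    (hsum : ∀ c, ∑ h ∈ Finset.range c, ρ h ≤ i + 1) (hb : φ b ≠ 0)
    (hmax : ∀ a : Fin d → ℕ, (∀ i', i < i' → a i' = b i') → b i < a i → φ a = 0) :
    ∃ ρ' : ℕ → ℕ, ∃ h, ρ = ρ' + Pi.single h 1 ∧ b i < ρ h ∧ Antitone ρ' ∧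
      (∀ c, ∑ h ∈ Finset.range c, ρ' h ≤ i) ∧ RowVanish φ b i ρ' := by
  classical
  -- The partition has at most `i + 1` boxes, so the first `i + 2` rows cannot all be nonempty.
  have hex : ∃ h, ρ h ≤ b i := by
    by_contra! hcon
    have h1 := hsum (i + 2)
    have h2 : ∑ h ∈ Finset.range (i + 2), 1 ≤ ∑ h ∈ Finset.range ((i : ℕ) + 2), ρ h :=
      Finset.sum_le_sum fun h _ => by have := hcon h; omega
    simp at h2
    omega
  obtain ⟨H0, hH0, hH0'⟩ : ∃ H0, ρ H0 ≤ b i ∧ ∀ h < H0, b i < ρ h :=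
    ⟨Nat.find hex, Nat.find_spec hex, fun h hh => not_le.1 (Nat.find_min hex hh)⟩
  -- If already the longest row were at most `b i`, the case `r = 0` with empty complement would
  -- give `φ b = 0`.
  have hpos : H0 ≠ 0 := by
    rintro rfl
    apply hb
    rw [← shiftSum_zero (initSeg d i) φ b]
    refine H.shiftSum_eq_zero subset_rfl (c := 0) (j := b i) ?_ (by simp) hH0 (fun _ _ => rfl)
      le_rfl
    rw [card_initSeg i.2.le]; omega
  obtain ⟨h, rfl⟩ : ∃ h, H0 = h + 1 := ⟨H0 - 1, by omega⟩
  have hh := hH0' h (by omega)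
  set ρ' : ℕ → ℕ := ρ - Pi.single h 1 with hρ'
  have e : ρ = ρ' + Pi.single h 1 := by
    funext h'
    by_cases hc : h' = h
    · subst hc; simp [hρ']; omega
    · simp [hρ', hc]
  have hs : ∀ c, ∑ h' ∈ Finset.range c, ρ h' =
      ∑ h' ∈ Finset.range c, ρ' h' + if h < c then 1 else 0 := by
    intro c
    conv_lhs => rw [e]
    simp [Finset.sum_add_distrib]
  have hρ'h : ∀ h', h' ≠ h → ρ' h' = ρ h' := fun h' hc => by simp [hρ', hc]
  have hρ'h' : ρ' h + 1 = ρ h := by simp [hρ']; omega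
  refine ⟨ρ', h, e, hh, ?_, ?_, ?_⟩
  · refine antitone_nat_of_succ_le fun k => ?_
    have := hρ (Nat.le_succ k)
    by_cases h1 : k = h
    · subst h1
      rw [hρ'h (k + 1) (by omega)]; omega
    · rw [hρ'h k h1]
      by_cases h2 : k + 1 = h
      · rw [h2]; rw [Nat.succ_eq_add_one, h2] at this; omega
      · rw [hρ'h _ h2]; exact this
  · intro c
    have h1 := hs c
    have h2 := hsum c
    split_ifs at h1 with hc
    · omega
    · have h3 : ∑ h' ∈ Finset.range c, ρ h' ≤ ∑ h' ∈ Finset.range h, ρ h' :=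
        Finset.sum_le_sum_of_subset (Finset.range_subset_range.2 (by omega))
      have h4 := hsum (h + 1)
      rw [Finset.sum_range_succ] at h4
      omega
  · intro S hS c r hc hr a ha
    have hiS : i ∉ S := fun h => notMem_initSeg i (hS h)
    have hsub : insert i S ⊆ initSeg d (i + 1) := by
      rw [initSeg_succ]; exact Finset.insert_subset_insert _ hS
    have ha' : ∀ i' : Fin d, i < i' → a i' = b i' := fun i' hi' => ha i' hi'.le
    have h1 := hs c
    -- If the bound already held for `ρ`, then `insert i S` gives vanishing, and the correction term
    -- has its exponent at `i` raised above `b i`, hence is zero by maximality. Otherwise the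
    -- removed box lies in the first `c` rows and the degree is exactly critical for `ρ`.
    by_cases hlt : ∑ h ∈ Finset.range c, ρ h < r + c
    · have hins : shiftSum (insert i S) r φ a = 0 := by
        refine H _ hsub c _ ?_ hlt a fun i' hi' => ha' i' (by rw [Fin.lt_def]; omega)
        rw [Finset.card_insert_of_notMem hiS]; omega
      cases r with
      | zero => rw [shiftSum_zero] at hins ⊢; exact hins
      | succ r =>
        rw [shiftSum_succ_eq_sub hiS, hins, zero_sub, neg_eq_zero]
        refine Finset.sum_eq_zero fun T hT => hmax _ ?_ ?_
        · intro i' hi'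
          have hT' : i' ∉ T := fun hm => by
            have := mem_initSeg.1 (hS ((Finset.mem_powersetCard.1 hT).1 hm))
            rw [Fin.lt_def] at hi'; omega
          simp [indic, hT', hi'.ne', ha' i' hi']
        · simp only [Pi.add_apply, Pi.single_eq_same, ha i le_rfl]
          omega
    · split_ifs at h1 with hc'
      · exact H.shiftSum_eq_zero hS hc (j := b i) (by omega)
          ((hρ (by omega : h + 1 ≤ c)).trans hH0) ha' (ha i le_rfl).ge
      · omega

/-- The leading exponent `b` decomposes into blocks of sizes `ρ h`. -/
lemma RowVanish.exists_blocks {φ : (Fin d → ℕ) → ℂ} {b : Fin d → ℕ} (hb : φ b ≠ 0)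
    (hmax : ∀ i, ∀ a : Fin d → ℕ, (∀ i', i < i' → a i' = b i') → b i < a i → φ a = 0) :
    ∀ m ≤ d, ∀ ρ : ℕ → ℕ, Antitone ρ → (∀ c, ∑ h ∈ Finset.range c, ρ h ≤ m) →
      RowVanish φ b m ρ → ∃ p : Fin d → ℕ,
        (∀ i : Fin d, (i : ℕ) < m → b i < (Finset.univ.filter fun i' => i' ≤ i ∧ p i' = p i).card) ∧
        ∀ h, (Finset.univ.filter fun i : Fin d => (i : ℕ) < m ∧ p i = h).card = ρ h := by
  intro m
  induction m with
  | zero =>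
    intro _ ρ _ hsum _
    refine ⟨0, by simp, fun h => ?_⟩
    have := hsum (h + 1)
    rw [Finset.sum_range_succ] at this
    simp; omega
  | succ m ih =>
    intro hm ρ hρ hsum H
    obtain ⟨ρ', h, e, hh, hρ', hsum', H'⟩ :=
      RowVanish.exists_row (i := ⟨m, hm⟩) H hρ hsum hb (hmax _)
    obtain ⟨p, hp1, hp2⟩ := ih (by omega) ρ' hρ' hsum' H'
    set i0 : Fin d := ⟨m, hm⟩ with hi0
    -- The coordinate `m` joins block `h`, the row that lost a box; its rank in that block is then
    -- `ρ h - 1`, which is at least the leading exponent.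
    have hpu : ∀ i : Fin d, (i : ℕ) < m → Function.update p i0 h i = p i := fun i hi =>
      Function.update_of_ne (fun hc => by rw [hc, hi0] at hi; simp at hi) _ _
    have hcard : ∀ h', (Finset.univ.filter fun i : Fin d =>
        (i : ℕ) < m + 1 ∧ Function.update p i0 h i = h').card = ρ h' := by
      intro h'
      rw [e, Pi.add_apply, ← hp2 h']
      by_cases hc : h' = h
      · subst hc
        rw [Pi.single_eq_same, ← Finset.card_insert_of_notMem (a := i0)]
        · congr 1
          ext i
          simp only [Finset.mem_filter, Finset.mem_univ, true_and, Finset.mem_insert]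
          by_cases hi : i = i0
          · simp [hi, hi0]
          · have : (i : ℕ) ≠ m := fun hc => hi (Fin.ext hc)
            rw [Function.update_of_ne hi]
            simp [hi]; omega
        · simp [hi0]
      · rw [Pi.single_eq_of_ne hc, add_zero]
        congr 1
        ext i
        simp only [Finset.mem_filter, Finset.mem_univ, true_and]
        by_cases hi : i = i0
        · simp [hi, hi0, Ne.symm hc]
        · have : (i : ℕ) ≠ m := fun hc => hi (Fin.ext hc)
          rw [Function.update_of_ne hi]
          constructor <;> rintro ⟨h1, h2⟩ <;> exact ⟨by omega, h2⟩
    refine ⟨Function.update p i0 h, fun i hi => ?_, hcard⟩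
    rcases Nat.lt_succ_iff_lt_or_eq.1 hi with hi | hi
    · convert hp1 i hi using 2
      refine Finset.filter_congr fun i' _ => and_congr_right fun hle => ?_
      rw [hpu i hi, hpu i' (lt_of_le_of_lt (Fin.le_def.1 hle) hi)]
    · have : i = i0 := Fin.ext hi
      subst this
      have h2 := hcard h
      rw [Function.update_self]
      refine lt_of_lt_of_le hh (h2.symm.le.trans (Finset.card_le_card fun i' => ?_))
      simp only [Finset.mem_filter, Finset.mem_univ, true_and]
      rintro ⟨h3, h4⟩
      exact ⟨Fin.le_def.2 (by omega), h4⟩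

/-- The row lengths of the partition of `d` with all rows of length `k + 1`, except the last. -/
def rowLength (d k h : ℕ) : ℕ := min d ((h + 1) * (k + 1)) - min d (h * (k + 1))

lemma rowLength_le (d k h : ℕ) : rowLength d k h ≤ k + 1 := by
  unfold rowLength
  have : (h + 1) * (k + 1) = h * (k + 1) + (k + 1) := by ring
  omega

lemma rowLength_antitone (d k : ℕ) : Antitone (rowLength d k) := by
  refine antitone_nat_of_succ_le fun h => ?_
  unfold rowLength
  have h1 : (h + 1) * (k + 1) = h * (k + 1) + (k + 1) := by ring
  have h2 : (h + 1 + 1) * (k + 1) = h * (k + 1) + (k + 1) + (k + 1) := by ring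
  omega

lemma sum_rowLength (d k c : ℕ) :
    ∑ h ∈ Finset.range c, rowLength d k h = min d (c * (k + 1)) := by
  induction c with
  | zero => simp
  | succ c ih =>
    rw [Finset.sum_range_succ, ih]
    unfold rowLength
    have h1 : (c + 1) * (k + 1) = c * (k + 1) + (k + 1) := by ring
    omega

/-- Modulo the positive-degree symmetric polynomials, `e_r(S)` is up to sign the complete symmetric
polynomial of degree `r` in the `c` remaining shifts. Each of these has vanishing `(k + 1)`-st
power, so nothing survives beyond degree `c * k`. -/
lemma IsHarmonic.shiftSum_eq_zero {φ : (Fin d → ℕ) → ℂ} {k : ℕ} (hφ : IsHarmonic φ)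
    (hk : ∀ a, φ a ≠ 0 → ∀ i, a i ≤ k) (c : ℕ) : ∀ S : Finset (Fin d), S.card + c = d →
    ∀ r, c * k < r → ∀ a, shiftSum S r φ a = 0 := by
  induction c with
  | zero =>
    intro S hS r hr a
    have : S = Finset.univ := by
      rw [← Finset.card_eq_iff_eq_univ]; simpa using hS
    obtain ⟨r, rfl⟩ : ∃ s, r = s + 1 := ⟨r - 1, by omega⟩
    rw [this]; exact hφ r a
  | succ c ih =>
    intro S hS r hr a
    obtain ⟨i, hi⟩ : ∃ i, i ∉ S := by
      by_contra! h
      have : S = Finset.univ := by ext; simp [h]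
      rw [this] at hS; simp at hS
    -- Descent on the distance `l` from the exponent at `i` to `k + 1`, where `φ` is zero by the
    -- bound on its order.
    have key : ∀ l r, c * k + l ≤ r → ∀ a : Fin d → ℕ, k + 1 ≤ a i + l →
        shiftSum S r φ a = 0 := by
      intro l
      induction l with
      | zero =>
        intro r _ a ha
        refine Finset.sum_eq_zero fun T _ => ?_
        by_contra hne
        have := hk _ hne i
        simp only [Pi.add_apply] at this
        omega
      | succ l ihl =>
        intro r hr a ha
        obtain ⟨r, rfl⟩ : ∃ s, r = s + 1 := ⟨r - 1, by omega⟩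
        rw [shiftSum_succ_eq_sub hi, ihl r (by omega) _ (by simp; omega), sub_zero]
        refine ih _ ?_ _ (by omega) a
        rw [Finset.card_insert_of_notMem hi]; omega
    have hck : (c + 1) * k = c * k + k := by ring
    exact key (k + 1) r (by omega) a (by omega)

lemma IsHarmonic.rowVanish {φ : (Fin d → ℕ) → ℂ} {k : ℕ} (hφ : IsHarmonic φ)
    (hk : ∀ a, φ a ≠ 0 → ∀ i, a i ≤ k) (b : Fin d → ℕ) :
    RowVanish φ b d (rowLength d k) := by
  intro S _ c r hc hr a _
  rw [sum_rowLength] at hr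
  have hck : c * (k + 1) = c * k + c := by ring
  rcases min_lt_iff.1 hr with h | h
  · exact shiftSum_of_card_lt (by omega) _ _
  · exact hφ.shiftSum_eq_zero hk c S hc r (by omega) a

/-- The colexicographically largest exponent of a harmonic function of order at most `k`
decomposes into staircase blocks of sizes at most `k + 1`. -/
theorem IsHarmonic.exists_blocks {φ : (Fin d → ℕ) → ℂ} {k : ℕ} (hφ : IsHarmonic φ)
    (hk : ∀ a, φ a ≠ 0 → ∀ i, a i ≤ k) {b : Fin d → ℕ} (hb : φ b ≠ 0)
    (hmax : ∀ a, φ a ≠ 0 → toColex a ≤ toColex b) :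
    ∃ p : Fin d → ℕ,
      (∀ i, b i < (Finset.univ.filter fun i' => i' ≤ i ∧ p i' = p i).card) ∧
      ∀ h, (Finset.univ.filter fun i => p i = h).card = rowLength d k h := by
  have hmax' : ∀ i, ∀ a : Fin d → ℕ, (∀ i', i < i' → a i' = b i') → b i < a i → φ a = 0 := by
    intro i a ha hlt
    by_contra hne
    exact absurd (Pi.apply_le_of_toColex (hmax a hne) ha) (not_le.2 hlt)
  obtain ⟨p, h1, h2⟩ := RowVanish.exists_blocks hb hmax' d le_rfl _ (rowLength_antitone d k)
    (fun c => by rw [sum_rowLength]; exact min_le_left _ _) (hφ.rowVanish hk b)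
  exact ⟨p, fun i => h1 i i.2, fun h => by simpa using h2 h⟩

end LeadingExponent

/-! ### Lexicographic rewriting of the values of a harmonic function -/

section Rewriting

variable {d : ℕ} {M : Type*} [AddCommGroup M] [Module ℂ M] {ψ : (Fin d → ℕ) → M}
  {Q : Submodule ℂ M}

/-- On harmonic functions, `e_s` of the first `m` shifts equals, up to sign, the complete symmetric
polynomial `h_s` of the other shifts, so it only involves monomials in the latter. -/
lemma IsHarmonic.shiftSum_initSeg_mem (hψ : IsHarmonic ψ) (t : ℕ) :
    ∀ m, m + t = d → ∀ s (a : Fin d → ℕ),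
      (∀ b : Fin d → ℕ, (∀ i : Fin d, (i : ℕ) < m → b i = 0) → ∑ i, b i = s → ψ (a + b) ∈ Q) →
      shiftSum (initSeg d m) s ψ a ∈ Q := by
  induction t with
  | zero =>
    intro m hm s a h
    obtain rfl : m = d := by omega
    cases s with
    | zero => rw [shiftSum_zero]; simpa using h 0 (by simp) (by simp)
    | succ s => rw [initSeg_self, hψ s a]; exact Q.zero_mem
  | succ t iht =>
    intro m hm s
    have hmd : m < d := by omega
    have hins := initSeg_succ (⟨m, hmd⟩ : Fin d)
    have hnot := notMem_initSeg (⟨m, hmd⟩ : Fin d)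
    simp only at hins hnot
    induction s with
    | zero => intro a h; rw [shiftSum_zero]; simpa using h 0 (by simp) (by simp)
    | succ s ihs =>
      intro a h
      rw [shiftSum_succ_eq_sub hnot, ← hins]
      refine Q.sub_mem (iht (m + 1) (by omega) _ a fun b hb hs => h b (fun i hi => hb i (by omega)) hs)
        (ihs _ fun b hb hs => ?_)
      rw [add_assoc]
      refine h _ (fun i hi => ?_) ?_
      · have : i ≠ ⟨m, hmd⟩ := fun hc => by rw [hc] at hi; simp at hi
        simp [this, hb i hi]
      · simp [Finset.sum_add_distrib, hs, add_comm]

/-- The relation `h_r(x_l, …, x_{d-1}) = ± e_r(x_0, …, x_{l-1})`, solved for the term `x_l^r`. The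
other terms contain `x_l` to a lower power, times shifts of later coordinates only. -/
lemma IsHarmonic.mem_of_shiftSum_mem (hψ : IsHarmonic ψ) (l : Fin d) (r : ℕ) :
    ∀ a : Fin d → ℕ, shiftSum (initSeg d l) r ψ a ∈ Q →
      (∀ c < r, ∀ b : Fin d → ℕ, (∀ i ≤ l, b i = 0) → ψ (a + Pi.single l c + b) ∈ Q) →
      ψ (a + Pi.single l r) ∈ Q := by
  induction r with
  | zero => intro a h _; rw [shiftSum_zero] at h; simpa using h
  | succ r ih =>
    intro a h hc
    have e : a + Pi.single l (r + 1) = a + Pi.single l 1 + Pi.single l r := by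
      rw [add_assoc, ← Pi.single_add, add_comm 1 r]
    rw [e]
    refine ih _ ?_ fun c hcr b hb => ?_
    · rw [shiftSum_eq_sub (notMem_initSeg l), ← initSeg_succ]
      refine Q.sub_mem (hψ.shiftSum_initSeg_mem (d - (l + 1)) _ (by omega) _ _ fun b hb _ => ?_) h
      have := hc 0 (by omega) b fun i hi => hb i (by rw [Fin.le_def] at hi; omega)
      simpa using this
    · have := hc (c + 1) (by omega) b hb
      rwa [add_comm c 1, Pi.single_add, ← add_assoc] at this

/-- One rewriting step: the terms replacing `x_l^r` agree with `a` before `l` and are smaller at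
`l`, hence are lexicographically smaller. Only the term in `e_r` of the earlier shifts has to be
treated separately. -/
lemma IsHarmonic.mem_of_lex (hψ : IsHarmonic ψ) (l : Fin d) (r : ℕ) (a : Fin d → ℕ)
    (hr : r ≤ a l) (h : shiftSum (initSeg d l) r ψ (a - Pi.single l r) ∈ Q)
    (hlt : ∀ a' : Fin d → ℕ, toLex a' < toLex a → ψ a' ∈ Q) : ψ a ∈ Q := by
  have e : a = (a - Pi.single l r) + Pi.single l r := by
    refine (tsub_add_cancel_of_le fun i => ?_).symm
    by_cases hi : i = l
    · subst hi; simpa using hr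
    · simp [hi]
  have := hψ.mem_of_shiftSum_mem l r (a - Pi.single l r) h fun c hc b hb => ?_
  · rwa [← e] at this
  · refine hlt _ ⟨l, fun i hi => ?_, ?_⟩
    · simp [hi.ne, hb i hi.le]
    · have := hb l le_rfl
      simp [this]; omega

/-- The values of a harmonic function lie in the span of its values at the exponents below the
staircase. -/
theorem IsHarmonic.mem_of_staircase (hψ : IsHarmonic ψ)
    (h : ∀ a : Fin d → ℕ, (∀ i, a i ≤ i) → ψ a ∈ Q) (a : Fin d → ℕ) : ψ a ∈ Q := by
  suffices ∀ a : Lex (Fin d → ℕ), ψ (ofLex a) ∈ Q from this (toLex a)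
  intro a
  induction a using WellFoundedLT.induction with
  | ind a ih =>
    by_cases ha : ∀ i, ofLex a i ≤ i
    · exact h _ ha
    · push Not at ha
      obtain ⟨l, hl⟩ := ha
      -- With `r = l + 1` the separate term is an elementary symmetric polynomial of degree `l + 1`
      -- in `l` shifts, which is zero.
      refine hψ.mem_of_lex l (l + 1) _ hl ?_ fun a' ha' => ih _ ha'
      rw [shiftSum_of_card_lt (by rw [card_initSeg l.2.le]; omega)]
      exact Q.zero_mem

/-- Refinement of `IsHarmonic.mem_of_staircase`, given the exponents with at most one zero. -/
theorem IsHarmonic.mem_of_refined_staircase (hψ : IsHarmonic ψ)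
    (h0 : ∀ a : Fin d → ℕ, (∀ i j, a i = 0 → a j = 0 → i = j) → ψ a ∈ Q)
    (h1 : ∀ (a : Fin d → ℕ) (i : Fin d), (∀ l, a l ≤ l) → a i = 0 → (∀ j, i < j → a j < j) →
      ψ a ∈ Q) (a : Fin d → ℕ) : ψ a ∈ Q := by
  suffices ∀ a : Lex (Fin d → ℕ), ψ (ofLex a) ∈ Q from this (toLex a)
  intro a
  induction a using WellFoundedLT.induction with
  | ind a ih =>
    by_cases ha : ∀ i, ofLex a i ≤ i
    · by_cases hz : ∃ i, ofLex a i = 0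
      · obtain ⟨i, hi, hmax⟩ : ∃ i, ofLex a i = 0 ∧ ∀ j, i < j → ofLex a j ≠ 0 := by
          obtain ⟨i, hi, hm⟩ := (Finset.univ.filter fun i => ofLex a i = 0).exists_max_image id
            ⟨hz.choose, Finset.mem_filter.2 ⟨Finset.mem_univ _, hz.choose_spec⟩⟩
          refine ⟨i, (Finset.mem_filter.1 hi).2, fun j hj hj0 => ?_⟩
          exact absurd (hm j (Finset.mem_filter.2 ⟨Finset.mem_univ _, hj0⟩)) (not_le.2 hj)
        by_cases hj : ∀ j, i < j → ofLex a j < j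
        · exact h1 _ i ha hi hj
        · push Not at hj
          obtain ⟨j, hij, hj⟩ := hj
          have hjj : ofLex a j = j := le_antisymm (ha j) hj
          -- Here `i` is the last zero of `a` and `j > i` lies on the diagonal. With `r = j` the
          -- separate term is the single product of the shifts before `j`. It makes all earlier
          -- exponents positive, and the later ones are already positive, so at most the entry at
          -- `j` is zero and `h0` applies.
          refine hψ.mem_of_lex j j _ hj ?_ fun a' ha' => ih _ ha'
          have hcard := shiftSum_card (initSeg d j) ψ (ofLex a - Pi.single j (j : ℕ))
          rw [card_initSeg j.2.le] at hcard
          rw [hcard]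
          refine h0 _ ?_
          have hne : ∀ l, l ≠ j →
              ((ofLex a - Pi.single j (j : ℕ) + indic (initSeg d j) : Fin d → ℕ)) l ≠ 0 := by
            intro l hl
            rcases lt_or_gt_of_ne hl with hlt | hgt
            · simp [indic, mem_initSeg, hlt]
            · have := hmax l (hij.trans hgt)
              simp only [Pi.add_apply, Pi.sub_apply, Pi.single_eq_of_ne hl]
              omega
          intro l l' hl hl'
          by_contra hll
          rcases eq_or_ne l j with rfl | h3
          · exact hne l' (Ne.symm hll) hl'
          · exact hne l h3 hl
      · exact h0 _ fun i _ hi => absurd ⟨i, hi⟩ hz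
    · push Not at ha
      obtain ⟨l, hl⟩ := ha
      refine hψ.mem_of_lex l (l + 1) _ hl ?_ fun a' ha' => ih _ ha'
      rw [shiftSum_of_card_lt (by rw [card_initSeg l.2.le]; omega)]
      exact Q.zero_mem

end Rewriting

/-! ### Harmonicity of determinants -/

section Determinants

variable {d : ℕ} {A : Type*} [CommRing A]

/-- A determinant in the columns `c l (a l)` is harmonic in `a`, provided `c l (s + 1)` is the
image of `c l s` under a fixed strictly lower triangular matrix. -/
theorem isHarmonic_det (c : Fin d → ℕ → Fin d → A) (B : Matrix (Fin d) (Fin d) A)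
    (hB : ∀ i j, i ≤ j → B i j = 0) (hc : ∀ l s, c l (s + 1) = B.mulVec (c l s)) :
    IsHarmonic fun a : Fin d → ℕ => Matrix.det (Matrix.of fun i l => c l (a l) i) := by
  have htr : ∀ a : Fin d → ℕ, Matrix.det (Matrix.of fun i l => c l (a l) i) =
      Matrix.detRowAlternating fun l => c l (a l) := by
    intro a
    rw [← Matrix.det_transpose]; rfl
  intro r a
  simp only [shiftSum]
  set m0 : Fin d → Fin d → Polynomial A := fun l i => Polynomial.C (c l (a l) i) with hm0
  set m1 : Fin d → Fin d → Polynomial A := fun l i => Polynomial.C (c l (a l + 1) i) with hm1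
  -- Replacing every column `v` by `(1 + X B) v` does not change the determinant, since `1 + X B` is
  -- unitriangular.
  have h1 : Matrix.detRowAlternating ((fun l => (Polynomial.X : Polynomial A) • m1 l) + m0) =
      Polynomial.C (Matrix.det (Matrix.of fun i l => c l (a l) i)) := by
    have e : Matrix.det (Matrix.transpose
        (Matrix.of ((fun l => (Polynomial.X : Polynomial A) • m1 l) + m0))) =
        Matrix.det ((1 + (Polynomial.X : Polynomial A) • B.map Polynomial.C) *
          (Matrix.of fun i l => c l (a l) i).map Polynomial.C) := by
      congr 1
      ext1 i l
      rw [add_mul, one_mul, smul_mul_assoc, ← Matrix.map_mul]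
      simp only [Matrix.transpose_apply, Matrix.of_apply, Pi.add_apply, Pi.smul_apply,
        Matrix.add_apply, Matrix.smul_apply, Matrix.map_apply, hm0, hm1, hc]
      rw [add_comm]
      rfl
    rw [Matrix.det_transpose] at e
    refine e.trans ?_
    rw [Matrix.det_mul, Matrix.det_of_isLowerTriangular]
    · rw [Finset.prod_eq_one, one_mul]
      · exact (RingHom.map_det (Polynomial.C : A →+* Polynomial A) _).symm
      · intro i _; simp [hB i i le_rfl]
    · intro i j hij
      have hij' : i < j := hij
      simp [hB i j hij'.le, hij'.ne]
  -- Multilinear expansion of the same determinant: the coefficient of `X^r` is the action of the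
  -- `r`-th elementary symmetric polynomial in the shifts. The positive-degree coefficients must
  -- therefore vanish.
  have h2 : Matrix.detRowAlternating ((fun l => (Polynomial.X : Polynomial A) • m1 l) + m0) =
      ∑ T : Finset (Fin d), (Polynomial.X : Polynomial A) ^ T.card *
        Polynomial.C (Matrix.det (Matrix.of fun i l => c l ((a + indic T) l) i)) := by
    rw [AlternatingMap.map_add_univ]
    refine Finset.sum_congr rfl fun T _ => ?_
    have e : T.piecewise (fun l => (Polynomial.X : Polynomial A) • m1 l) m0 =
        T.piecewise (fun l => (Polynomial.X : Polynomial A) • (T.piecewise m1 m0) l)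
          (T.piecewise m1 m0) := by
      funext l
      by_cases hl : l ∈ T <;> simp [hl]
    rw [e]
    have := MultilinearMap.map_piecewise_smul
      (Matrix.detRowAlternating (n := Fin d) (R := Polynomial A)).toMultilinearMap
      (fun _ => (Polynomial.X : Polynomial A)) (T.piecewise m1 m0) T
    simp only [AlternatingMap.coe_multilinearMap, Finset.prod_const] at this
    rw [this, smul_eq_mul]
    congr 1
    rw [htr]
    refine Eq.trans ?_ (RingHom.map_det (Polynomial.C : A →+* Polynomial A) _).symm
    refine congrArg Matrix.det ?_
    ext1 l i
    change _ = Polynomial.C (c l ((a + indic T) l) i)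
    by_cases hl : l ∈ T <;> simp [hl, hm0, hm1, indic]
  have h3 := congrArg (fun q => Polynomial.coeff q (r + 1)) (h1.symm.trans h2)
  simp only [Polynomial.coeff_C_succ, Polynomial.finsetSum_coeff, Polynomial.coeff_X_pow_mul',
    Polynomial.coeff_C] at h3
  rw [h3, ← Finset.sum_subset (Finset.subset_univ (Finset.powersetCard (r + 1) Finset.univ))]
  · refine Finset.sum_congr rfl fun T hT => ?_
    have := (Finset.mem_powersetCard.1 hT).2
    simp [this]
  · intro T _ hT
    have : T.card ≠ r + 1 := fun h => hT (Finset.mem_powersetCard.2 ⟨Finset.subset_univ _, h⟩)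
    split_ifs <;> first | rfl | omega

end Determinants

/-! ### Products of Vandermonde determinants span the harmonic functions of bounded order -/

section Blocks

variable {d : ℕ}

/-- The number of earlier indices in the same block as `i`. -/
def blockRank (p : Fin d → ℕ) (i : Fin d) : ℕ :=
  (Finset.univ.filter fun i' => i' < i ∧ p i' = p i).card

lemma blockRank_lt {p : Fin d → ℕ} {i j : Fin d} (hp : p i = p j) (h : i < j) :
    blockRank p i < blockRank p j := by
  refine Finset.card_lt_card (Finset.ssubset_iff_of_subset ?_ |>.2 ⟨i, ?_, ?_⟩)
  · intro l
    simp only [Finset.mem_filter, Finset.mem_univ, true_and]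
    rintro ⟨h1, h2⟩
    exact ⟨h1.trans h, h2.trans hp⟩
  · simp [h, hp]
  · simp

lemma blockRank_injective {p : Fin d → ℕ} {i j : Fin d} (hp : p i = p j)
    (h : blockRank p i = blockRank p j) : i = j := by
  rcases lt_trichotomy i j with hl | he | hl
  · exact absurd h (blockRank_lt hp hl).ne
  · exact he
  · exact absurd h (blockRank_lt hp.symm hl).ne'

lemma card_filter_le_eq_blockRank_add_one (p : Fin d → ℕ) (i : Fin d) :
    (Finset.univ.filter fun i' => i' ≤ i ∧ p i' = p i).card = blockRank p i + 1 := by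
  rw [blockRank, ← Finset.card_insert_of_notMem (a := i)]
  · congr 1
    ext l
    simp only [Finset.mem_filter, Finset.mem_univ, true_and, Finset.mem_insert, le_iff_lt_or_eq]
    constructor
    · rintro ⟨h | h, h'⟩
      · exact Or.inr ⟨h, h'⟩
      · exact Or.inl h
    · rintro (rfl | ⟨h, h'⟩)
      · exact ⟨Or.inr rfl, rfl⟩
      · exact ⟨Or.inl h, h'⟩
  · simp

lemma blockRank_lt_card (p : Fin d → ℕ) (i : Fin d) :
    blockRank p i < (Finset.univ.filter fun i' => p i' = p i).card := by
  rw [Nat.lt_iff_add_one_le, ← card_filter_le_eq_blockRank_add_one]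
  exact Finset.card_le_card fun l => by simp

lemma exists_blockRank_add_one_eq {p : Fin d → ℕ} {i : Fin d} (h : blockRank p i ≠ 0) :
    ∃ j, p j = p i ∧ blockRank p j + 1 = blockRank p i := by
  obtain ⟨j, hj, hm⟩ := (Finset.univ.filter fun i' => i' < i ∧ p i' = p i).exists_max_image id
    (Finset.card_ne_zero.1 h)
  simp only [Finset.mem_filter, Finset.mem_univ, true_and, id] at hj hm
  refine ⟨j, hj.2, ?_⟩
  rw [← card_filter_le_eq_blockRank_add_one, blockRank]
  congr 1
  ext l
  simp only [Finset.mem_filter, Finset.mem_univ, true_and, hj.2]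
  constructor
  · rintro ⟨h1, h2⟩; exact ⟨h1.trans_lt hj.1, h2⟩
  · rintro ⟨h1, h2⟩; exact ⟨hm l ⟨h1, h2⟩, h2⟩

/-- The harmonic function given by the product of the derivatives `∂^c` of the Vandermonde
determinants in the blocks of `p`. -/
def blockVandermonde (p c a : Fin d → ℕ) : ℂ :=
  Matrix.det (Matrix.of fun i l : Fin d =>
    if p i = p l ∧ blockRank p i = a l + c l then ((blockRank p i).factorial : ℂ) else 0)

lemma isHarmonic_blockVandermonde (p c : Fin d → ℕ) : IsHarmonic (blockVandermonde p c) := by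
  refine isHarmonic_det (fun l s i => if p i = p l ∧ blockRank p i = s + c l then
    ((blockRank p i).factorial : ℂ) else 0)
    (Matrix.of fun i j => if p i = p j ∧ blockRank p i = blockRank p j + 1 then
      (blockRank p i : ℂ) else 0) ?_ ?_
  · intro i j hij
    simp only [Matrix.of_apply]
    rw [if_neg]
    rintro ⟨h1, h2⟩
    rcases hij.lt_or_eq with h | h
    · have := blockRank_lt h1 h; omega
    · rw [h] at h2; omega
  · intro l s
    funext i
    simp only [Matrix.mulVec, dotProduct, Matrix.of_apply]
    by_cases h : p i = p l ∧ blockRank p i = s + 1 + c l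
    · obtain ⟨j, hj1, hj2⟩ := exists_blockRank_add_one_eq (p := p) (i := i) (by omega)
      rw [if_pos h, Finset.sum_eq_single j]
      · rw [if_pos ⟨hj1.symm, hj2.symm⟩, if_pos ⟨hj1.trans h.1, by omega⟩, ← hj2,
          Nat.factorial_succ]
        push_cast; ring
      · intro j' _ hj'
        rw [if_neg, zero_mul]
        rintro ⟨h1, h2⟩
        exact hj' (blockRank_injective (h1.symm.trans hj1.symm) (by omega))
      · simp
    · rw [if_neg h, Finset.sum_eq_zero]
      intro j _
      by_cases h1 : p i = p j ∧ blockRank p i = blockRank p j + 1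
      · rw [if_neg (c := p j = p l ∧ _), mul_zero]
        rintro ⟨h2, h3⟩
        exact h ⟨h1.1.trans h2, by omega⟩
      · rw [if_neg h1, zero_mul]

/-- At this exponent the matrix is diagonal with factorials on the diagonal, because an index is
determined by its block and its rank there. -/
lemma blockVandermonde_ne_zero {p c a : Fin d → ℕ} (h : a + c = blockRank p) :
    blockVandermonde p c a ≠ 0 := by
  have : (Matrix.of fun i l : Fin d => if p i = p l ∧ blockRank p i = a l + c l then
      ((blockRank p i).factorial : ℂ) else 0) =
      Matrix.diagonal fun i => ((blockRank p i).factorial : ℂ) := by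
    ext i l
    have hl : a l + c l = blockRank p l := congrFun h l
    rw [Matrix.of_apply, hl]
    by_cases hil : i = l
    · subst hil; simp
    · rw [Matrix.diagonal_apply_ne _ hil, if_neg]
      rintro ⟨h1, h2⟩
      exact hil (blockRank_injective h1 h2)
  rw [blockVandermonde, this, Matrix.det_diagonal]
  exact Finset.prod_ne_zero_iff.2 fun i _ => by exact_mod_cast Nat.factorial_ne_zero _

lemma exists_perm_of_blockVandermonde_ne_zero {p c a : Fin d → ℕ}
    (h : blockVandermonde p c a ≠ 0) :
    ∃ σ : Equiv.Perm (Fin d), ∀ l, p (σ l) = p l ∧ blockRank p (σ l) = a l + c l := by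
  rw [blockVandermonde, Matrix.det_apply] at h
  obtain ⟨σ, -, hσ⟩ := Finset.exists_ne_zero_of_sum_ne_zero h
  refine ⟨σ, fun l => ?_⟩
  by_contra hl
  refine hσ ?_
  rw [Finset.prod_eq_zero (Finset.mem_univ l), smul_zero]
  rw [Matrix.of_apply, if_neg hl]

lemma blockVandermonde_le {p c a : Fin d → ℕ} {k : ℕ}
    (hp : ∀ h, (Finset.univ.filter fun i => p i = h).card ≤ k + 1)
    (h : blockVandermonde p c a ≠ 0) (i : Fin d) : a i ≤ k := by
  obtain ⟨σ, hσ⟩ := exists_perm_of_blockVandermonde_ne_zero h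
  have h1 := (hσ i).2
  have h2 := blockRank_lt_card p (σ i)
  have h3 := hp (p (σ i))
  omega

/-- A nonzero term of the determinant is a block-preserving permutation. Where `a` and `b` agree
from the top down it is the identity, so the next index can only move to a smaller one, whose rank
in the block is no larger. -/
lemma toColex_le_of_blockVandermonde_ne_zero {p c a b : Fin d → ℕ} (hb : b + c = blockRank p)
    (h : blockVandermonde p c a ≠ 0) : toColex a ≤ toColex b := by
  obtain ⟨σ, hσ⟩ := exists_perm_of_blockVandermonde_ne_zero h
  by_contra hlt
  obtain ⟨i, hi, hlt⟩ : ∃ i : Fin d, (∀ j, i < j → b j = a j) ∧ b i < a i := not_le.1 hlt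
  have hfix : ∀ j, i < j → σ j = j := by
    intro j hj
    have h1 : b j = a j := hi j hj
    have h2 : b j + c j = blockRank p j := congrFun hb j
    exact blockRank_injective (hσ j).1 (by rw [(hσ j).2, ← h1, h2])
  have hle : σ i ≤ i := by
    by_contra hc
    have := σ.injective (hfix _ (not_le.1 hc))
    rw [this] at hc; exact hc le_rfl
  have h2 : b i + c i = blockRank p i := congrFun hb i
  have h3 := (hσ i).2
  rcases hle.lt_or_eq with h4 | h4
  · have := blockRank_lt (hσ i).1 h4; omega
  · rw [h4] at h3; omega

/-- The space of harmonic functions of order at most `k` is spanned by the products of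
derivatives of Vandermonde determinants in blocks of sizes at most `k + 1`. -/
theorem IsHarmonic.mem_span {φ : (Fin d → ℕ) → ℂ} {k : ℕ} (hφ : IsHarmonic φ)
    (hk : ∀ a, φ a ≠ 0 → ∀ i, a i ≤ k) :
    φ ∈ Submodule.span ℂ {ψ | ∃ p c : Fin d → ℕ,
      (∀ h, (Finset.univ.filter fun i => p i = h).card = rowLength d k h) ∧
        ψ = blockVandermonde p c} := by
  set Q := Submodule.span ℂ {ψ | ∃ p c : Fin d → ℕ,
      (∀ h, (Finset.univ.filter fun i => p i = h).card = rowLength d k h) ∧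
        ψ = blockVandermonde p c} with hQ
  -- Leading-term elimination: the blocks of the leading exponent `b` and the derivative `blockRank
  -- p - b` give a spanning function with the same leading exponent, and subtracting a multiple of
  -- it lowers the support in colex order.
  have step : ∀ b : Fin d → ℕ, (∀ φ : (Fin d → ℕ) → ℂ, IsHarmonic φ →
      (∀ a, φ a ≠ 0 → ∀ i, a i ≤ k) → (∀ a, φ a ≠ 0 → toColex a < toColex b) → φ ∈ Q) →
      ∀ φ : (Fin d → ℕ) → ℂ, IsHarmonic φ → (∀ a, φ a ≠ 0 → ∀ i, a i ≤ k) → φ b ≠ 0 →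
      (∀ a, φ a ≠ 0 → toColex a ≤ toColex b) → φ ∈ Q := by
    intro b ih φ hφ hk hb hmax
    obtain ⟨p, hp1, hp2⟩ := hφ.exists_blocks hk hb hmax
    have hbc : b + (blockRank p - b) = blockRank p := add_tsub_cancel_of_le fun i => by
      have := hp1 i
      rw [card_filter_le_eq_blockRank_add_one] at this
      exact Nat.lt_succ_iff.1 this
    set ψ := blockVandermonde p (blockRank p - b) with hψ
    have hψb : ψ b ≠ 0 := blockVandermonde_ne_zero hbc
    have hψQ : ψ ∈ Q := Submodule.subset_span ⟨p, _, hp2, rfl⟩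
    have hψk : ∀ a, ψ a ≠ 0 → ∀ i, a i ≤ k := fun a ha i =>
      blockVandermonde_le (fun h => (hp2 h).trans_le (rowLength_le d k h)) ha i
    have hsub : φ - (φ b / ψ b) • ψ ∈ Q := by
      have hor : ∀ a, (φ - (φ b / ψ b) • ψ) a ≠ 0 → φ a ≠ 0 ∨ ψ a ≠ 0 := by
        intro a ha
        by_contra! hc
        exact ha (by simp [hc.1, hc.2])
      refine ih _ ?_ ?_ ?_
      · intro r a
        have h1 := hφ r a
        have h2 := isHarmonic_blockVandermonde p (blockRank p - b) r a
        simp only [shiftSum, Pi.sub_apply, Pi.smul_apply, smul_eq_mul, Finset.sum_sub_distrib,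
          ← Finset.mul_sum] at h1 h2 ⊢
        rw [h1, h2, mul_zero, sub_zero]
      · intro a ha i
        rcases hor a ha with h | h
        · exact hk a h i
        · exact hψk a h i
      · intro a ha
        refine lt_of_le_of_ne ?_ ?_
        · rcases hor a ha with h | h
          · exact hmax a h
          · exact toColex_le_of_blockVandermonde_ne_zero hbc h
        · intro hab
          have : a = b := hab
          subst this
          exact ha (by simp [div_mul_cancel₀ _ hψb])
    have := Q.add_mem hsub (Q.smul_mem (φ b / ψ b) hψQ)
    rwa [sub_add_cancel] at this
  have exmax : ∀ φ : (Fin d → ℕ) → ℂ, (∀ a, φ a ≠ 0 → ∀ i, a i ≤ k) → φ ≠ 0 →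
      ∃ b, φ b ≠ 0 ∧ ∀ a, φ a ≠ 0 → toColex a ≤ toColex b := by
    intro φ hk hne
    have hfin : {a | φ a ≠ 0}.Finite :=
      (Set.finite_Iic (fun _ : Fin d => k)).subset fun a ha i => hk a ha i
    obtain ⟨a, ha⟩ := Function.ne_iff.1 hne
    obtain ⟨b, hb, hm⟩ := hfin.toFinset.exists_max_image (fun a => toColex a) ⟨a, by simpa using ha⟩
    exact ⟨b, by simpa using hb, fun a ha => hm a (by simpa using ha)⟩
  have main : ∀ b : Colex (Fin d → ℕ), ∀ φ : (Fin d → ℕ) → ℂ, IsHarmonic φ →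
      (∀ a, φ a ≠ 0 → ∀ i, a i ≤ k) → (∀ a, φ a ≠ 0 → toColex a < b) → φ ∈ Q := by
    intro b
    induction b using WellFoundedLT.induction with
    | ind b ih =>
      intro φ hφ hk hb
      by_cases hne : φ = 0
      · rw [hne]; exact Q.zero_mem
      · obtain ⟨b', hb', hm⟩ := exmax φ hk hne
        exact step b' (ih _ (hb b' hb')) φ hφ hk hb' hm
  by_cases hne : φ = 0
  · rw [hne]; exact Q.zero_mem
  · obtain ⟨b', hb', hm⟩ := exmax φ hk hne
    exact step b' (main _) φ hφ hk hb' hm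

end Blocks

/-! ### Determinants with columns `J^a v_i` and their factorizations -/

section ColumnDeterminants

variable {κ A : Type*} [CommRing A] {d : ℕ}

/-- The determinant with columns `J^{a l} v_{w l}`. -/
def colDet (x : κ → ℕ → A) (w : Fin d → κ) (a : Fin d → ℕ) : A :=
  Matrix.det (Matrix.of fun j l : Fin d => (j : ℕ).descFactorial (a l) • x (w l) (j - a l))

lemma map_colDet {B : Type*} [CommRing B] (f : A →+* B) (x : κ → ℕ → A) (w : Fin d → κ)
    (a : Fin d → ℕ) : f (colDet x w a) = colDet (fun i j => f (x i j)) w a := by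
  rw [colDet, RingHom.map_det, colDet]
  congr 1
  ext j l
  simp

/-- Applying `J` to a column is multiplication by one strictly lower triangular matrix, with entries
`j` just below the diagonal, whatever the letter of the column. So `isHarmonic_det` applies. -/
lemma isHarmonic_colDet (x : κ → ℕ → A) (w : Fin d → κ) : IsHarmonic (colDet x w) := by
  refine isHarmonic_det
    (fun l s (j : Fin d) => (j : ℕ).descFactorial s • x (w l) (j - s))
    (Matrix.of fun j j' : Fin d => if (j : ℕ) = j' + 1 then ((j : ℕ) : A) else 0) ?_ ?_
  · intro i j hij
    rw [Matrix.of_apply, if_neg]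
    have := Fin.le_def.1 hij
    omega
  · intro l s
    funext j
    simp only [Matrix.mulVec, dotProduct, Matrix.of_apply]
    rcases Nat.eq_zero_or_pos (j : ℕ) with hj | hj
    · rw [Finset.sum_eq_zero]
      · simp [hj]
      · intro j' _; rw [if_neg (by omega), zero_mul]
    · rw [Finset.sum_eq_single (⟨j - 1, by omega⟩ : Fin d)]
      · rw [if_pos (by simp; omega)]
        obtain ⟨m, hm⟩ : ∃ m, (j : ℕ) = m + 1 := ⟨j - 1, by omega⟩
        simp only [hm, Nat.succ_descFactorial_succ, Nat.add_sub_cancel, Nat.add_sub_add_right]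
        rw [nsmul_eq_mul, nsmul_eq_mul]
        push_cast; ring
      · intro j' _ hj'
        rw [if_neg, zero_mul]
        intro hc
        exact hj' (Fin.ext (by simp; omega))
      · simp

lemma colDet_comp_perm (x : κ → ℕ → A) (w : Fin d → κ) (a : Fin d → ℕ)
    (σ : Equiv.Perm (Fin d)) :
    colDet x (w ∘ σ) (a ∘ σ) = ((Equiv.Perm.sign σ : ℤ) : A) * colDet x w a := by
  rw [colDet, colDet, ← Matrix.det_permute']
  rfl

lemma colDet_eq_zero {x : κ → ℕ → A} {w : Fin d → κ} {a : Fin d → ℕ} {l l' : Fin d}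
    (h : l ≠ l') (hw : w l = w l') (ha : a l = a l') : colDet x w a = 0 :=
  Matrix.det_zero_of_column_eq h fun j => by simp [hw, ha]

lemma colDet_eq_zero_of_forall_ne_zero {x : κ → ℕ → A} {w : Fin (d + 1) → κ}
    {a : Fin (d + 1) → ℕ} (h : ∀ l, a l ≠ 0) : colDet x w a = 0 := by
  refine Matrix.det_eq_zero_of_row_eq_zero 0 fun l => ?_
  obtain ⟨m, hm⟩ := Nat.exists_eq_succ_of_ne_zero (h l)
  simp [hm]

/-- If only one column starts with a nonzero entry, the determinant factors. -/
lemma colDet_eq_mul {x : κ → ℕ → A} {w : Fin (d + 1) → κ} {a : Fin (d + 1) → ℕ}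
    {l : Fin (d + 1)} (hl : a l = 0) (h : ∀ l', l' ≠ l → a l' ≠ 0) :
    ∃ n : ℤ, colDet x w a = n • (x (w l) 0 *
      colDet x (fun l' => w (l.succAbove l')) fun l' => a (l.succAbove l') - 1) := by
  -- The sign comes from expanding along row 0, whose only possibly nonzero entry is in column `l`.
  -- The factor `j + 1` comes out of row `j + 1` of the minor, as one power of `J` is removed from
  -- each remaining column.
  refine ⟨(-1) ^ (l : ℕ) * ∏ j : Fin d, ((j : ℤ) + 1), ?_⟩
  rw [colDet, Matrix.det_succ_row_zero, Finset.sum_eq_single l]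
  · have e : (Matrix.submatrix (Matrix.of fun j l : Fin (d + 1) =>
        (j : ℕ).descFactorial (a l) • x (w l) (j - a l)) Fin.succ l.succAbove) =
        Matrix.of fun j l' : Fin d => ((j : A) + 1) *
          (Matrix.of fun j l' : Fin d => (j : ℕ).descFactorial (a (l.succAbove l') - 1) •
            x (w (l.succAbove l')) (j - (a (l.succAbove l') - 1))) j l' := by
      ext j l'
      obtain ⟨m, hm⟩ := Nat.exists_eq_succ_of_ne_zero (h _ (l.succAbove_ne l'))
      simp only [Matrix.submatrix_apply, Matrix.of_apply, hm, Fin.val_succ, Nat.succ_eq_add_one,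
        Nat.succ_descFactorial_succ, Nat.add_sub_cancel, Nat.add_sub_add_right]
      rw [nsmul_eq_mul, nsmul_eq_mul]
      push_cast; ring
    rw [e, Matrix.det_mul_column, ← colDet]
    simp [hl, zsmul_eq_mul]
    ring
  · intro l' _ hl'
    obtain ⟨m, hm⟩ := Nat.exists_eq_succ_of_ne_zero (h _ hl')
    simp [hm]
  · simp

/-- The determinant of the block diagonal matrix with blocks given by `p` and columns
`J^{c l} v_{w l}` in each block. -/
def blockDet (x : κ → ℕ → A) (p : Fin d → ℕ) (w : Fin d → κ) (c : Fin d → ℕ) : A :=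
  Matrix.det (Matrix.of fun i l : Fin d => if p i = p l then
    (blockRank p i).descFactorial (c l) • x (w l) (blockRank p i - c l) else 0)

lemma blockRank_const (h : ℕ) (i : Fin d) : blockRank (fun _ => h) i = i := by
  rw [blockRank, ← Fin.card_Iio i]
  congr 1
  ext
  simp

lemma blockDet_const (x : κ → ℕ → A) (h : ℕ) (w : Fin d → κ) (c : Fin d → ℕ) :
    blockDet x (fun _ => h) w c = colDet x w c := by
  simp [blockDet, colDet, blockRank_const]

lemma blockRank_orderIso (p : Fin d → ℕ) (h : ℕ) {m : ℕ} (e : Fin m ≃o {i // p i = h})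
    (j : Fin m) : blockRank p (e j) = j := by
  rw [blockRank, ← Fin.card_Iio j]
  symm
  refine Finset.card_bij (fun j' _ => (e j' : Fin d)) ?_ ?_ ?_
  · intro j' hj'
    simp only [Finset.mem_filter, Finset.mem_univ, true_and]
    exact ⟨e.lt_iff_lt.2 (Finset.mem_Iio.1 hj'), (e j').2.trans (e j).2.symm⟩
  · intro j1 _ j2 _ hj
    exact e.injective (Subtype.ext hj)
  · intro i hi
    simp only [Finset.mem_filter, Finset.mem_univ, true_and] at hi
    refine ⟨e.symm ⟨i, hi.2.trans (e j).2⟩, ?_, by simp⟩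
    rw [Finset.mem_Iio, ← e.lt_iff_lt, e.apply_symm_apply]
    exact hi.1

/-- The matrix is block diagonal along `p`, so its determinant is the product over the blocks.
Enumerating a block increasingly turns the rank into the row number, which gives a column
determinant of the size of the block. -/
lemma blockDet_mem {R : Type*} [CommSemiring R] [Algebra R A] (S : Subalgebra R A)
    {x : κ → ℕ → A} {p : Fin d → ℕ}
    (w : Fin d → κ) (c : Fin d → ℕ) (hS : ∀ h, ∀ m,
      (Finset.univ.filter fun i => p i = h).card = m → ∀ (w' : Fin m → κ) (c' : Fin m → ℕ),
        colDet x w' c' ∈ S) : blockDet x p w c ∈ S := by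
  have hb : Matrix.BlockTriangular (Matrix.of fun i l : Fin d => if p i = p l then
      (blockRank p i).descFactorial (c l) • x (w l) (blockRank p i - c l) else 0) p := by
    intro i l hil
    rw [Matrix.of_apply, if_neg hil.ne']
  rw [blockDet, hb.det]
  refine S.prod_mem fun h _ => ?_
  have hcard : Fintype.card {i // p i = h} = (Finset.univ.filter fun i => p i = h).card :=
    Fintype.card_subtype _
  set e := Fintype.orderIsoFinOfCardEq _ hcard
  rw [← Matrix.det_submatrix_equiv_self e.toEquiv]
  convert hS h _ rfl (fun l => w (e l)) (fun l => c (e l)) using 1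
  rw [colDet]
  congr 1
  ext j l
  have h1 := blockRank_orderIso p h e j
  have h2 : p (e j) = p (e l) := (e j).2.trans (e l).2.symm
  simp only [Matrix.submatrix_apply, Matrix.toSquareBlock_def, Matrix.of_apply]
  change (if p (e j) = p (e l) then (blockRank p (e j)).descFactorial (c (e l)) •
    x (w (e l)) (blockRank p (e j) - c (e l)) else 0) = _
  rw [if_pos h2, h1]

end ColumnDeterminants

/-! ### From harmonic functions back to differential polynomials -/

section Contraction

variable {κ : Type*} {d : ℕ}

/-- The multilinear specialization of a function on exponents, in the letters `w`. -/
def contract (k : ℕ) (w : Fin d → κ) :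
    ((Fin d → ℕ) → ℂ) →ₗ[ℂ] MvPolynomial (κ × ℕ) ℂ where
  toFun φ := ∑ a : Fin d → Fin (k + 1),
    (φ (fun l => a l) / ∏ l, ((a l : ℕ).factorial : ℂ)) • ∏ l, X (w l, (a l : ℕ))
  map_add' φ φ' := by
    simp only [Pi.add_apply, add_div, add_smul, Finset.sum_add_distrib]
  map_smul' r φ := by
    simp only [Pi.smul_apply, smul_eq_mul, mul_div_assoc, mul_smul, Finset.smul_sum,
      RingHom.id_apply]

/-- Each column of the block determinant is a sum over the order `s` of the variable in it;
expanding multilinearly gives the sum defining `contract`. Dividing by `s!` turns the factorials of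
`blockVandermonde` into falling factorials. -/
lemma contract_blockVandermonde {k : ℕ} {p : Fin d → ℕ} (hp : ∀ i, blockRank p i ≤ k)
    (w : Fin d → κ) (c : Fin d → ℕ) :
    contract k w (blockVandermonde p c) =
      blockDet (fun i j => (X (i, j) : MvPolynomial (κ × ℕ) ℂ)) p w c := by
  set t : Fin d → Fin (k + 1) → Fin d → ℂ := fun l s i =>
    (((s : ℕ).factorial : ℂ))⁻¹ * (if p i = p l ∧ blockRank p i = s + c l then
      ((blockRank p i).factorial : ℂ) else 0) with ht
  have e1 : (Matrix.of fun i l : Fin d => if p i = p l then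
      (blockRank p i).descFactorial (c l) •
        (X (w l, blockRank p i - c l) : MvPolynomial (κ × ℕ) ℂ) else 0) =
      Matrix.transpose (Matrix.of fun l i =>
        (∑ s : Fin (k + 1), fun i => X (w l, (s : ℕ)) * C (t l s i)) i) := by
    ext1 i l
    simp only [Matrix.of_apply, Matrix.transpose_apply, Finset.sum_apply, ht]
    by_cases hpl : p i = p l
    · rw [if_pos hpl]
      by_cases hc : c l ≤ blockRank p i
      · rw [Finset.sum_eq_single (⟨blockRank p i - c l, by have := hp i; omega⟩ : Fin (k + 1))]
        · rw [if_pos ⟨hpl, by simp; omega⟩]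
          rw [nsmul_eq_mul, mul_comm, ← map_natCast (C : ℂ →+* MvPolynomial (κ × ℕ) ℂ)]
          congr 2
          have := Nat.factorial_mul_descFactorial hc
          rw [← this]
          push_cast
          rw [inv_mul_cancel_left₀]
          exact_mod_cast Nat.factorial_ne_zero _
        · intro s _ hs
          rw [if_neg, mul_zero, C_0, mul_zero]
          rintro ⟨-, h⟩
          exact hs (Fin.ext (by simp; omega))
        · simp
      · rw [Nat.descFactorial_of_lt (by omega), zero_smul, Finset.sum_eq_zero]
        intro s _
        rw [if_neg (by omega), mul_zero, C_0, mul_zero]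
    · rw [if_neg hpl, Finset.sum_eq_zero]
      intro s _
      rw [if_neg fun h => hpl h.1, mul_zero, C_0, mul_zero]
  rw [blockDet, e1, Matrix.det_transpose]
  have e2 := MultilinearMap.map_sum
    (Matrix.detRowAlternating (n := Fin d) (R := MvPolynomial (κ × ℕ) ℂ)).toMultilinearMap
    (fun l (s : Fin (k + 1)) (i : Fin d) =>
      (X (w l, (s : ℕ)) * C (t l s i) : MvPolynomial (κ × ℕ) ℂ))
  refine Eq.trans ?_ e2.symm
  change ∑ a : Fin d → Fin (k + 1), _ = _
  refine Finset.sum_congr rfl fun a _ => ?_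
  have e3 := Matrix.det_mul_column (fun l => (X (w l, (a l : ℕ)) : MvPolynomial (κ × ℕ) ℂ))
    ((Matrix.of fun l i => t l (a l) i).map C)
  refine Eq.trans ?_ e3.symm
  rw [← RingHom.mapMatrix_apply, ← RingHom.map_det, smul_eq_C_mul, mul_comm]
  congr 2
  rw [blockVandermonde, ← Matrix.det_transpose, div_eq_inv_mul, ← Finset.prod_inv_distrib]
  exact (Matrix.det_mul_column _ _).symm

end Contraction

/-! ### The action of the units `1 + zT` -/

section Action

variable {N : ℕ}

lemma act_X (α : (PowerSeries ℂ)ˣ) (i : Fin (N + 1)) (m : ℕ) :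
    act α (X (i, m) : V N) = ∑ l ∈ Finset.range (m + 1),
      ((m.descFactorial l : ℂ) * PowerSeries.coeff l (α : PowerSeries ℂ)) •
        (X (i, m - l) : V N) := by
  rw [act, aeval_X]
  simp only
  rw [← Finset.sum_range_reflect]
  refine Finset.sum_congr rfl fun l hl => ?_
  have hl : l ≤ m := Nat.lt_succ_iff.1 (Finset.mem_range.1 hl)
  have e : m + 1 - 1 - l = m - l := by omega
  rw [e, Nat.sub_sub_self hl, PowerSeries.constantCoeff_iterate_derivative, Nat.choose_symm hl,
    Nat.descFactorial_eq_factorial_mul_choose]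
  push_cast
  ring_nf

/-- The unit `1 + z T`. -/
def onePlus (z : ℂ) : (PowerSeries ℂ)ˣ :=
  (PowerSeries.isUnit_iff_constantCoeff.2
    (by simp : IsUnit (PowerSeries.constantCoeff (1 + PowerSeries.C z * PowerSeries.X)))).unit

lemma coe_onePlus (z : ℂ) : (onePlus z : PowerSeries ℂ) = 1 + PowerSeries.C z * PowerSeries.X :=
  rfl

lemma constantCoeff_onePlus (z : ℂ) :
    PowerSeries.constantCoeff (onePlus z : PowerSeries ℂ) = 1 := by
  simp [coe_onePlus]

lemma act_onePlus_X (z : ℂ) (i : Fin (N + 1)) (m : ℕ) :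
    act (onePlus z) (X (i, m) : V N) = X (i, m) + (z * m) • X (i, m - 1) := by
  rw [act_X]
  have hc : ∀ l, PowerSeries.coeff l (onePlus z : PowerSeries ℂ) =
      if l = 0 then 1 else if l = 1 then z else 0 := by
    intro l
    rw [coe_onePlus, map_add, PowerSeries.coeff_one, PowerSeries.coeff_C_mul,
      PowerSeries.coeff_X]
    rcases l with _ | _ | l <;> simp
  cases m with
  | zero => simp [hc]
  | succ m =>
    rw [Finset.sum_range_succ', Finset.sum_range_succ', Finset.sum_eq_zero]
    · simp [hc, add_comm, mul_comm]
    · intro l _; simp [hc]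

/-- The chain rule: `X_i^{(j)}` occurs in the images of `X_i^{(j)}` and `X_i^{(j+1)}` only, with
coefficients `1` and `z (j + 1)`. -/
lemma pderiv_act_onePlus (z : ℂ) (i : Fin (N + 1)) (j : ℕ) (P : V N) :
    pderiv (i, j) (act (onePlus z) P) = act (onePlus z) (pderiv (i, j) P) +
      (z * ((j : ℂ) + 1)) • act (onePlus z) (pderiv (i, j + 1) P) := by
  induction P using MvPolynomial.induction_on with
  | C r => simp [act, algHom_C, MvPolynomial.algebraMap_eq]
  | add P Q hP hQ => simp only [map_add, hP, hQ, smul_add]; abel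
  | mul_X P v hP =>
    obtain ⟨i', m⟩ := v
    have hX : pderiv (i, j) (act (onePlus z) (X (i', m) : V N)) =
        act (onePlus z) (pderiv (i, j) (X (i', m))) +
          (z * ((j : ℂ) + 1)) • act (onePlus z) (pderiv (i, j + 1) (X (i', m))) := by
      rw [act_onePlus_X, map_add, Derivation.map_smul, pderiv_X, pderiv_X, pderiv_X]
      by_cases hi : i' = i
      · subst hi
        by_cases h1 : m = j
        · subst h1
          have h2 : m ≠ 0 → m - 1 ≠ m := by omega
          by_cases h3 : m = 0
          · subst h3; simp 
          · simp [h2 h3]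
        · by_cases h2 : m = j + 1
          · subst h2; simp 
          · by_cases h3 : m = 0
            · subst h3
              have : ¬ (0 : ℕ) = j + 1 := by omega
              simp [h1]
            · have : ¬ m - 1 = j := by omega
              simp [h1, h2, this]
      · simp [hi]
    simp only [map_mul, Derivation.leibniz, hP, hX, smul_eq_mul, map_add, mul_add, smul_add,
      mul_smul_comm]
    abel

end Action

/-! ### Polarization of differentially homogeneous polynomials -/

section Polarization

variable {N : ℕ}

/-- The full polarization of a differential polynomial, as a coefficient function. -/
def polar : (d : ℕ) → (Fin d → Fin (N + 1)) → (Fin d → ℕ) → V N →ₗ[ℂ] ℂ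
  | 0, _, _ => (aeval fun _ => (0 : ℂ)).toLinearMap
  | d + 1, w, a => polar d (Fin.tail w) (Fin.tail a) ∘ₗ (pderiv (w 0, a 0)).toLinearMap

lemma sum_finset_succ {d : ℕ} {M : Type*} [AddCommMonoid M] (f : Finset (Fin (d + 1)) → M) :
    ∑ T, f T = ∑ T : Finset (Fin d), (f (T.map (Fin.succEmb d)) +
      f (insert 0 (T.map (Fin.succEmb d)))) := by
  rw [← Finset.powerset_univ, Fin.univ_succ, Finset.cons_eq_insert, Finset.sum_powerset_insert,
    Finset.sum_add_distrib, ← Finset.powerset_univ (α := Fin d)]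
  · have h : ∀ g : Finset (Fin (d + 1)) → M,
        ∑ T ∈ (Finset.univ.map (⟨Fin.succ, Fin.succ_injective d⟩ : Fin d ↪ Fin (d + 1))).powerset,
          g T = ∑ T ∈ (Finset.univ : Finset (Fin d)).powerset, g (T.map (Fin.succEmb d)) := by
      intro g
      symm
      refine Finset.sum_bij (fun T _ => T.map (Fin.succEmb d)) ?_ ?_ ?_ fun _ _ => rfl
      · intro T _
        rw [Finset.mem_powerset]
        exact Finset.map_subset_map.2 (Finset.subset_univ T)
      · intro T _ T' _ h; exact Finset.map_injective _ h
      · intro T hT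
        obtain ⟨T', -, rfl⟩ := Finset.subset_map_iff.1 (Finset.mem_powerset.1 hT)
        exact ⟨T', by simp, rfl⟩
    rw [h, h]
  · simp

/-- Each of the `d` derivatives contributes either itself or its shift by one. The normalization by
factorials absorbs the coefficients `a l + 1`, so `1 + zT` acts as the product of the operators `1 +
z x_l`, with `x_l` the shifts. -/
lemma polar_act (z : ℂ) {d : ℕ} (w : Fin d → Fin (N + 1)) (a : Fin d → ℕ) (P : V N) :
    (∏ l, ((a l).factorial : ℂ)) * polar d w a (act (onePlus z) P) =
      ∑ T : Finset (Fin d), z ^ T.card *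
        ((∏ l, (((a + indic T) l).factorial : ℂ)) * polar d w (a + indic T) P) := by
  induction d generalizing P with
  | zero =>
    have : ∀ P : V N, aeval (fun _ => (0 : ℂ)) (act (onePlus z) P) = aeval (fun _ => (0 : ℂ)) P := by
      intro P
      rw [← AlgHom.comp_apply]
      congr 1
      ext v
      rw [AlgHom.comp_apply]
      rw [act_onePlus_X]
      simp
    have hu : (default : Finset (Fin 0)) = ∅ := rfl
    simp [polar, this, hu]
  | succ d ih =>
    rw [sum_finset_succ]
    have e1 : ∀ T : Finset (Fin d), Fin.tail (a + indic (T.map (Fin.succEmb d))) =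
        Fin.tail a + indic T := by
      intro T; funext l; simp [Fin.tail, indic]
    have e2 : ∀ T : Finset (Fin d), Fin.tail (a + indic (insert 0 (T.map (Fin.succEmb d)))) =
        Fin.tail a + indic T := by
      intro T; funext l; simp [Fin.tail, indic, Fin.succ_ne_zero]
    have e3 : ∀ T : Finset (Fin d), (a + indic (T.map (Fin.succEmb d))) 0 = a 0 := by
      intro T; simp [indic, Fin.succ_ne_zero]
    have e4 : ∀ T : Finset (Fin d), (a + indic (insert 0 (T.map (Fin.succEmb d)))) 0 = a 0 + 1 := by
      intro T; simp [indic]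
    have hp : ∀ b : Fin (d + 1) → ℕ, ∏ l, ((b l).factorial : ℂ) =
        (b 0).factorial * ∏ l, ((Fin.tail b l).factorial : ℂ) := fun b => Fin.prod_univ_succ _
    have hc : ∀ T : Finset (Fin d), (insert 0 (T.map (Fin.succEmb d))).card = T.card + 1 := by
      intro T
      rw [Finset.card_insert_of_notMem (by simp [Fin.succ_ne_zero]), Finset.card_map]
    simp only [polar, LinearMap.comp_apply, hp, e1, e2, e3, e4, Finset.card_map, hc,
      Derivation.coeFn_coe, pderiv_act_onePlus, map_add, map_smul, smul_eq_mul,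
      Finset.sum_add_distrib]
    have ih1 := ih (Fin.tail w) (Fin.tail a) (pderiv (w 0, a 0) P)
    have ih2 := ih (Fin.tail w) (Fin.tail a) (pderiv (w 0, a 0 + 1) P)
    have : ∀ F Q R c s : ℂ, F * Q * (R + c * s) = F * (Q * R) + F * c * (Q * s) := by
      intros; ring
    rw [this, ih1, ih2, Finset.mul_sum, Finset.mul_sum, Nat.factorial_succ]
    push_cast
    congr 1
    · exact Finset.sum_congr rfl fun T _ => by ring
    · exact Finset.sum_congr rfl fun T _ => by ring

lemma coeff_onePlus_act_eq_zero {d : ℕ} {f : Finset (Fin d) → ℂ} {c : ℂ}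
    (h : ∀ z : ℂ, ∑ T, z ^ T.card * f T = c) (r : ℕ) :
    ∑ T ∈ Finset.univ.powersetCard (r + 1), f T = 0 := by
  have hp : (∑ T, Polynomial.X ^ T.card * Polynomial.C (f T) : Polynomial ℂ) = Polynomial.C c := by
    refine Polynomial.funext fun z => ?_
    rw [Polynomial.eval_finsetSum, Polynomial.eval_C, ← h z]
    exact Finset.sum_congr rfl fun T _ => by rw [Polynomial.eval_mul, Polynomial.eval_pow, Polynomial.eval_X, Polynomial.eval_C]
  have h3 := congrArg (fun q => Polynomial.coeff q (r + 1)) hp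
  simp only [Polynomial.coeff_C_succ, Polynomial.finsetSum_coeff, Polynomial.coeff_X_pow_mul',
    Polynomial.coeff_C] at h3
  rw [← h3, ← Finset.sum_subset (Finset.subset_univ (Finset.powersetCard (r + 1) Finset.univ))]
  · refine Finset.sum_congr rfl fun T hT => ?_
    have := (Finset.mem_powersetCard.1 hT).2
    simp [this]
  · intro T _ hT
    have : T.card ≠ r + 1 := fun h => hT (Finset.mem_powersetCard.2 ⟨Finset.subset_univ _, h⟩)
    split_ifs <;> first | rfl | omega

/-- A unit `1 + zT` has constant term 1 and so fixes `P`. The polynomial in `z` provided by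
`polar_act` is therefore constant, and its higher coefficients are the shift sums. -/
lemma isHarmonic_polar {d e : ℕ} {P : V N} (hP : P ∈ diffHom N e) (w : Fin d → Fin (N + 1)) :
    IsHarmonic fun a : Fin d → ℕ => (∏ l, ((a l).factorial : ℂ)) * polar d w a P := by
  intro r a
  refine coeff_onePlus_act_eq_zero (c := (∏ l, ((a l).factorial : ℂ)) * polar d w a P)
    (f := fun T => (∏ l, (((a + indic T) l).factorial : ℂ)) * polar d w (a + indic T) P)
    (fun z => ?_) r
  have h : act (onePlus z) P = P := by
    have := hP (onePlus z)
    rwa [constantCoeff_onePlus, one_pow, one_smul] at this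
  rw [← polar_act, h]

lemma mem_orderLE {k : ℕ} {P : V N} : P ∈ orderLE N k ↔ ∀ v ∈ P.vars, v.2 ≤ k := by
  rw [orderLE, mem_supported]; rfl

lemma mem_orderLE_iff_exists_rename {k : ℕ} {P : V N} : P ∈ orderLE N k ↔
    ∃ q : MvPolynomial (Fin (N + 1) × Fin (k + 1)) ℂ,
      rename (Prod.map id Fin.val) q = P := by
  constructor
  · intro h
    refine exists_rename_eq_of_vars_subset_range P _
      (Function.injective_id.prodMap Fin.val_injective) fun v hv => ?_
    have := mem_orderLE.1 h v hv
    exact ⟨(v.1, ⟨v.2, by omega⟩), rfl⟩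
  · rintro ⟨q, rfl⟩
    rw [mem_orderLE]
    intro v hv
    obtain ⟨u, -, rfl⟩ := mem_vars_rename _ _ hv
    exact Nat.lt_succ_iff.1 u.2.2

lemma prodMap_val_injective (k : ℕ) : Function.Injective
    (Prod.map id Fin.val : Fin (N + 1) × Fin (k + 1) → Fin (N + 1) × ℕ) :=
  Function.injective_id.prodMap Fin.val_injective

lemma pderiv_mem_orderLE {k : ℕ} {P : V N} (h : P ∈ orderLE N k) (v : Fin (N + 1) × ℕ) :
    pderiv v P ∈ orderLE N k := by
  by_cases hv : v.2 ≤ k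
  · obtain ⟨q, rfl⟩ := mem_orderLE_iff_exists_rename.1 h
    have := pderiv_rename (prodMap_val_injective (N := N) k) (v.1, ⟨v.2, by omega⟩) q
    exact mem_orderLE_iff_exists_rename.2 ⟨_, this.symm⟩
  · rw [pderiv_eq_zero_of_notMem_vars]
    · exact zero_mem _
    · exact fun hm => hv (mem_orderLE.1 h v hm)

lemma pderiv_eq_zero_of_orderLE {k : ℕ} {P : V N} (h : P ∈ orderLE N k) {v : Fin (N + 1) × ℕ}
    (hv : k < v.2) : pderiv v P = 0 :=
  pderiv_eq_zero_of_notMem_vars fun hm => absurd (mem_orderLE.1 h v hm) (not_le.2 hv)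

lemma polar_le {k d : ℕ} {P : V N} (h : P ∈ orderLE N k) {w : Fin d → Fin (N + 1)}
    {a : Fin d → ℕ} (hne : polar d w a P ≠ 0) (i : Fin d) : a i ≤ k := by
  induction d generalizing P with
  | zero => exact i.elim0
  | succ d ih =>
    simp only [polar, LinearMap.comp_apply, Derivation.coeFn_coe] at hne
    refine Fin.cases ?_ (fun j => ?_) i
    · by_contra hc
      rw [pderiv_eq_zero_of_orderLE h (by simpa using hc), map_zero] at hne
      exact hne rfl
    · exact ih (pderiv_mem_orderLE h _) hne j

lemma sum_X_mul_pderiv_of_orderLE {k d : ℕ} {P : V N} (h : P ∈ orderLE N k)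
    (hP : P.IsHomogeneous d) :
    ∑ c : Fin (N + 1) × Fin (k + 1), X (c.1, (c.2 : ℕ)) * pderiv (c.1, (c.2 : ℕ)) P = d • P := by
  obtain ⟨q, rfl⟩ := mem_orderLE_iff_exists_rename.1 h
  rw [IsHomogeneous.rename_isHomogeneous_iff (prodMap_val_injective k)] at hP
  rw [← map_nsmul, ← hP.sum_X_mul_pderiv, map_sum]
  refine Finset.sum_congr rfl fun c _ => ?_
  rw [map_mul, rename_X, ← pderiv_rename (prodMap_val_injective k)]
  rfl

/-- A homogeneous polynomial is recovered from its polarization. -/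
lemma sum_polar {k d : ℕ} {P : V N} (h : P ∈ orderLE N k) (hP : P.IsHomogeneous d) :
    ∑ c : Fin d → Fin (N + 1) × Fin (k + 1),
      polar d (fun l => (c l).1) (fun l => (c l).2) P • ∏ l, (X ((c l).1, ((c l).2 : ℕ)) : V N) =
        (d.factorial : ℂ) • P := by
  induction d generalizing P with
  | zero =>
    obtain ⟨r, rfl⟩ : ∃ r, P = C r := ⟨_, (totalDegree_eq_zero_iff_eq_C.1
      ((totalDegree_zero_iff_isHomogeneous _).2 hP))⟩
    simp [polar, smul_eq_C_mul]
  | succ d ih =>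
    rw [← (Fin.consEquiv fun _ => Fin (N + 1) × Fin (k + 1)).sum_comp, Fintype.sum_prod_type]
    have : ∀ c : Fin (N + 1) × Fin (k + 1), ∑ c' : Fin d → Fin (N + 1) × Fin (k + 1),
        polar (d + 1) (fun l => ((Fin.consEquiv fun _ => Fin (N + 1) × Fin (k + 1)) (c, c') l).1)
          (fun l => ((Fin.consEquiv fun _ => Fin (N + 1) × Fin (k + 1)) (c, c') l).2) P •
          ∏ l, (X (((Fin.consEquiv fun _ => Fin (N + 1) × Fin (k + 1)) (c, c') l).1,
            (((Fin.consEquiv fun _ => Fin (N + 1) × Fin (k + 1)) (c, c') l).2 : ℕ)) : V N) =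
        (d.factorial : ℂ) • (X (c.1, (c.2 : ℕ)) * pderiv (c.1, (c.2 : ℕ)) P) := by
      intro c
      rw [← mul_smul_comm, ← ih (pderiv_mem_orderLE h (c.1, (c.2 : ℕ))) (by simpa using hP.pderiv),
        Finset.mul_sum]
      refine Finset.sum_congr rfl fun c' _ => ?_
      rw [Fin.prod_univ_succ, ← mul_smul_comm]
      rfl
    simp only [this]
    rw [← Finset.smul_sum, sum_X_mul_pderiv_of_orderLE h hP, Nat.factorial_succ, mul_comm,
      Nat.cast_mul, mul_smul, Nat.cast_smul_eq_nsmul ℂ (d + 1)]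

/-- The constant unit 2 multiplies a monomial of degree `m` by `2^m`, and powers of 2 determine
their exponent. -/
lemma isHomogeneous_of_mem_diffHom {d : ℕ} {P : V N} (hP : P ∈ diffHom N d) :
    P.IsHomogeneous d := by
  have hu : IsUnit (PowerSeries.C (2 : ℂ)) := (isUnit_iff_ne_zero.2 two_ne_zero).map _
  have hact : (act hu.unit : V N →ₐ[ℂ] V N) = aeval fun v => (2 : ℂ) • (X v : V N) := by
    ext1 v
    rw [aeval_X, act_X, Finset.sum_range_succ', Finset.sum_eq_zero]
    · simp
    · intro l _; simp
  have hcoeff : ∀ (Q : V N) (m : Fin (N + 1) × ℕ →₀ ℕ),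
      coeff m (aeval (fun v => (2 : ℂ) • (X v : V N)) Q) = 2 ^ m.degree * coeff m Q := by
    intro Q m
    induction Q using MvPolynomial.induction_on' with
    | monomial n r =>
      rw [aeval_monomial, Finsupp.prod]
      simp only [smul_pow, Finset.prod_smul, Finset.prod_pow_eq_pow_sum]
      have : ∏ v ∈ n.support, (X v : V N) ^ n v = monomial n 1 := by
        rw [monomial_eq, C_1, one_mul, Finsupp.prod]
      rw [this, algebraMap_eq, mul_smul_comm, C_mul_monomial, mul_one, coeff_smul, coeff_monomial,
        smul_eq_mul]
      split_ifs with h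
      · rw [h]; rfl
      · simp
    | add p q hp hq => rw [map_add, coeff_add, hp, hq, coeff_add, mul_add]
  intro m hm
  have h1 := congrArg (coeff m) (hP hu.unit)
  rw [hact, hcoeff, coeff_smul, IsUnit.unit_spec, PowerSeries.constantCoeff_C, smul_eq_mul] at h1
  have h2 := mul_right_cancel₀ hm h1
  have h3 : m.degree = d := by
    have : (2 : ℕ) ^ m.degree = 2 ^ d := by exact_mod_cast h2
    exact Nat.pow_right_injective le_rfl this
  rw [← h3, Finsupp.degree_eq_weight_one]; rfl

/-- Reduction of differentially homogeneous polynomials to determinants. -/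
theorem mem_span_blockDet {k d : ℕ} {P : V N} (hP : P ∈ diffHom N d) (h : P ∈ orderLE N k) :
    P ∈ Submodule.span ℂ {Q : V N | ∃ (p : Fin d → ℕ) (w : Fin d → Fin (N + 1)) (c : Fin d → ℕ),
      (∀ h, (Finset.univ.filter fun i => p i = h).card = rowLength d k h) ∧
        Q = blockDet (fun i j => X (i, j)) p w c} := by
  set S := Submodule.span ℂ {Q : V N | ∃ (p : Fin d → ℕ) (w : Fin d → Fin (N + 1)) (c : Fin d → ℕ),
      (∀ h, (Finset.univ.filter fun i => p i = h).card = rowLength d k h) ∧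
        Q = blockDet (fun i j => X (i, j)) p w c}
  have hd : (d.factorial : ℂ) ≠ 0 := by exact_mod_cast d.factorial_ne_zero
  rw [← S.smul_mem_iff hd, ← sum_polar h (isHomogeneous_of_mem_diffHom hP),
    ← (Equiv.arrowProdEquivProdArrow (Fin d) (fun _ => Fin (N + 1)) (fun _ => Fin (k + 1))).symm.sum_comp,
    Fintype.sum_prod_type]
  -- The polarization sum is grouped by the sequence of letters `w`; each group is the contraction
  -- of one harmonic function.
  refine S.sum_mem fun w _ => ?_
  have hmem : contract k w (fun a : Fin d → ℕ => (∏ l, ((a l).factorial : ℂ)) * polar d w a P) ∈ S := by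
    have h1 := (isHarmonic_polar hP w).mem_span (k := k) fun a ha i =>
      polar_le h (right_ne_zero_of_mul ha) i
    have h2 := Submodule.mem_map_of_mem (f := contract k w) h1
    refine (Submodule.map_span_le _ _ S).2 ?_ h2
    rintro _ ⟨p, c, hp, rfl⟩
    refine Submodule.subset_span ⟨p, w, c, hp, contract_blockVandermonde (fun i => ?_) w c⟩
    have h3 := blockRank_lt_card p i
    have h4 := rowLength_le d k (p i)
    rw [← hp] at h4
    omega
  convert hmem using 1
  refine Finset.sum_congr rfl fun a _ => ?_
  congr 1
  have : (∏ l, ((a l : ℕ).factorial : ℂ)) ≠ 0 :=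
    Finset.prod_ne_zero_iff.2 fun l _ => by exact_mod_cast Nat.factorial_ne_zero _
  rw [mul_div_cancel_left₀ _ this]
  rfl

end Polarization

/-! ### Column determinants are differentially homogeneous -/

section Membership

variable {N : ℕ}

/-- The determinants `colDet` are differentially homogeneous. -/
lemma colDet_mem_diffHom {d : ℕ} (w : Fin d → Fin (N + 1)) (a : Fin d → ℕ) :
    colDet (fun i j => (X (i, j) : V N)) w a ∈ diffHom N d := by
  intro α
  set c : ℕ → ℂ := fun l => PowerSeries.coeff l (α : PowerSeries ℂ) with hc
  -- The unit `α` acts on every column as the matrix `α(J)`, which commutes with the powers of `J`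
  -- already applied. It is lower triangular with diagonal `α(0)`, so its determinant is `α(0)^d`.
  have e : (Matrix.of fun j l : Fin d => (j : ℕ).descFactorial (a l) •
        act α (X (w l, (j : ℕ) - a l) : V N)) =
      (Matrix.of fun j j' : Fin d => if j' ≤ j then
          (C (((j : ℕ).descFactorial (j - j') : ℂ) * c (j - j')) : V N) else 0) *
        Matrix.of fun j l : Fin d => (j : ℕ).descFactorial (a l) • X (w l, (j : ℕ) - a l) := by
    ext1 j l
    rw [Matrix.mul_apply]
    simp only [Matrix.of_apply]
    set f : ℕ → V N := fun j' => (if j' ≤ (j : ℕ) then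
      (C (((j : ℕ).descFactorial (j - j') : ℂ) * c (j - j')) : V N) else 0) *
        (j'.descFactorial (a l) • X (w l, j' - a l)) with hfdef
    have hsum : ∑ j' : Fin d, (if j' ≤ j then
        (C (((j : ℕ).descFactorial (j - j') : ℂ) * c (j - j')) : V N) else 0) *
        ((j' : ℕ).descFactorial (a l) • X (w l, (j' : ℕ) - a l)) =
        ∑ s ∈ Finset.range ((j : ℕ) + 1), f (j - s) := by
      have h1 : ∑ s ∈ Finset.range ((j : ℕ) + 1), f (j - s) =
          ∑ j' ∈ Finset.range ((j : ℕ) + 1), f j' := by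
        rw [← Finset.sum_range_reflect]
        refine Finset.sum_congr rfl fun s hs => ?_
        rw [Finset.mem_range] at hs
        congr 1; omega
      rw [h1, Finset.sum_subset (Finset.range_subset_range.2 (show (j : ℕ) + 1 ≤ d by omega)),
        ← Fin.sum_univ_eq_sum_range]
      · rfl
      · intro j' _ hj'
        rw [Finset.mem_range] at hj'
        simp only [hfdef]
        rw [if_neg (by omega), zero_mul]
    rw [hsum, act_X]
    rcases le_or_gt (a l) j with ha | ha
    · rw [← Finset.sum_subset (Finset.range_subset_range.2
        (show (j : ℕ) - a l + 1 ≤ (j : ℕ) + 1 by omega)), Finset.smul_sum]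
      · refine Finset.sum_congr rfl fun s hs => ?_
        rw [Finset.mem_range] at hs
        have e1 : (j : ℕ) - (j - s) = s := by omega
        have e2 : (j : ℕ) - s - a l = j - a l - s := by omega
        have e3 : (j : ℕ).descFactorial (a l) * ((j : ℕ) - a l).descFactorial s =
            (j : ℕ).descFactorial s * ((j : ℕ) - s).descFactorial (a l) := by
          have h1 := Nat.descFactorial_mul_descFactorial (n := j) (Nat.le_add_right (a l) s)
          have h2 := Nat.descFactorial_mul_descFactorial (n := j) (Nat.le_add_left s (a l))
          rw [Nat.add_sub_cancel_left] at h1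
          rw [Nat.add_sub_cancel] at h2
          rw [mul_comm, h1, ← h2, mul_comm]
        simp only [hfdef]
        rw [if_pos (by omega), e1, e2, smul_eq_C_mul, nsmul_eq_mul, nsmul_eq_mul,
          ← map_natCast (C : ℂ →+* V N), ← map_natCast (C : ℂ →+* V N), ← mul_assoc, ← mul_assoc,
          ← C_mul, ← C_mul]
        congr 2
        have e4 : ((j : ℕ).descFactorial (a l) : ℂ) * (((j : ℕ) - a l).descFactorial s : ℂ) =
            ((j : ℕ).descFactorial s : ℂ) * (((j : ℕ) - s).descFactorial (a l) : ℂ) := by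
          exact_mod_cast e3
        rw [← mul_assoc, e4]
        ring
      · intro s hs' hs
        rw [Finset.mem_range] at hs hs'
        simp only [hfdef]
        rw [Nat.descFactorial_of_lt (show (j : ℕ) - s < a l by omega), zero_smul, mul_zero]
    · rw [Nat.descFactorial_of_lt ha, zero_smul, Finset.sum_eq_zero]
      intro s _
      simp only [hfdef]
      rw [Nat.descFactorial_of_lt (show (j : ℕ) - s < a l by omega), zero_smul, mul_zero]
  have h := map_colDet (act α : V N →ₐ[ℂ] V N).toRingHom (fun i j => (X (i, j) : V N)) w a
  have h' : act α (colDet (fun i j => (X (i, j) : V N)) w a) =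
    colDet (fun i j => act α (X (i, j) : V N)) w a := h
  rw [h', colDet, e, Matrix.det_mul, Matrix.det_of_isLowerTriangular]
  · simp [colDet, hc, smul_eq_C_mul]
  · intro i j hij
    have hij' : i < j := hij
    simp [not_le.2 hij']

lemma colDet_mem_orderLE {d k : ℕ} (h : d ≤ k + 1) (w : Fin d → Fin (N + 1)) (a : Fin d → ℕ) :
    colDet (fun i j => (X (i, j) : V N)) w a ∈ orderLE N k := by
  rw [colDet, Matrix.det_apply]
  refine sum_mem fun σ _ => ?_
  refine zsmul_mem (prod_mem fun l _ => nsmul_mem ?_ _) _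
  refine X_mem_supported.2 ?_
  have := (σ l).2
  simp only [Set.mem_ofPred_eq]
  omega

end Membership

/-! ### Sorting columns and reducing to indices -/

section Sorting

variable {N d : ℕ}

/-- The conditions of `IsIndex` other than `exists_head_zero`. -/
structure IsPreIndex (d : ℕ) (α : Fin (N + 1) → List ℕ) : Prop where
  increasing : ∀ i, (α i).Pairwise (· < ·)
  lt_partialLength : ∀ i, ∀ a ∈ α i, a < partialLength α i
  length_eq : ∑ i, (α i).length = d

/-- The index collecting the columns `(w l, a l)`. -/
def indexOf (w : Fin d → Fin (N + 1)) (a : Fin d → ℕ) (i : Fin (N + 1)) : List ℕ :=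
  ((Finset.univ.filter fun l => w l = i).image a).sort (· ≤ ·)

lemma mem_indexOf {w : Fin d → Fin (N + 1)} {a : Fin d → ℕ} {i : Fin (N + 1)} {s : ℕ} :
    s ∈ indexOf w a i ↔ ∃ l, w l = i ∧ a l = s := by
  simp [indexOf]

lemma length_indexOf {w : Fin d → Fin (N + 1)} {a : Fin d → ℕ}
    (h : ∀ l l', w l = w l' → a l = a l' → l = l') (i : Fin (N + 1)) :
    (indexOf w a i).length = (Finset.univ.filter fun l => w l = i).card := by
  rw [indexOf, Finset.length_sort, Finset.card_image_of_injOn]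
  intro l hl l' hl' hll
  simp only [Finset.coe_filter, Finset.mem_univ, true_and, Set.mem_ofPred_eq] at hl hl'
  exact h l l' (hl.trans hl'.symm) hll

lemma partialLength_indexOf {w : Fin d → Fin (N + 1)} {a : Fin d → ℕ}
    (h : ∀ l l', w l = w l' → a l = a l' → l = l') (i : Fin (N + 1)) :
    partialLength (indexOf w a) i = (Finset.univ.filter fun l => w l ≤ i).card := by
  rw [partialLength, Finset.card_eq_sum_card_fiberwise (f := w) (t := Finset.Iic i)]
  · refine Finset.sum_congr rfl fun j hj => ?_
    rw [length_indexOf h]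
    congr 1
    ext l
    simp only [Finset.mem_filter, Finset.mem_univ, true_and]
    constructor
    · rintro rfl; exact ⟨Finset.mem_Iic.1 hj, rfl⟩
    · exact fun h => h.2
  · intro l hl
    simpa using hl

lemma mem_columns {α : Fin (N + 1) → List ℕ} {v : Fin (N + 1) × ℕ} :
    v ∈ columns α ↔ v.2 ∈ α v.1 := by
  obtain ⟨i, a⟩ := v
  simp [columns]

lemma nodup_columns {α : Fin (N + 1) → List ℕ} (h : ∀ i, (α i).Nodup) : (columns α).Nodup := by
  rw [columns, List.nodup_flatMap]
  refine ⟨fun i _ => (h i).map fun a b hab => (Prod.ext_iff.1 hab).2, ?_⟩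
  refine List.Pairwise.imp ?_ (List.nodup_finRange (N + 1))
  intro i j hij
  rw [Function.onFun, List.disjoint_left]
  rintro ⟨i', a⟩ h1 h2
  simp only [List.mem_map, Prod.mk.injEq] at h1 h2
  obtain ⟨_, _, rfl, _⟩ := h1
  obtain ⟨_, _, rfl, _⟩ := h2
  exact hij rfl

lemma length_columns (α : Fin (N + 1) → List ℕ) :
    (columns α).length = ∑ i, (α i).length := by
  simp only [columns, List.length_flatMap, List.length_map]
  rw [← List.ofFn_eq_map, List.sum_ofFn]

lemma W_eq_colDet {A : Type*} [CommRing A] (x : Fin (N + 1) → ℕ → A) (α : Fin (N + 1) → List ℕ) :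
    W x α = colDet x (fun c => ((columns α).get c).1) fun c => ((columns α).get c).2 := rfl

/-- Up to sign, a determinant with distinct columns only depends on its set of columns. -/
lemma exists_colDet_eq_mul_W {A : Type*} [CommRing A] (x : Fin (N + 1) → ℕ → A)
    {w : Fin d → Fin (N + 1)} {a : Fin d → ℕ}
    (h : ∀ l l', w l = w l' → a l = a l' → l = l') :
    ∃ n : ℤ, colDet x w a = n * W x (indexOf w a) := by
  have hnd : (columns (indexOf w a)).Nodup :=
    nodup_columns fun i => Finset.sort_nodup _ _
  have hmem : ∀ v, v ∈ columns (indexOf w a) ↔ ∃ l, (w l, a l) = v := by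
    rintro ⟨i, s⟩
    rw [mem_columns, mem_indexOf]
    simp
  have hlen : (columns (indexOf w a)).length = d := by
    rw [length_columns]
    simp only [length_indexOf h]
    rw [← Finset.card_eq_sum_card_fiberwise (f := w) (t := Finset.univ) (by simp)]
    simp
  rw [W_eq_colDet]
  generalize columns (indexOf w a) = L at hnd hmem hlen
  subst hlen
  have hinj : Function.Injective fun l => (w l, a l) := fun l l' hll =>
    h l l' (Prod.ext_iff.1 hll).1 (Prod.ext_iff.1 hll).2
  choose f hf using fun c : Fin L.length => (hmem (L.get c)).1 (L.get_mem c)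
  have hfinj : Function.Injective f := by
    intro c c' hcc
    have : L.get c = L.get c' := by rw [← hf, ← hf, hcc]
    exact List.nodup_iff_injective_get.1 hnd this
  set σ : Equiv.Perm (Fin L.length) :=
    Equiv.ofBijective f (Finite.injective_iff_bijective.1 hfinj) with hσ
  have h1 : (fun c => (L.get c).1) = w ∘ σ := by
    funext c; rw [← hf c]; rfl
  have h2 : (fun c => (L.get c).2) = a ∘ σ := by
    funext c; rw [← hf c]; rfl
  refine ⟨Equiv.Perm.sign σ, ?_⟩
  rw [h1, h2, colDet_comp_perm, ← mul_assoc]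
  have : ((Equiv.Perm.sign σ : ℤ) : A) * ((Equiv.Perm.sign σ : ℤ) : A) = 1 := by
    rw [← Int.cast_mul, ← Units.val_mul, Int.units_mul_self]; simp
  rw [this, one_mul]

lemma isPreIndex_indexOf {w : Fin d → Fin (N + 1)} {a : Fin d → ℕ}
    (h : ∀ l l', w l = w l' → a l = a l' → l = l') (hw : Monotone w) (ha : ∀ l, a l ≤ l) :
    IsPreIndex d (indexOf w a) where
  increasing i := Finset.sortedLT_sort _ |>.pairwise
  lt_partialLength i s hs := by
    obtain ⟨l, rfl, rfl⟩ := mem_indexOf.1 hs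
    rw [partialLength_indexOf h]
    refine lt_of_le_of_lt (ha l) ?_
    rw [Nat.lt_iff_add_one_le, ← Fin.card_Iic l]
    refine Finset.card_le_card fun l' hl' => ?_
    simpa using hw (Finset.mem_Iic.1 hl')
  length_eq := by
    simp only [length_indexOf h]
    rw [← Finset.card_eq_sum_card_fiberwise (f := w) (t := Finset.univ) (by simp)]
    simp

/-- The witness is the letter `w i`. Since `w` is monotone, column `l` has at least `l + 1` columns
with letter at most its own. Columns after `i` are strictly below the staircase; columns before `i`
with the letter `w i` have exponent below `i`, hence below the bound as well. -/
lemma isIndex_indexOf {w : Fin d → Fin (N + 1)} {a : Fin d → ℕ}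
    (h : ∀ l l', w l = w l' → a l = a l' → l = l') (hw : Monotone w) (ha : ∀ l, a l ≤ l)
    {i : Fin d} (hi : a i = 0) (hlt : ∀ j, i < j → a j < j) : IsIndex d (indexOf w a) where
  increasing := (isPreIndex_indexOf h hw ha).increasing
  lt_partialLength := (isPreIndex_indexOf h hw ha).lt_partialLength
  length_eq := (isPreIndex_indexOf h hw ha).length_eq
  exists_head_zero := by
    have hcard : ∀ l : Fin d, (l : ℕ) + 1 ≤ partialLength (indexOf w a) (w l) := by
      intro l
      rw [partialLength_indexOf h, ← Fin.card_Iic l]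
      refine Finset.card_le_card fun l' hl' => ?_
      simpa using hw (Finset.mem_Iic.1 hl')
    refine ⟨w i, ?_, ?_, ?_⟩
    · have hmem : 0 ∈ indexOf w a (w i) := mem_indexOf.2 ⟨i, rfl, hi⟩
      have hsort := (isPreIndex_indexOf h hw ha).increasing (w i)
      cases hL : indexOf w a (w i) with
      | nil => rw [hL] at hmem; simp at hmem
      | cons b L =>
        rw [hL] at hmem hsort
        rcases List.mem_cons.1 hmem with rfl | hm
        · rfl
        · exact absurd (List.rel_of_pairwise_cons hsort hm) (by omega)
    · intro hlen s hs
      obtain ⟨l, hl, rfl⟩ := mem_indexOf.1 (List.mem_of_getLast? hs)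
      rcases lt_trichotomy l i with h1 | rfl | h1
      · have h2 := ha l
        have h3 := hcard i
        rw [Fin.lt_def] at h1
        omega
      · rw [hi]
        have : (indexOf w a (w l)).length ≤ partialLength (indexOf w a) (w l) :=
          Finset.single_le_sum (f := fun j => (indexOf w a j).length) (fun _ _ => Nat.zero_le _)
            (Finset.mem_Iic.2 le_rfl)
        omega
      · have h2 := hlt l h1
        have h3 := hcard l
        rw [hl] at h3
        omega
    · intro j hj s hs
      obtain ⟨l, rfl, rfl⟩ := mem_indexOf.1 (List.mem_of_getLast? hs)
      have h1 : i < l := by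
        by_contra hc
        exact absurd (hw (not_lt.1 hc)) (not_le.2 hj)
      have h2 := hlt l h1
      have h3 := hcard l
      omega

variable {A : Type*} [CommRing A] [Algebra ℂ A] {x : Fin (N + 1) → ℕ → A}

/-- Sorting the letters and the exponents of a determinant. -/
lemma colDet_mem_of_monotone {Q : Submodule ℂ A}
    (hQ : ∀ w : Fin d → Fin (N + 1), Monotone w → ∀ a : Fin d → ℕ, colDet x w a ∈ Q)
    (w : Fin d → Fin (N + 1)) (a : Fin d → ℕ) : colDet x w a ∈ Q := by
  have h1 := hQ _ (Tuple.monotone_sort w) (a ∘ Tuple.sort w)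
  rw [colDet_comp_perm, ← zsmul_eq_mul] at h1
  rcases Int.units_eq_one_or (Equiv.Perm.sign (Tuple.sort w)) with hs | hs
  · rw [hs] at h1; simpa using h1
  · rw [hs] at h1; simpa using h1

lemma colDet_mem_of_index {Q : Submodule ℂ A} {w : Fin d → Fin (N + 1)} {a : Fin d → ℕ}
    (hQ : (∀ l l', w l = w l' → a l = a l' → l = l') → W x (indexOf w a) ∈ Q) :
    colDet x w a ∈ Q := by
  by_cases h : ∀ l l', w l = w l' → a l = a l' → l = l'
  · obtain ⟨n, hn⟩ := exists_colDet_eq_mul_W x h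
    rw [hn, ← zsmul_eq_mul]
    exact zsmul_mem (hQ h) n
  · push Not at h
    obtain ⟨l, l', h1, h2, h3⟩ := h
    rw [colDet_eq_zero h3 h1 h2]
    exact Q.zero_mem

/-- Rewriting changes only the exponents, so the letters can be sorted once and for all; exponents
below the staircase under sorted letters form a pre-index. -/
theorem colDet_mem_of_preIndex {Q : Submodule ℂ A}
    (hQ : ∀ α : Fin (N + 1) → List ℕ, IsPreIndex d α → W x α ∈ Q)
    (w : Fin d → Fin (N + 1)) (a : Fin d → ℕ) : colDet x w a ∈ Q :=
  colDet_mem_of_monotone (fun w hw => (isHarmonic_colDet x w).mem_of_staircase fun _ ha =>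
    colDet_mem_of_index fun h => hQ _ (isPreIndex_indexOf h hw ha)) w a

/-- The refined staircase leaves two cases: indices, covered by `hQ`, and exponents with at most one
zero. With no zero the first row vanishes; with one zero the determinant factors and `hQ'` applies.
-/
theorem colDet_mem_of_isIndex {Q : Submodule ℂ A}
    (hQ : ∀ α : Fin (N + 1) → List ℕ, IsIndex (d + 1) α → W x α ∈ Q)
    (hQ' : ∀ (i : Fin (N + 1)) (w : Fin d → Fin (N + 1)) (a : Fin d → ℕ),
      x i 0 * colDet x w a ∈ Q)
    (w : Fin (d + 1) → Fin (N + 1)) (a : Fin (d + 1) → ℕ) : colDet x w a ∈ Q := by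
  refine colDet_mem_of_monotone (fun w hw =>
    (isHarmonic_colDet x w).mem_of_refined_staircase (fun a ha => ?_) fun a i ha hi hlt =>
      colDet_mem_of_index fun h => hQ _ (isIndex_indexOf h hw ha hi hlt)) w a
  by_cases hz : ∃ l, a l = 0
  · obtain ⟨l, hl⟩ := hz
    obtain ⟨n, hn⟩ := colDet_eq_mul (x := x) (w := w) hl fun l' hl' h0 => hl' (ha _ _ h0 hl)
    rw [hn]
    exact zsmul_mem (hQ' _ _ _) n
  · rw [colDet_eq_zero_of_forall_ne_zero fun l hl => hz ⟨l, hl⟩]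
    exact Q.zero_mem

lemma exists_isIndex_one (i : Fin (N + 1)) : ∃ α : Fin (N + 1) → List ℕ, IsIndex 1 α ∧
    ∀ {Q : Submodule ℂ A}, W x α ∈ Q → x i 0 ∈ Q := by
  refine ⟨indexOf (fun _ : Fin 1 => i) (fun _ => 0), ?_, fun {Q} hQ => ?_⟩
  · exact isIndex_indexOf (fun _ _ _ _ => Subsingleton.elim _ _) (fun _ _ _ => le_rfl) (by simp)
      (i := 0) rfl fun j hj => absurd hj (by simp [Subsingleton.elim j 0])
  · have h1 : colDet x (fun _ : Fin 1 => i) (fun _ => 0) ∈ Q := colDet_mem_of_index fun _ => hQ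
    simpa [colDet] using h1

theorem colDet_mem_of_genFamily {S : Subalgebra ℂ A} {e : ℕ}
    (hS : ∀ i ∈ Finset.Icc 1 e, genFamily x i ⊆ S) :
    ∀ {d : ℕ}, d ≤ e → ∀ (w : Fin d → Fin (N + 1)) (a : Fin d → ℕ), colDet x w a ∈ S := by
  have hx : 1 ≤ e → ∀ i, x i 0 ∈ S := by
    intro he i
    obtain ⟨α, hα, h⟩ := exists_isIndex_one (x := x) i
    exact h (Q := Subalgebra.toSubmodule S) (hS 1 (by simp [he]) ⟨α, hα, rfl⟩)
  intro d
  induction d with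
  | zero => intro _ w a; simp [colDet]
  | succ d ih =>
    intro hd w a
    refine colDet_mem_of_isIndex (Q := Subalgebra.toSubmodule S)
      (fun α hα => hS (d + 1) (by simp; omega) ⟨α, hα, rfl⟩) (fun i w a => ?_) w a
    exact S.mul_mem (hx (by omega) i) (ih (by omega) w a)

end Sorting

/-! ### Generation of the algebra -/

section Generation

variable {N : ℕ}

lemma W_mem_diffHom {d : ℕ} {α : Fin (N + 1) → List ℕ} (h : ∑ i, (α i).length = d) :
    W (fun i j => (X (i, j) : V N)) α ∈ diffHom N d := by
  rw [← h, ← length_columns]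
  exact colDet_mem_diffHom _ _

lemma W_mem_orderLE {d k : ℕ} {α : Fin (N + 1) → List ℕ} (h : ∑ i, (α i).length = d)
    (hd : d ≤ k + 1) : W (fun i j => (X (i, j) : V N)) α ∈ orderLE N k := by
  refine colDet_mem_orderLE ?_ _ _
  rwa [length_columns, h]

theorem mem_adjoin_of_mem_diffHom {d k : ℕ} {P : V N} (hP : P ∈ diffHom N d)
    (hk : P ∈ orderLE N k) :
    P ∈ Algebra.adjoin ℂ (⋃ i ∈ Finset.Icc 1 (k + 1), G N i) := by
  set S := Algebra.adjoin ℂ (⋃ i ∈ Finset.Icc 1 (k + 1), G N i) with hS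
  change P ∈ Subalgebra.toSubmodule S
  refine (Submodule.span_le (p := Subalgebra.toSubmodule S)).2 ?_ (mem_span_blockDet hP hk)
  rintro _ ⟨p, w, c, hp, rfl⟩
  refine blockDet_mem S w c fun h m hm w' c' => ?_
  refine colDet_mem_of_genFamily (e := k + 1) (fun i hi g hg => ?_) ?_ w' c'
  · exact Algebra.subset_adjoin (Set.mem_biUnion hi hg)
  · rw [← hm, hp]; exact rowLength_le d k h

lemma exists_mem_orderLE (P : V N) (d : ℕ) : ∃ k, d ≤ k + 1 ∧ P ∈ orderLE N k := by
  refine ⟨max (P.vars.sup Prod.snd) d, by omega, mem_orderLE.2 fun v hv => ?_⟩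
  exact le_max_of_le_left (Finset.le_sup (f := Prod.snd) hv)

/-- With an order bound `k` so large that `d ≤ k + 1`, the partition has a single row. The block
determinants are then single determinants of size `d`. -/
theorem mem_span_W {d : ℕ} {P : V N} (hP : P ∈ diffHom N d) :
    P ∈ Submodule.span ℂ {Q : V N | ∃ α, IsPreIndex d α ∧ Q = W (fun i j => X (i, j)) α} := by
  obtain ⟨k, hdk, hk⟩ := exists_mem_orderLE P d
  refine (Submodule.span_le).2 ?_ (mem_span_blockDet hP hk)
  rintro _ ⟨p, w, c, hp, rfl⟩
  have hp0 : p = fun _ => 0 := by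
    funext i
    by_contra hne
    have h1 := hp (p i)
    have h2 := blockRank_lt_card p i
    rw [h1, rowLength] at h2
    obtain ⟨m, hm⟩ := Nat.exists_eq_succ_of_ne_zero hne
    have h3 : (p i) * (k + 1) = m * (k + 1) + (k + 1) := by
      rw [hm, Nat.succ_mul]
    omega
  rw [hp0, blockDet_const]
  exact colDet_mem_of_preIndex (Q := Submodule.span ℂ {Q : V N | ∃ α, IsPreIndex d α ∧
    Q = W (fun i j => X (i, j)) α}) (fun α hα => Submodule.subset_span ⟨α, hα, rfl⟩) w c

lemma homogeneousComponent_of_mem_diffHom {d : ℕ} {P : V N} (hP : P ∈ diffHom N d) (e : ℕ) :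
    homogeneousComponent e P = if e = d then P else 0 := by
  rw [homogeneousComponent_of_mem (isHomogeneous_of_mem_diffHom hP)]

lemma mem_diffAlg_iff {P : V N} :
    P ∈ diffAlg N ↔ ∀ d, homogeneousComponent d P ∈ diffHom N d := by
  constructor
  · rintro ⟨x, rfl⟩ d
    induction x using DirectSum.induction_on with
    | zero => simp
    | of i p =>
      change homogeneousComponent d (DirectSum.coeAlgHom (diffHom N) (DirectSum.of _ i p)) ∈ _
      rw [DirectSum.coeAlgHom_of, homogeneousComponent_of_mem_diffHom p.2]
      split_ifs with h
      · rw [h]; exact p.2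
      · exact zero_mem _
    | add x y hx hy =>
      change homogeneousComponent d (DirectSum.coeAlgHom (diffHom N) (x + y)) ∈ _
      rw [map_add, map_add]
      exact add_mem hx hy
  · intro h
    rw [← sum_homogeneousComponent P]
    refine sum_mem fun i _ => ⟨DirectSum.of (fun i => diffHom N i) i ⟨_, h i⟩, ?_⟩
    exact DirectSum.coeAlgHom_of _ _ _

lemma diffHom_le_diffAlg {d : ℕ} {P : V N} (hP : P ∈ diffHom N d) : P ∈ diffAlg N :=
  ⟨DirectSum.of (fun i => diffHom N i) d ⟨P, hP⟩, DirectSum.coeAlgHom_of _ _ _⟩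

lemma homogeneousComponent_mem_orderLE {k : ℕ} {P : V N} (h : P ∈ orderLE N k) (d : ℕ) :
    homogeneousComponent d P ∈ orderLE N k := by
  rw [mem_orderLE] at h ⊢
  intro v hv
  rw [mem_vars_iff_mem_support] at hv
  obtain ⟨m, hm, hv⟩ := hv
  refine h v ((mem_vars_iff_mem_support v).2 ⟨m, ?_, hv⟩)
  rw [mem_support_iff, coeff_homogeneousComponent] at hm
  rw [mem_support_iff]
  intro h0
  exact hm (by simp [h0])

/-- The generators generate the algebra of differentially homogeneous polynomials of order at
most `k`. -/
theorem adjoin_G (N k : ℕ) :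
    Algebra.adjoin ℂ (⋃ i ∈ Finset.Icc 1 (k + 1), G N i) = diffAlgLE N k := by
  refine le_antisymm (Algebra.adjoin_le ?_) fun P hP => ?_
  · refine Set.iUnion₂_subset fun i hi => ?_
    rintro _ ⟨α, hα, rfl⟩
    exact ⟨diffHom_le_diffAlg (W_mem_diffHom hα.length_eq),
      W_mem_orderLE hα.length_eq (Finset.mem_Icc.1 hi).2⟩
  · rw [← sum_homogeneousComponent P]
    exact sum_mem fun i _ => mem_adjoin_of_mem_diffHom (mem_diffAlg_iff.1 hP.1 i)
      (homogeneousComponent_mem_orderLE hP.2 i)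

end Generation

/-! ### Indices as words, and upper bounds on their number -/

section Words

variable {N : ℕ}

/-- The index attached to a word, written from its last letter to its first letter: the
positions of the letter `i` in the subword of the letters `≤ i`. -/
def ofWord : List (Fin (N + 1)) → Fin (N + 1) → List ℕ
  | [] => fun _ => []
  | i :: w => Function.update (ofWord w) i (ofWord w i ++ [partialLength (ofWord w) i])

lemma partialLength_update (α : Fin (N + 1) → List ℕ) (i : Fin (N + 1)) (L : List ℕ)
    (j : Fin (N + 1)) : partialLength (Function.update α i L) j + (if i ≤ j then (α i).length else 0)
      = partialLength α j + if i ≤ j then L.length else 0 := by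
  unfold partialLength
  by_cases h : i ≤ j
  · have hm : i ∈ Finset.Iic j := Finset.mem_Iic.2 h
    rw [if_pos h, if_pos h, ← Finset.add_sum_erase _ _ hm, ← Finset.add_sum_erase _ _ hm,
      Function.update_self]
    rw [Finset.sum_congr rfl fun l hl => by
      rw [Function.update_of_ne (Finset.ne_of_mem_erase hl)]]
    omega
  · rw [if_neg h, if_neg h]
    congr 1
    refine Finset.sum_congr rfl fun l hl => ?_
    rw [Function.update_of_ne]
    rintro rfl
    exact h (Finset.mem_Iic.1 hl)

lemma length_le_partialLength (α : Fin (N + 1) → List ℕ) {i j : Fin (N + 1)} (h : i ≤ j) :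
    (α i).length ≤ partialLength α j :=
  Finset.single_le_sum (f := fun j => (α j).length) (fun _ _ => Nat.zero_le _)
    (Finset.mem_Iic.2 h)

lemma length_ofWord (w : List (Fin (N + 1))) (i : Fin (N + 1)) :
    (ofWord w i).length = w.count i := by
  induction w with
  | nil => simp [ofWord]
  | cons j w ih =>
    rw [ofWord, List.count_cons]
    by_cases h : i = j
    · subst h; simp [ih]
    · rw [Function.update_of_ne h, ih]
      simp [Ne.symm h]

lemma length_le_of_pairwise_lt {L : List ℕ} {b : ℕ} (h : L.Pairwise (· < ·))
    (hb : ∀ a ∈ L, a < b) : L.length ≤ b := by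
  have h1 : L.toFinset ⊆ Finset.range b := fun a ha => by
    simpa using hb a (by simpa using ha)
  have h2 := Finset.card_le_card h1
  rwa [List.toFinset_card_of_nodup (h.imp fun h => h.ne), Finset.card_range] at h2

/-- The last letter of the word of an index. -/
lemma IsPreIndex.exists_last {d : ℕ} {α : Fin (N + 1) → List ℕ} (h : IsPreIndex (d + 1) α) :
    ∃ i L, α i = L ++ [partialLength α i - 1] ∧ 0 < partialLength α i ∧
      ∀ j, i < j → ∀ a ∈ α j, a + 1 < partialLength α j := by
  classical
  have hconcat : ∀ i, α i ≠ [] → ∃ L b, α i = L ++ [b] := fun i hi => by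
    rcases List.eq_nil_or_concat (α i) with h0 | ⟨L, b, h0⟩
    · exact absurd h0 hi
    · exact ⟨L, b, by simpa using h0⟩
  -- The first nonempty tuple works: it is a strictly increasing list of numbers smaller than its
  -- own length, so it ends with its length minus one.
  have hex : ∃ i L, α i = L ++ [partialLength α i - 1] := by
    have hne : ∃ i, α i ≠ [] := by
      by_contra! hc
      have := h.length_eq
      simp [hc] at this
    obtain ⟨i, hi, hmin⟩ := (Finset.univ.filter fun i => α i ≠ []).exists_min_image id
      ⟨hne.choose, by simpa using hne.choose_spec⟩
    simp only [Finset.mem_filter, Finset.mem_univ, true_and, id] at hi hmin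
    have hs : partialLength α i = (α i).length := by
      unfold partialLength
      refine Finset.sum_eq_single i (fun j hj hji => ?_) (by simp)
      by_contra hc
      exact hji (le_antisymm (Finset.mem_Iic.1 hj) (hmin j fun h0 => hc (by simp [h0])))
    obtain ⟨L, b, hL⟩ := hconcat i hi
    refine ⟨i, L, ?_⟩
    have h1 := h.lt_partialLength i b (by simp [hL])
    have h2 := h.increasing i
    rw [hL, List.pairwise_append] at h2
    have h3 := length_le_of_pairwise_lt h2.1 fun a ha => h2.2.2 a ha b (by simp)
    rw [hs, hL] at h1 ⊢
    simp only [List.length_append, List.length_singleton] at h1 ⊢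
    rw [show b = L.length + 1 - 1 by omega]
  -- The last letter is the largest `i` whose tuple ends at its bound: for larger letters there is
  -- room, so their bound survives the removal of one column.
  obtain ⟨i, hi, hmax⟩ := (Finset.univ.filter fun i =>
    ∃ L, α i = L ++ [partialLength α i - 1]).exists_max_image id
      ⟨hex.choose, by simpa using hex.choose_spec⟩
  simp only [Finset.mem_filter, Finset.mem_univ, true_and, id] at hi hmax
  obtain ⟨L, hL⟩ := hi
  refine ⟨i, L, hL, ?_, fun j hj a ha => ?_⟩
  · have := h.lt_partialLength i (partialLength α i - 1) (by rw [hL]; simp)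
    omega
  · obtain ⟨L', b, hL'⟩ := hconcat j (List.ne_nil_of_mem ha)
    have h1 := h.lt_partialLength j b (by simp [hL'])
    have h2 := h.increasing j
    rw [hL', List.pairwise_append] at h2
    have h3 : b ≠ partialLength α j - 1 := by
      intro hb
      exact absurd (hmax j ⟨L', by rw [← hb]; exact hL'⟩) (not_le.2 hj)
    rw [hL', List.mem_append, List.mem_singleton] at ha
    rcases ha with ha | rfl
    · have := h2.2.2 a ha b (by simp); omega
    · omega

lemma IsPreIndex.exists_word {d : ℕ} {α : Fin (N + 1) → List ℕ} (h : IsPreIndex d α) :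
    ∃ w : List (Fin (N + 1)), w.length = d ∧ ofWord w = α := by
  induction d generalizing α with
  | zero =>
    refine ⟨[], rfl, ?_⟩
    funext i
    have := h.length_eq
    rw [Finset.sum_eq_zero_iff] at this
    exact (List.length_eq_zero_iff.1 (this i (Finset.mem_univ i))).symm
  | succ d ih =>
    obtain ⟨i, L, hL, hpos, hlast⟩ := h.exists_last
    have hlen : (α i).length = L.length + 1 := by rw [hL]; simp
    have hpl : ∀ j, partialLength (Function.update α i L) j + (if i ≤ j then 1 else 0) =
        partialLength α j := by
      intro j
      have := partialLength_update α i L j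
      rw [hlen] at this
      split_ifs at this ⊢ <;> omega
    have hinc := h.increasing i
    rw [hL, List.pairwise_append] at hinc
    obtain ⟨w, hw, hα⟩ := ih (α := Function.update α i L) {
      increasing := fun j => by
        by_cases hj : j = i
        · subst hj; rw [Function.update_self]; exact hinc.1
        · rw [Function.update_of_ne hj]; exact h.increasing j
      lt_partialLength := fun j a ha => by
        have h1 := hpl j
        by_cases hj : j = i
        · subst hj
          rw [Function.update_self] at ha
          have := hinc.2.2 a ha _ (List.mem_singleton_self _)
          rw [if_pos le_rfl] at h1
          omega
        · rw [Function.update_of_ne hj] at ha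
          rcases lt_or_gt_of_ne hj with h2 | h2
          · rw [if_neg (not_le.2 h2)] at h1
            have := h.lt_partialLength j a ha
            omega
          · rw [if_pos h2.le] at h1
            have := hlast j h2 a ha
            omega
      length_eq := by
        have h1 := h.length_eq
        have hm := Finset.mem_univ i
        rw [← Finset.add_sum_erase _ _ hm] at h1 ⊢
        rw [Function.update_self, Finset.sum_congr rfl fun l hl => by
          rw [Function.update_of_ne (Finset.ne_of_mem_erase hl)]]
        omega }
    refine ⟨i :: w, by simp [hw], ?_⟩
    rw [ofWord, hα, Function.update_self, Function.update_idem]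
    have h1 := hpl i
    rw [if_pos le_rfl] at h1
    rw [show partialLength (Function.update α i L) i = partialLength α i - 1 by omega, ← hL,
      Function.update_eq_self]

/-- The tuple of `j` starts with 0 when no letter `≤ j` precedes the first `j`. The first letter of
the word, stored last in the list, is then `j` itself or larger. -/
lemma le_getLast_of_head?_ofWord (w : List (Fin (N + 1))) (hw : w ≠ []) {j : Fin (N + 1)}
    (hj : (ofWord w j).head? = some 0) : j ≤ w.getLast hw := by
  induction w generalizing j with
  | nil => exact absurd rfl hw
  | cons i w ih =>
    by_cases hw' : w = []
    · subst hw'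
      by_cases hji : j = i
      · simp [hji]
      · rw [ofWord, Function.update_of_ne hji] at hj
        simp [ofWord] at hj
    · rw [List.getLast_cons hw']
      by_cases hji : j = i
      · subst hji
        rw [ofWord, Function.update_self] at hj
        by_cases h0 : ofWord w j = []
        · rw [h0] at hj
          simp only [List.nil_append, List.head?_cons, Option.some.injEq] at hj
          by_contra hc
          have h1 := length_le_partialLength (ofWord w) (not_le.1 hc).le
          rw [hj, length_ofWord] at h1
          have := List.count_pos_iff.2 (List.getLast_mem hw')
          omega
        · rw [List.head?_append_of_ne_nil _ h0] at hj
          exact ih hw' hj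
      · rw [ofWord, Function.update_of_ne hji] at hj
        exact ih hw' hj

lemma IsIndex.isPreIndex {d : ℕ} {α : Fin (N + 1) → List ℕ} (h : IsIndex d α) :
    IsPreIndex d α := ⟨h.increasing, h.lt_partialLength, h.length_eq⟩

/-- The last letter of the word of a generator is smaller than the first one. -/
lemma head_lt_getLast_of_isIndex {d : ℕ} {i : Fin (N + 1)} {w : List (Fin (N + 1))} (hw : w ≠ [])
    (h : IsIndex d (ofWord (i :: w))) : i < w.getLast hw := by
  obtain ⟨i0, h1, h2, h3⟩ := h.exists_head_zero
  have h4 := le_getLast_of_head?_ofWord (i :: w) (List.cons_ne_nil _ _) h1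
  rw [List.getLast_cons hw] at h4
  have hpl := partialLength_update (ofWord w) i (ofWord w i ++ [partialLength (ofWord w) i]) i
  rw [if_pos le_rfl, if_pos le_rfl, List.length_append, List.length_singleton] at hpl
  have hlast : partialLength (ofWord w) i ∈ (ofWord (i :: w) i).getLast? := by
    rw [ofWord, Function.update_self]; simp
  have h5 : i ≤ i0 := by
    by_contra hc
    have := h3 i (not_le.1 hc) _ hlast
    rw [ofWord] at this
    omega
  refine lt_of_le_of_ne (h5.trans h4) fun he => ?_
  obtain rfl : i = i0 := le_antisymm h5 (h4.trans he.ge)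
  have hlen : 1 < (ofWord (i :: w) i).length := by
    rw [length_ofWord, List.count_cons_self]
    have : 0 < w.count i := List.count_pos_iff.2 (he ▸ List.getLast_mem hw)
    omega
  have := h2 hlen _ hlast
  rw [ofWord] at this
  omega

/-- Every pre-index comes from a word, so words of length `d` index a spanning family; this is the
upper bound `(N + 1)^d` on the dimension. -/
lemma diffHom_le_span_ofWord (N d : ℕ) : diffHom N d ≤ Submodule.span ℂ (Set.range
    fun w : Fin d → Fin (N + 1) => W (fun i j => (X (i, j) : V N)) (ofWord (List.ofFn w))) := by
  intro P hP
  refine (Submodule.span_le).2 ?_ (mem_span_W hP)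
  rintro _ ⟨α, hα, rfl⟩
  obtain ⟨w, rfl, rfl⟩ := hα.exists_word
  exact Submodule.subset_span ⟨w.get, by simp⟩

lemma card_pairs_lt (N : ℕ) :
    Fintype.card {p : Fin (N + 1) × Fin (N + 1) // p.1 < p.2} = N * (N + 1) / 2 := by
  have h : ∀ b : Fin (N + 1), (Finset.univ.filter fun a : Fin (N + 1) => a < b).card = b := by
    intro b
    have : (Finset.univ.filter fun a : Fin (N + 1) => a < b) = Finset.Iio b := by ext; simp
    rw [this, Fin.card_Iio]
  rw [Fintype.card_subtype, Finset.card_filter, ← Finset.univ_product_univ,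
    Finset.sum_product_right]
  simp_rw [← Finset.card_filter, h]
  rw [Fin.sum_univ_eq_sum_range (fun i => i), Finset.sum_range_id, Nat.add_sub_cancel, mul_comm]

/-- The number of generators is at most the expected one. -/
theorem encard_genFamily_le {A : Type*} [CommRing A] (x : Fin (N + 1) → ℕ → A) {d : ℕ}
    (hd : 1 ≤ d) : (genFamily x d).encard ≤ (numGen N d : ℕ∞) := by
  have key : ∀ (T : Type) [Fintype T] (f : T → A), genFamily x d ⊆ Set.range f →
      Fintype.card T = numGen N d → (genFamily x d).encard ≤ (numGen N d : ℕ∞) := by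
    intro T _ f hf hT
    refine (Set.encard_le_encard hf).trans ?_
    rw [← Set.image_univ, ← hT]
    refine (Set.encard_image_le f Set.univ).trans ?_
    rw [Set.encard_univ, ENat.card_eq_coe_fintype_card]
  by_cases h1 : d = 1
  · subst h1
    refine key (Fin (N + 1)) (fun i => W x (ofWord [i])) ?_ (by simp [numGen])
    rintro _ ⟨α, hα, rfl⟩
    obtain ⟨w, hw, rfl⟩ := hα.isPreIndex.exists_word
    obtain ⟨i, rfl⟩ := List.length_eq_one_iff.1 hw
    exact ⟨i, rfl⟩
  · obtain ⟨e, rfl⟩ : ∃ e, d = e + 2 := ⟨d - 2, by omega⟩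
    -- A generator is given by the two extreme letters of its word, which are strictly ordered, and
    -- by `e` unconstrained letters between them.
    refine key ({p : Fin (N + 1) × Fin (N + 1) // p.1 < p.2} × (Fin e → Fin (N + 1)))
      (fun t => W x (ofWord (t.1.1.1 :: (List.ofFn t.2 ++ [t.1.1.2])))) ?_ ?_
    · rintro _ ⟨α, hα, rfl⟩
      obtain ⟨w, hw, rfl⟩ := hα.isPreIndex.exists_word
      obtain ⟨i, w, rfl⟩ := List.exists_cons_of_length_eq_add_one hw
      simp only [List.length_cons, Nat.add_right_cancel_iff] at hw
      have hne : w ≠ [] := by rintro rfl; simp at hw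
      have hlt := head_lt_getLast_of_isIndex hne hα
      have hlen : w.dropLast.length = e := by simp [hw]
      subst hlen
      refine ⟨(⟨(i, w.getLast hne), hlt⟩, w.dropLast.get), ?_⟩
      simp only [List.ofFn_get, List.dropLast_append_getLast]
    · rw [Fintype.card_prod, card_pairs_lt, numGen, if_neg h1]
      simp

end Words

/-! ### Limits of modules over `ℂ⟦ε⟧` at the closed point -/

section Limits

variable {A : Type*} [CommRing A] [Algebra ℂ A]

lemma algebraMap_series (k : PowerSeries ℂ) :
    algebraMap (PowerSeries ℂ) (PowerSeries A) k = PowerSeries.map (algebraMap ℂ A) k := rfl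

lemma coeff_series_smul (k : PowerSeries ℂ) (p : PowerSeries A) (n : ℕ) :
    PowerSeries.coeff n (k • p) = ∑ x ∈ Finset.HasAntidiagonal.antidiagonal n,
      PowerSeries.coeff x.1 k • PowerSeries.coeff x.2 p := by
  rw [Algebra.smul_def, PowerSeries.coeff_mul]
  refine Finset.sum_congr rfl fun x _ => ?_
  rw [algebraMap_series, PowerSeries.coeff_map, Algebra.smul_def]

lemma constantCoeff_series_smul (k : PowerSeries ℂ) (p : PowerSeries A) :
    PowerSeries.constantCoeff (k • p) =
      PowerSeries.constantCoeff k • PowerSeries.constantCoeff p := by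
  simpa using coeff_series_smul k p 0

lemma X_pow_series_smul (m : ℕ) (p : PowerSeries A) :
    (PowerSeries.X : PowerSeries ℂ) ^ m • p = PowerSeries.X ^ m * p := by
  rw [Algebra.smul_def, algebraMap_series, map_pow, PowerSeries.map_X]

/-- The limit at the closed point of a family of vectors over `ℂ⟦ε⟧`: the constant
coefficients of the elements of the saturation. -/
def limitSpace (E : Submodule (PowerSeries ℂ) (PowerSeries A)) : Submodule ℂ A where
  carrier := {v | ∃ (p : PowerSeries A) (m : ℕ),
    (PowerSeries.X : PowerSeries ℂ) ^ m • p ∈ E ∧ PowerSeries.constantCoeff p = v}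
  add_mem' := by
    rintro _ _ ⟨p, m, hp, rfl⟩ ⟨q, l, hq, rfl⟩
    refine ⟨p + q, m + l, ?_, map_add _ _ _⟩
    have h : (PowerSeries.X : PowerSeries ℂ) ^ (m + l) • (p + q) =
        (PowerSeries.X : PowerSeries ℂ) ^ l • ((PowerSeries.X : PowerSeries ℂ) ^ m • p) +
        (PowerSeries.X : PowerSeries ℂ) ^ m • ((PowerSeries.X : PowerSeries ℂ) ^ l • q) := by
      rw [smul_smul, smul_smul, ← pow_add, ← pow_add, add_comm l m, smul_add]
    rw [h]
    exact add_mem (E.smul_mem _ hp) (E.smul_mem _ hq)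
  zero_mem' := ⟨0, 0, by simp, map_zero _⟩
  smul_mem' := by
    rintro c _ ⟨p, m, hp, rfl⟩
    refine ⟨PowerSeries.C c • p, m, ?_, ?_⟩
    · rw [smul_comm]
      exact E.smul_mem _ hp
    · rw [constantCoeff_series_smul, PowerSeries.constantCoeff_C]

lemma limitSpace_mono {E E' : Submodule (PowerSeries ℂ) (PowerSeries A)} (h : E ≤ E') :
    limitSpace E ≤ limitSpace E' := by
  rintro _ ⟨p, m, hp, rfl⟩
  exact ⟨p, m, h hp, rfl⟩

lemma mul_mem_limitSpace {E E' : Submodule (PowerSeries ℂ) (PowerSeries A)} {v v' : A}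
    (hv : v ∈ limitSpace E) (hv' : v' ∈ limitSpace E') : v * v' ∈ limitSpace (E * E') := by
  obtain ⟨p, m, hp, rfl⟩ := hv
  obtain ⟨q, l, hq, rfl⟩ := hv'
  refine ⟨p * q, m + l, ?_, map_mul _ _ _⟩
  rw [pow_add, ← smul_mul_smul_comm]
  exact Submodule.mul_mem_mul hp hq

/-- The coefficients of a linear relation vanish order by order: the lowest order that is left would
be a relation between the constant terms. -/
lemma linearIndependent_of_constantCoeff {ι : Type*} [Fintype ι] {p : ι → PowerSeries A}
    (h : LinearIndependent ℂ fun i => PowerSeries.constantCoeff (p i)) :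
    LinearIndependent (PowerSeries ℂ) p := by
  rw [Fintype.linearIndependent_iff] at h ⊢
  intro k hk
  have key : ∀ n i, PowerSeries.coeff n (k i) = 0 := by
    intro n
    induction n using Nat.strong_induction_on with
    | _ n ih =>
      refine h (fun i => PowerSeries.coeff n (k i)) ?_
      have h1 := congrArg (PowerSeries.coeff n) hk
      rw [map_sum, map_zero] at h1
      rw [← h1]
      refine Finset.sum_congr rfl fun i _ => ?_
      rw [coeff_series_smul, Finset.sum_eq_single (n, 0)]
      · simp
      · intro x hx hne
        rw [Finset.HasAntidiagonal.mem_antidiagonal] at hx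
        rw [ih x.1 _ i, zero_smul]
        by_contra hc
        exact hne (Prod.ext (by simp; omega) (by simp; omega))
      · simp
  exact fun i => PowerSeries.ext fun n => by rw [key n i, map_zero]

/-- Independent limit vectors lift to independent series. These stay independent after
multiplication by powers of `ε`, which brings them into a module with `|T|` generators. -/
lemma card_le_of_limitSpace {E : Submodule (PowerSeries ℂ) (PowerSeries A)} {T : Type*}
    [Fintype T] {g : T → PowerSeries A} (hE : E ≤ Submodule.span _ (Set.range g))
    {ι : Type*} [Fintype ι] {v : ι → A} (hv : LinearIndependent ℂ v)
    (hv' : ∀ i, v i ∈ limitSpace E) : Fintype.card ι ≤ Fintype.card T := by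
  classical
  choose p m hp hpv using hv'
  have h1 : LinearIndependent (PowerSeries ℂ) p :=
    linearIndependent_of_constantCoeff (by simpa only [hpv] using hv)
  have h2 : LinearIndependent (PowerSeries ℂ)
      fun i => (PowerSeries.X : PowerSeries ℂ) ^ m i • p i := by
    rw [Fintype.linearIndependent_iff] at h1 ⊢
    intro k hk i
    simp only [smul_smul] at hk
    have := h1 _ hk i
    exact (mul_eq_zero.1 this).resolve_right (pow_ne_zero _ PowerSeries.X_ne_zero)
  have : Fintype (Set.range g) := Set.fintypeRange g
  refine (linearIndependent_le_span_aux' _ h2 (Set.range g) ?_).trans (Fintype.card_range_le g)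
  rintro _ ⟨i, rfl⟩
  exact hE (hp i)

lemma finrank_le_of_le_limitSpace {E : Submodule (PowerSeries ℂ) (PowerSeries A)} {T : Type*}
    [Fintype T] {g : T → PowerSeries A} (hE : E ≤ Submodule.span _ (Set.range g))
    {D : Submodule ℂ A} [FiniteDimensional ℂ D] (hD : D ≤ limitSpace E) :
    Module.finrank ℂ D ≤ Fintype.card T := by
  have h := card_le_of_limitSpace hE
    ((Module.finBasis ℂ D).linearIndependent.map' _ (Submodule.ker_subtype _))
    fun i => hD (Module.finBasis ℂ D i).2
  rwa [Fintype.card_fin] at h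

lemma exists_eq_X_pow_smul {f : PowerSeries A} (hf : f ≠ 0) : ∃ (p : PowerSeries A) (m : ℕ),
    f = (PowerSeries.X : PowerSeries ℂ) ^ m • p ∧ PowerSeries.constantCoeff p ≠ 0 ∧
      PowerSeries.coeff m f = PowerSeries.constantCoeff p := by
  classical
  have hex : ∃ n, PowerSeries.coeff n f ≠ 0 := by
    by_contra! hc
    exact hf (PowerSeries.ext fun n => by rw [hc n, map_zero])
  obtain ⟨p, hp⟩ := PowerSeries.X_pow_dvd_iff.2 fun m (hm : m < Nat.find hex) =>
    not_not.1 (Nat.find_min hex hm)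
  have h : PowerSeries.coeff (Nat.find hex) f = PowerSeries.constantCoeff p := by
    generalize Nat.find hex = m at hp
    subst hp
    simpa using PowerSeries.coeff_X_pow_mul p m 0
  exact ⟨p, Nat.find hex, by rw [X_pow_series_smul]; exact hp,
    h ▸ Nat.find_spec hex, h⟩

/-- A linear form applied to all coefficients of a power series. -/
def coeffwise (l : A →ₗ[ℂ] ℂ) : PowerSeries A →ₗ[PowerSeries ℂ] PowerSeries ℂ where
  toFun p := PowerSeries.mk fun n => l (PowerSeries.coeff n p)
  map_add' p q := by ext n; simp
  map_smul' k p := by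
    ext n
    simp only [PowerSeries.coeff_mk, coeff_series_smul, map_sum, map_smul, RingHom.id_apply,
      smul_eq_mul, PowerSeries.coeff_mul]

lemma coeff_coeffwise (l : A →ₗ[ℂ] ℂ) (p : PowerSeries A) (n : ℕ) :
    PowerSeries.coeff n (coeffwise l p) = l (PowerSeries.coeff n p) :=
  PowerSeries.coeff_mk n fun n => l (PowerSeries.coeff n p)

/-- The dimension does not drop in the limit. Coordinates on the limit space, extended to `A` and
applied coefficientwise, are injective on the span of `g`: the leading coefficient of a nonzero
element is a nonzero limit vector. -/
lemma card_le_finrank_limitSpace {E : Submodule (PowerSeries ℂ) (PowerSeries A)} {T : Type*}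
    [Fintype T] {g : T → PowerSeries A} (hg : LinearIndependent (PowerSeries ℂ) g)
    (hE : ∀ t, g t ∈ E) [FiniteDimensional ℂ (limitSpace E)] :
    Fintype.card T ≤ Module.finrank ℂ (limitSpace E) := by
  classical
  let b := Module.finBasis ℂ (limitSpace E)
  obtain ⟨l, hl⟩ := LinearMap.exists_extend b.equivFun.toLinearMap
  let L : PowerSeries A →ₗ[PowerSeries ℂ] (Fin (Module.finrank ℂ (limitSpace E)) → PowerSeries ℂ) :=
    LinearMap.pi fun i => coeffwise (LinearMap.proj i ∘ₗ l)
  have hinj : Function.Injective (L ∘ₗ Fintype.linearCombination (PowerSeries ℂ) g) := by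
    rw [← LinearMap.ker_eq_bot, LinearMap.ker_eq_bot']
    intro k hk
    rw [LinearMap.comp_apply, Fintype.linearCombination_apply] at hk
    refine funext fun t => Fintype.linearIndependent_iff.1 hg k ?_ t
    by_contra hf
    obtain ⟨p, m, hp, hp0, hm⟩ := exists_eq_X_pow_smul hf
    have hmem : PowerSeries.constantCoeff p ∈ limitSpace E :=
      ⟨p, m, by rw [← hp]; exact sum_mem fun t _ => E.smul_mem _ (hE t), rfl⟩
    have h1 : l (PowerSeries.constantCoeff p) = 0 := by
      funext i
      have : PowerSeries.coeff m (L (∑ i, k i • g i) i) = PowerSeries.coeff m 0 := by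
        rw [hk, Pi.zero_apply]
      have h0 : L (∑ i, k i • g i) i = coeffwise (LinearMap.proj i ∘ₗ l) (∑ i, k i • g i) := rfl
      rw [h0, coeff_coeffwise, hm] at this
      simpa using this
    have h2 := LinearMap.congr_fun hl ⟨_, hmem⟩
    rw [LinearMap.comp_apply, Submodule.subtype_apply, h1] at h2
    have h3 := b.equivFun.map_eq_zero_iff.1 h2.symm
    exact hp0 (congrArg Subtype.val h3)
  have := card_le_of_injective (PowerSeries ℂ) _ hinj
  simpa using this

end Limits

/-! ### Values of the generic series, and the dimension of the space of degree `d` -/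

section ExpSeries

variable {N : ℕ}

/-- The series `∑_j (c ε)^j / j! X_i^{(j)}`, the value at `c ε` of the generic power series. -/
def expSeries (i : Fin (N + 1)) (c : ℂ) : PowerSeries (V N) :=
  PowerSeries.mk fun j => (c ^ j / (j.factorial : ℂ)) • X (i, j)

/-- The action is the Leibniz rule for the product of `α` with the generic series `X_i`, so at the
point `c ε` it multiplies the value by `α(c ε)`. -/
lemma map_act_expSeries (α : (PowerSeries ℂ)ˣ) (i : Fin (N + 1)) (c : ℂ) :
    PowerSeries.map (act (N := N) α : V N →+* V N) (expSeries i c) =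
      PowerSeries.rescale c (α : PowerSeries ℂ) • expSeries i c := by
  ext1 n
  rw [coeff_series_smul, PowerSeries.coeff_map, expSeries, PowerSeries.coeff_mk,
    Finset.Nat.sum_antidiagonal_eq_sum_range_succ_mk, RingHom.coe_coe, map_smul, act_X,
    Finset.smul_sum]
  refine Finset.sum_congr rfl fun l hl => ?_
  have hl' : l ≤ n := by simpa [Nat.lt_succ_iff] using hl
  rw [PowerSeries.coeff_rescale, PowerSeries.coeff_mk, smul_smul, smul_smul]
  congr 1
  rw [← Nat.factorial_mul_descFactorial hl']
  have h1 : ((n - l).factorial : ℂ) ≠ 0 := by exact_mod_cast (n - l).factorial_ne_zero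
  have h2 : (n.descFactorial l : ℂ) ≠ 0 := by
    rw [Ne, Nat.cast_eq_zero, Nat.descFactorial_eq_zero_iff_lt]
    omega
  have h3 : c ^ n = c ^ l * c ^ (n - l) := by rw [← pow_add]; congr 1; omega
  push_cast
  rw [h3]
  field_simp

variable {ι : Type*} [Fintype ι]

/-- Products of the series `expSeries`. -/
def prodSeries (c : ι → ℂ) (w : ι → Fin (N + 1)) : PowerSeries (V N) :=
  ∏ l, expSeries (w l) (c l)

/-- The space of multilinear expressions in the values of the generic power series. -/
def valueSpan (N : ℕ) (c : ι → ℂ) : Submodule (PowerSeries ℂ) (PowerSeries (V N)) :=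
  Submodule.span _ (Set.range (prodSeries c))

lemma map_series_smul {A B : Type*} [CommRing A] [Algebra ℂ A] [CommRing B] [Algebra ℂ B]
    (f : A →ₐ[ℂ] B) (k : PowerSeries ℂ) (p : PowerSeries A) :
    PowerSeries.map (f : A →+* B) (k • p) = k • PowerSeries.map (f : A →+* B) p := by
  ext1 n
  simp only [PowerSeries.coeff_map, coeff_series_smul, map_sum, RingHom.coe_coe, map_smul]

lemma map_series_smul_eq_mul {A : Type*} [CommRing A] [Algebra ℂ A] (f : A →ₐ[ℂ] ℂ)
    (k : PowerSeries ℂ) (p : PowerSeries A) :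
    PowerSeries.map (f : A →+* ℂ) (k • p) = k * PowerSeries.map (f : A →+* ℂ) p := by
  ext1 n
  simp only [PowerSeries.coeff_map, coeff_series_smul, map_sum, RingHom.coe_coe, map_smul,
    PowerSeries.coeff_mul, smul_eq_mul]

lemma map_act_of_mem_valueSpan {c : ι → ℂ} {q : PowerSeries (V N)} (hq : q ∈ valueSpan N c)
    (α : (PowerSeries ℂ)ˣ) : PowerSeries.map (act (N := N) α : V N →+* V N) q =
      (∏ l, PowerSeries.rescale (c l) (α : PowerSeries ℂ)) • q := by
  induction hq using Submodule.span_induction with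
  | mem q hq =>
    obtain ⟨w, rfl⟩ := hq
    rw [prodSeries, map_prod]
    simp only [map_act_expSeries]
    rw [Finset.prod_smul]
  | zero => simp
  | add p q _ _ hp hq => rw [map_add, hp, hq, smul_add]
  | smul k q _ hq => rw [map_series_smul, hq, smul_comm]

/-- A product of values at the points `c_l ε` is multiplied by `∏ α(c_l ε)`, which tends to
`α(0)^d`. The points may coincide here. -/
lemma limitSpace_valueSpan_le (c : ι → ℂ) :
    limitSpace (valueSpan N c) ≤ diffHom N (Fintype.card ι) := by
  rintro _ ⟨p, m, hp, rfl⟩ α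
  have h1 := map_act_of_mem_valueSpan hp α
  rw [map_series_smul, smul_comm, X_pow_series_smul, X_pow_series_smul] at h1
  have h2 := congrArg PowerSeries.constantCoeff
    (mul_left_cancel₀ (pow_ne_zero m PowerSeries.X_ne_zero) h1)
  have h3 : ∀ l, PowerSeries.constantCoeff (PowerSeries.rescale (c l) (α : PowerSeries ℂ)) =
      PowerSeries.constantCoeff (α : PowerSeries ℂ) := fun l => by
    rw [← PowerSeries.coeff_zero_eq_constantCoeff_apply, PowerSeries.coeff_rescale, pow_zero,
      one_mul, PowerSeries.coeff_zero_eq_constantCoeff_apply]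
  rw [constantCoeff_series_smul, map_prod, Finset.prod_congr rfl fun l _ => h3 l,
    Finset.prod_const, Finset.card_univ, ← PowerSeries.coeff_zero_eq_constantCoeff_apply,
    PowerSeries.coeff_map, PowerSeries.coeff_zero_eq_constantCoeff_apply] at h2
  exact h2

/-- Distinct points can be interpolated: suitable series `X_i` isolate the product belonging to one
word `w₀`. Since the interpolating values involve `ε`, the relation is first turned into a
polynomial identity over `ℂ⟦ε⟧`. -/
lemma linearIndependent_prodSeries {c : ι → ℂ} (hc : Function.Injective c) :
    LinearIndependent (PowerSeries ℂ) (prodSeries (N := N) c) := by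
  classical
  rw [Fintype.linearIndependent_iff]
  intro k hk w₀
  let d := Fintype.card ι
  -- The relation with the generic series truncated after degree `d`. It holds at all constant
  -- values of the variables, an infinite set in each coordinate, so the polynomial is zero and
  -- other values may be substituted.
  let R : MvPolynomial (Fin (N + 1) × ℕ) (PowerSeries ℂ) := ∑ w, C (k w) * ∏ l,
    ∑ j ∈ Finset.range (d + 1),
      C (PowerSeries.monomial j (c l ^ j / (j.factorial : ℂ))) * X (w l, j)
  have hR : R = 0 := by
    refine MvPolynomial.funext_set (fun _ => Set.range PowerSeries.C)
      (fun _ => Set.infinite_range_of_injective PowerSeries.C_injective) fun x hx => ?_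
    choose y hy using fun v => hx v (Set.mem_univ v)
    let e : V N →ₐ[ℂ] ℂ := aeval fun v => if v.2 < d + 1 then y v else 0
    have he : ∀ i c, PowerSeries.map (e : V N →+* ℂ) (expSeries i c) =
        ∑ j ∈ Finset.range (d + 1),
          PowerSeries.monomial j (c ^ j / (j.factorial : ℂ)) * x (i, j) := by
      intro i c
      ext n
      rw [PowerSeries.coeff_map, expSeries, PowerSeries.coeff_mk, map_sum, RingHom.coe_coe,
        map_smul, aeval_X]
      simp only [← hy, PowerSeries.coeff_mul_C, PowerSeries.coeff_monomial, ite_mul, zero_mul,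
        Finset.sum_ite_eq, Finset.mem_range, smul_eq_mul, mul_ite, mul_zero]
    have h1 := congrArg (PowerSeries.map (e : V N →+* ℂ)) hk
    rw [map_sum, map_zero] at h1
    rw [map_zero, ← h1]
    simp only [R, map_sum, map_mul, map_prod, eval_C, eval_X, map_series_smul_eq_mul,
      prodSeries, he]
  let f : Fin (N + 1) → Polynomial ℂ := fun i =>
    Lagrange.interpolate Finset.univ c fun l => if w₀ l = i then 1 else 0
  have hf : ∀ i l, (f i).eval (c l) = if w₀ l = i then 1 else 0 := fun i l =>
    Lagrange.eval_interpolate_at_node _ hc.injOn (Finset.mem_univ l)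
  have hdeg : ∀ i, (f i).natDegree < d + 1 := fun i => by
    have := Lagrange.degree_interpolate_lt (s := Finset.univ)
      (fun l => if w₀ l = i then (1 : ℂ) else 0) (v := c) hc.injOn
    exact Nat.lt_succ_of_le (Polynomial.natDegree_le_of_degree_le this.le)
  -- The weights `ε^(d - j)` clear the powers of `ε`: the truncated series at `c_l ε` becomes `ε^d`
  -- times the value of the interpolating polynomial at `c_l`, which is 1 or 0.
  let x : Fin (N + 1) × ℕ → PowerSeries ℂ := fun v =>
    PowerSeries.monomial (d - v.2) ((v.2.factorial : ℂ) * (f v.1).coeff v.2)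
  have hx : ∀ i l, ∑ j ∈ Finset.range (d + 1),
      PowerSeries.monomial j (c l ^ j / (j.factorial : ℂ)) * x (i, j) =
        if w₀ l = i then PowerSeries.X ^ d else 0 := by
    intro i l
    have h1 : ∀ j ∈ Finset.range (d + 1),
        PowerSeries.monomial j (c l ^ j / (j.factorial : ℂ)) * x (i, j) =
          PowerSeries.monomial d ((f i).coeff j * c l ^ j) := by
      intro j hj
      have hj' : j ≤ d := by simpa [Nat.lt_succ_iff] using hj
      rw [PowerSeries.monomial_mul_monomial, Nat.add_sub_cancel' hj']
      congr 1
      have : (j.factorial : ℂ) ≠ 0 := by exact_mod_cast j.factorial_ne_zero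
      field_simp
    rw [Finset.sum_congr rfl h1, ← map_sum, ← Polynomial.eval_eq_sum_range' (hdeg i), hf]
    split_ifs
    · rw [PowerSeries.X_pow_eq]
    · rw [map_zero]
  have h2 := congrArg (eval x) hR
  simp only [R, map_sum, map_mul, map_prod, eval_C, eval_X, hx, map_zero] at h2
  rw [Finset.sum_eq_single w₀] at h2
  · simp only [if_true, Finset.prod_const] at h2
    exact (mul_eq_zero.1 h2).resolve_right (pow_ne_zero _ (pow_ne_zero _ PowerSeries.X_ne_zero))
  · intro w _ hw
    obtain ⟨l, hl⟩ := Function.ne_iff.1 hw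
    rw [Finset.prod_eq_zero (Finset.mem_univ l) (if_neg (Ne.symm hl)), mul_zero]
  · simp

instance finiteDimensional_diffHom (N d : ℕ) : FiniteDimensional ℂ (diffHom N d) :=
  have := FiniteDimensional.span_of_finite ℂ (Set.finite_range
    fun w : Fin d → Fin (N + 1) => W (fun i j => (X (i, j) : V N)) (ofWord (List.ofFn w)))
  Submodule.finiteDimensional_of_le (diffHom_le_span_ofWord N d)

lemma finrank_diffHom_le (N d : ℕ) : Module.finrank ℂ (diffHom N d) ≤ (N + 1) ^ d := by
  classical
  have := FiniteDimensional.span_of_finite ℂ (Set.finite_range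
    fun w : Fin d → Fin (N + 1) => W (fun i j => (X (i, j) : V N)) (ofWord (List.ofFn w)))
  refine (Submodule.finrank_mono (diffHom_le_span_ofWord N d)).trans ?_
  refine (finrank_range_le_card _).trans ?_
  simp

lemma card_le_finrank_limitSpace_valueSpan {c : ι → ℂ} (hc : Function.Injective c) :
    (N + 1) ^ Fintype.card ι ≤ Module.finrank ℂ (limitSpace (valueSpan N c)) := by
  classical
  have := Submodule.finiteDimensional_of_le (limitSpace_valueSpan_le (N := N) c)
  have h := card_le_finrank_limitSpace (linearIndependent_prodSeries (N := N) hc)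
    (E := valueSpan N c) fun w => Submodule.subset_span ⟨w, rfl⟩
  simpa using h

/-- The limit lies in a space of dimension at most `(N + 1)^d` and itself has at least that
dimension, so the inclusion is an equality. -/
lemma diffHom_le_limitSpace {c : ι → ℂ} (hc : Function.Injective c) :
    diffHom N (Fintype.card ι) ≤ limitSpace (valueSpan N c) :=
  (Submodule.eq_of_le_of_finrank_le (limitSpace_valueSpan_le c)
    ((finrank_diffHom_le N _).trans (card_le_finrank_limitSpace_valueSpan hc))).ge

theorem finrank_diffHom (N d : ℕ) : Module.finrank ℂ (diffHom N d) = (N + 1) ^ d := by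
  refine le_antisymm (finrank_diffHom_le N d) ?_
  have hc : Function.Injective fun i : Fin d => ((i : ℕ) : ℂ) :=
    Nat.cast_injective.comp Fin.val_injective
  have h1 := card_le_finrank_limitSpace_valueSpan (N := N) hc
  have h2 := Submodule.finrank_mono (limitSpace_valueSpan_le (N := N) fun i : Fin d => ((i : ℕ) : ℂ))
  rw [Fintype.card_fin] at h1 h2
  exact h1.trans h2

/-- Each factor is a limit over its own subset of points, on which `c` is injective. The product is
then a limit over all points, even if `c` is not injective as a whole. -/
lemma mul_mem_limitSpace_valueSpan {c : ι → ℂ} (s : Finset ι)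
    (hs : Set.InjOn c s) (hs' : Set.InjOn c (s : Set ι)ᶜ) {p q : V N}
    (hp : p ∈ diffHom N s.card) (hq : q ∈ diffHom N (Fintype.card ι - s.card)) :
    p * q ∈ limitSpace (valueSpan N c) := by
  classical
  have h1 : p ∈ limitSpace (valueSpan N fun l : {l // l ∈ s} => c l) := by
    refine diffHom_le_limitSpace (c := fun l : {l // l ∈ s} => c l)
      (fun l l' h => Subtype.ext (hs l.2 l'.2 h)) ?_
    rwa [Fintype.card_coe]
  have h2 : q ∈ limitSpace (valueSpan N fun l : {l // ¬ l ∈ s} => c l) := by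
    refine diffHom_le_limitSpace (c := fun l : {l // ¬ l ∈ s} => c l)
      (fun l l' h => Subtype.ext (hs' l.2 l'.2 h)) ?_
    rwa [Fintype.card_subtype_compl, Fintype.card_coe]
  refine limitSpace_mono ?_ (mul_mem_limitSpace h1 h2)
  rw [valueSpan, valueSpan, Submodule.span_mul_span, Submodule.span_le]
  rintro _ ⟨_, ⟨w, rfl⟩, _, ⟨w', rfl⟩, rfl⟩
  refine Submodule.subset_span ⟨fun l => if h : l ∈ s then w ⟨l, h⟩ else w' ⟨l, h⟩, ?_⟩
  simp only [prodSeries]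
  rw [← Fintype.prod_subtype_mul_prod_subtype (fun l => l ∈ s)]
  congr 1
  · exact Finset.prod_congr (Finset.ext fun _ => by simp) fun l _ => by rw [dif_pos l.2]
  · exact Finset.prod_congr (Finset.ext fun _ => by simp) fun l _ => by rw [dif_neg l.2]

end ExpSeries

/-! ### Codimension of the decomposable elements -/

section Decomposable

variable {N : ℕ}

/-- The decomposable elements of degree `d`. -/
def decomposable (N d : ℕ) : Submodule ℂ (V N) :=
  Submodule.span ℂ {P | ∃ a b, a + b = d ∧ 1 ≤ a ∧ 1 ≤ b ∧
    ∃ p ∈ diffHom N a, ∃ q ∈ diffHom N b, P = p * q}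

lemma decomposable_le (N d : ℕ) : decomposable N d ≤ diffHom N d := by
  refine Submodule.span_le.2 ?_
  rintro _ ⟨a, b, rfl, -, -, p, hp, q, hq, rfl⟩
  exact SetLike.GradedMul.mul_mem hp hq

lemma decomposable_of_le_one {d : ℕ} (hd : d ≤ 1) : decomposable N d = ⊥ := by
  rw [decomposable, Submodule.span_eq_bot]
  rintro _ ⟨a, b, h, ha, hb, -⟩
  omega

/-- The generators of `valueSpan N c` when the first two entries of `c` agree. -/
def symProdSeries {e : ℕ} (c : Fin (e + 2) → ℂ)
    (t : Sym2 (Fin (N + 1)) × (Fin e → Fin (N + 1))) : PowerSeries (V N) :=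
  Sym2.lift ⟨fun i j => expSeries i (c 0) * expSeries j (c 0), fun _ _ => mul_comm _ _⟩ t.1 *
    ∏ l : Fin e, expSeries (t.2 l) (c l.succ.succ)

lemma valueSpan_le_span_symProdSeries {e : ℕ} {c : Fin (e + 2) → ℂ} (hc : c 1 = c 0) :
    valueSpan N c ≤ Submodule.span _ (Set.range (symProdSeries c)) := by
  refine Submodule.span_mono ?_
  rintro _ ⟨w, rfl⟩
  refine ⟨(s(w 0, w 1), fun l => w l.succ.succ), ?_⟩
  rw [prodSeries, Fin.prod_univ_succ, Fin.prod_univ_succ, ← mul_assoc, Fin.succ_zero_eq_one, hc,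
    symProdSeries, Sym2.lift_mk]

lemma decomposable_le_limitSpace {e : ℕ} {c : Fin (e + 2) → ℂ}
    (hc : ∀ i j, c i = c j → i = j ∨ (i = 0 ∧ j = 1) ∨ (i = 1 ∧ j = 0)) :
    decomposable N (e + 2) ≤ limitSpace (valueSpan N c) := by
  classical
  refine Submodule.span_le.2 ?_
  rintro _ ⟨a, b, hab, ha, hb, p, hp, q, hq, rfl⟩
  -- The `a` points of the first factor are chosen to contain 0 but not 1, which separates the two
  -- colliding points.
  obtain ⟨s, hs0, hs1, hs⟩ := Finset.exists_subsuperset_card_eq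
    (s := {(0 : Fin (e + 2))}) (t := Finset.univ.erase 1) (n := a) (by simp) (by simpa using ha)
    (by rw [Finset.card_erase_of_mem (Finset.mem_univ _), Finset.card_univ, Fintype.card_fin]
        omega)
  have h0 : (0 : Fin (e + 2)) ∈ s := hs0 (Finset.mem_singleton_self _)
  have h1 : (1 : Fin (e + 2)) ∉ s := fun h => Finset.ne_of_mem_erase (hs1 h) rfl
  refine mul_mem_limitSpace_valueSpan s (fun i hi j hj h => ?_) (fun i hi j hj h => ?_)
    (by rwa [hs]) (by rw [hs, Fintype.card_fin, ← hab, Nat.add_sub_cancel_left]; exact hq)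
  · rcases hc i j h with h | ⟨-, rfl⟩ | ⟨rfl, -⟩
    · exact h
    · exact absurd hj h1
    · exact absurd hi h1
  · rcases hc i j h with h | ⟨rfl, -⟩ | ⟨-, rfl⟩
    · exact h
    · exact absurd h0 hi
    · exact absurd h0 hj

lemma finrank_decomposable_le (N e : ℕ) :
    Module.finrank ℂ (decomposable N (e + 2)) ≤ (N + 2).choose 2 * (N + 1) ^ e := by
  classical
  -- The truncated subtraction is deliberate: it sends both 0 and 1 to the point 0 and is injective
  -- otherwise.
  obtain ⟨c, hc⟩ : ∃ c : Fin (e + 2) → ℂ, ∀ i, c i = ((i : ℕ) - 1 : ℕ) := ⟨_, fun _ => rfl⟩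
  have hc1 : c 1 = c 0 := by rw [hc, hc]; simp
  have hc2 : ∀ i j : Fin (e + 2), c i = c j → i = j ∨ (i = 0 ∧ j = 1) ∨ (i = 1 ∧ j = 0) := by
    intro i j h
    rw [hc, hc] at h
    have h' : (i : ℕ) - 1 = (j : ℕ) - 1 := Nat.cast_injective h
    simp only [Fin.ext_iff, Fin.val_zero, Fin.val_one]
    omega
  have := Submodule.finiteDimensional_of_le (decomposable_le N (e + 2))
  have h := finrank_le_of_le_limitSpace (valueSpan_le_span_symProdSeries (N := N) hc1)
    (decomposable_le_limitSpace hc2)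
  rwa [Fintype.card_prod, Sym2.card, Fintype.card_fun, Fintype.card_fin, Fintype.card_fin] at h

/-- A set which spans the differentially homogeneous polynomials of degree `d` modulo the
decomposable ones has at least `numGen N d` elements. -/
theorem numGen_le_card {d : ℕ} (hd : 1 ≤ d) (T : Finset (V N))
    (h : diffHom N d ≤ Submodule.span ℂ (T : Set (V N)) ⊔ decomposable N d) :
    numGen N d ≤ T.card := by
  have := Submodule.finiteDimensional_of_le (decomposable_le N d)
  have := FiniteDimensional.span_of_finite ℂ T.finite_toSet
  have h1 := Submodule.finrank_mono h
  have h2 := Submodule.finrank_add_le_finrank_add_finrank (Submodule.span ℂ (T : Set (V N)))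
    (decomposable N d)
  have h3 := finrank_span_finset_le_card (R := ℂ) T
  rw [finrank_diffHom] at h1
  rw [Set.finrank] at h3
  rcases Nat.lt_or_ge 1 d with hd1 | hd1
  · obtain ⟨e, rfl⟩ : ∃ e, d = e + 2 := ⟨d - 2, by omega⟩
    have h4 := finrank_decomposable_le N e
    rw [numGen, if_neg (by omega), Nat.add_sub_cancel]
    -- Ordered pairs of letters split into unordered pairs with repetition, carried by the
    -- decomposables, and strictly ordered pairs, left for the generators.
    have h5 : (N + 2).choose 2 + N * (N + 1) / 2 = (N + 1) ^ 2 := by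
      rw [Nat.choose_two_right]
      have h6 : (N + 2) * (N + 2 - 1) = N * (N + 1) + 2 * (N + 1) := by
        rw [show N + 2 - 1 = N + 1 by omega]; ring
      have h7 := Nat.even_mul_succ_self N
      obtain ⟨m, hm⟩ := h7
      have h8 : (N + 1) ^ 2 = N * (N + 1) + (N + 1) := by ring
      rw [h6, h8, hm]
      omega
    have h6 : (N + 1) ^ (e + 2) = (N + 2).choose 2 * (N + 1) ^ e +
        N * (N + 1) / 2 * (N + 1) ^ e := by
      rw [← add_mul, h5]; ring
    omega
  · obtain rfl : d = 1 := le_antisymm hd1 hd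
    rw [decomposable_of_le_one le_rfl, finrank_bot] at h2
    rw [decomposable_of_le_one le_rfl] at h1
    rw [numGen, if_pos rfl]
    simp only [pow_one] at h1
    omega

end Decomposable

/-! ### Minimality, cardinality and exact order of the generators -/

section Minimality

variable {N : ℕ}

lemma mem_diffHom_of_mem_G {d : ℕ} {P : V N} (hP : P ∈ G N d) : P ∈ diffHom N d := by
  obtain ⟨α, hα, rfl⟩ := hP
  exact W_mem_diffHom hα.length_eq

lemma X_mem_diffHom_one (i : Fin (N + 1)) : (X (i, 0) : V N) ∈ diffHom N 1 := by
  have h := colDet_mem_diffHom (N := N) (fun _ : Fin 1 => i) fun _ => 0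
  simpa [colDet] using h

/-- The generators of degree `d` span the differentially homogeneous polynomials of degree `d`
modulo the decomposable ones. -/
lemma diffHom_le_span_G_sup {d : ℕ} (hd : 1 ≤ d) :
    diffHom N d ≤ Submodule.span ℂ (G N d) ⊔ decomposable N d := by
  obtain ⟨e, rfl⟩ : ∃ e, d = e + 1 := ⟨d - 1, by omega⟩
  intro P hP
  refine Submodule.span_le.2 ?_ (mem_span_W hP)
  rintro _ ⟨α, hα, rfl⟩
  have hlen : (columns α).length = e + 1 := by rw [length_columns, hα.length_eq]
  rw [W_eq_colDet]
  have key : ∀ (m : ℕ) (w : Fin m → Fin (N + 1)) (a : Fin m → ℕ), m = e + 1 →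
      colDet (fun i j => (X (i, j) : V N)) w a ∈
        Submodule.span ℂ (G N (e + 1)) ⊔ decomposable N (e + 1) := by
    rintro _ w a rfl
    refine colDet_mem_of_isIndex (fun α hα => ?_) (fun i w a => ?_) w a
    · exact Submodule.mem_sup_left (Submodule.subset_span ⟨α, hα, rfl⟩)
    · rcases Nat.eq_zero_or_pos e with rfl | he
      · rw [show colDet (fun i j => (X (i, j) : V N)) w a = 1 by simp [colDet], mul_one]
        obtain ⟨α, hα, h⟩ := exists_isIndex_one (x := fun i j => (X (i, j) : V N)) i
        exact h (Submodule.mem_sup_left (Submodule.subset_span ⟨α, hα, rfl⟩))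
      · exact Submodule.mem_sup_right (Submodule.subset_span ⟨1, e, add_comm _ _, le_rfl, he,
          _, X_mem_diffHom_one i, _, colDet_mem_diffHom w a, rfl⟩)
  exact key _ _ _ hlen

lemma finite_G {d : ℕ} (hd : 1 ≤ d) : (G N d).Finite :=
  Set.finite_of_encard_le_coe (encard_genFamily_le _ hd)

/-- The count of words bounds the family from above; spanning modulo decomposables bounds it from
below. -/
theorem encard_G {d : ℕ} (hd : 1 ≤ d) : (G N d).encard = (numGen N d : ℕ∞) := by
  refine le_antisymm (encard_genFamily_le _ hd) ?_
  rw [(finite_G hd).encard_eq_coe_toFinset_card, Nat.cast_le]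
  refine numGen_le_card hd _ ?_
  rw [Set.Finite.coe_toFinset]
  exact diffHom_le_span_G_sup hd

/-- No generator is a combination of the other ones modulo the decomposable elements. -/
lemma notMem_span_sup_decomposable {d : ℕ} (hd : 1 ≤ d) {g : V N} (hg : g ∈ G N d) :
    g ∉ Submodule.span ℂ (G N d \ {g}) ⊔ decomposable N d := by
  classical
  intro h
  have hle : diffHom N d ≤ Submodule.span ℂ (G N d \ {g}) ⊔ decomposable N d := by
    refine (diffHom_le_span_G_sup hd).trans (sup_le (Submodule.span_le.2 fun P hP => ?_)
      le_sup_right)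
    by_cases hPg : P = g
    · rw [hPg]; exact h
    · exact Submodule.mem_sup_left (Submodule.subset_span ⟨hP, hPg⟩)
  have hg' : g ∈ (finite_G (N := N) hd).toFinset := by simpa using hg
  have h1 := numGen_le_card hd ((finite_G (N := N) hd).toFinset.erase g) (by simpa using hle)
  have h2 := encard_G (N := N) hd
  rw [(finite_G hd).encard_eq_coe_toFinset_card, Nat.cast_inj] at h2
  have h3 := Finset.card_pos.2 ⟨g, hg'⟩
  rw [Finset.card_erase_of_mem hg'] at h1
  omega

lemma ne_zero_of_mem_G {d : ℕ} (hd : 1 ≤ d) {g : V N} (hg : g ∈ G N d) : g ≠ 0 := by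
  rintro rfl
  exact notMem_span_sup_decomposable hd hg (zero_mem _)

/-- A monomial in the elements of `S` is 1, a single element of `S`, or decomposable, and in each
case it is concentrated in one degree. -/
lemma homogeneousComponent_mem_of_mem_adjoin {k : ℕ} {S : Set (V N)}
    (hS : S ⊆ ⋃ i ∈ Finset.Icc 1 k, G N i) {P : V N} (hP : P ∈ Algebra.adjoin ℂ S) {d : ℕ}
    (hd : 1 ≤ d) :
    homogeneousComponent d P ∈ Submodule.span ℂ (S ∩ G N d) ⊔ decomposable N d := by
  have hle : ∀ e, Submodule.span ℂ (S ∩ G N e) ⊔ decomposable N e ≤ diffHom N e := fun e =>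
    sup_le (Submodule.span_le.2 fun P hP => mem_diffHom_of_mem_G hP.2) (decomposable_le N e)
  have key : ∀ P ∈ Submonoid.closure S, P = 1 ∨
      ∃ e, 1 ≤ e ∧ P ∈ Submodule.span ℂ (S ∩ G N e) ⊔ decomposable N e := by
    intro P hP
    induction hP using Submonoid.closure_induction with
    | mem P hP =>
      obtain ⟨i, hi, hPi⟩ := Set.mem_iUnion₂.1 (hS hP)
      exact Or.inr ⟨i, (Finset.mem_Icc.1 hi).1,
        Submodule.mem_sup_left (Submodule.subset_span ⟨hP, hPi⟩)⟩
    | one => exact Or.inl rfl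
    | mul P Q _ _ hP hQ =>
      rcases hP with rfl | ⟨a, ha, hP⟩
      · rwa [one_mul]
      · rcases hQ with rfl | ⟨b, hb, hQ⟩
        · rw [mul_one]; exact Or.inr ⟨a, ha, hP⟩
        · exact Or.inr ⟨a + b, by omega, Submodule.mem_sup_right (Submodule.subset_span
            ⟨a, b, rfl, ha, hb, P, hle a hP, Q, hle b hQ, rfl⟩)⟩
  rw [← Subalgebra.mem_toSubmodule, Algebra.adjoin_eq_span] at hP
  induction hP using Submodule.span_induction with
  | mem P hP =>
    rcases key P hP with rfl | ⟨e, he, hP⟩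
    · rw [homogeneousComponent_of_mem_diffHom (SetLike.GradedOne.one_mem (A := diffHom N)),
        if_neg (by omega)]
      exact zero_mem _
    · rw [homogeneousComponent_of_mem_diffHom (hle e hP)]
      split_ifs with h
      · rw [h]; exact hP
      · exact zero_mem _
  | zero => rw [map_zero]; exact zero_mem _
  | add P Q _ _ hP hQ => rw [map_add]; exact add_mem hP hQ
  | smul c P _ hP => rw [map_smul]; exact Submodule.smul_mem _ c hP

lemma mem_of_mem_adjoin {k d : ℕ} {S : Set (V N)} (hS : S ⊆ ⋃ i ∈ Finset.Icc 1 k, G N i)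
    (hd : 1 ≤ d) {g : V N} (hg : g ∈ G N d) (h : g ∈ Algebra.adjoin ℂ S) : g ∈ S := by
  by_contra hgS
  have h1 := homogeneousComponent_mem_of_mem_adjoin hS h hd
  rw [homogeneousComponent_of_mem_diffHom (mem_diffHom_of_mem_G hg), if_pos rfl] at h1
  have hsub : S ∩ G N d ⊆ G N d \ {g} := fun P hP => ⟨hP.2, fun h => hgS (h ▸ hP.1)⟩
  have hle : Submodule.span ℂ (S ∩ G N d) ⊔ decomposable N d ≤
      Submodule.span ℂ (G N d \ {g}) ⊔ decomposable N d :=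
    sup_le_sup_right (Submodule.span_mono hsub) _
  exact notMem_span_sup_decomposable hd hg (hle h1)

theorem minimal_G (N k : ℕ) :
    Minimal (fun S : Set (V N) => Algebra.adjoin ℂ S = diffAlgLE N k)
      (⋃ i ∈ Finset.Icc 1 (k + 1), G N i) := by
  refine ⟨adjoin_G N k, fun S hS hSle g hg => ?_⟩
  obtain ⟨d, hd, hgd⟩ := Set.mem_iUnion₂.1 hg
  refine mem_of_mem_adjoin hSle (Finset.mem_Icc.1 hd).1 hgd ?_
  have hS' : Algebra.adjoin ℂ S = diffAlgLE N k := hS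
  rw [hS', ← adjoin_G]
  exact Algebra.subset_adjoin hg

lemma finite_iUnion_G (N k : ℕ) : (⋃ i ∈ Finset.Icc 1 k, G N i).Finite :=
  (Finset.finite_toSet _).biUnion fun _ hi => finite_G (Finset.mem_Icc.1 hi).1

theorem fg_diffAlgLE (N k : ℕ) : (diffAlgLE N k).FG :=
  Subalgebra.fg_def.2 ⟨_, finite_iUnion_G N (k + 1), adjoin_G N k⟩

theorem totalDegree_of_mem_G {d : ℕ} (hd : 1 ≤ d) {g : V N} (hg : g ∈ G N d) :
    g.totalDegree = d :=
  (isHomogeneous_of_mem_diffHom (mem_diffHom_of_mem_G hg)).totalDegree (ne_zero_of_mem_G hd hg)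

lemma mem_orderLE_iff_order_le {k : ℕ} {P : V N} : P ∈ orderLE N k ↔ order P ≤ k := by
  rw [mem_orderLE, order, Finset.sup_le_iff]

theorem order_of_mem_G {d : ℕ} (hd : 1 ≤ d) {g : V N} (hg : g ∈ G N d) : order g = d - 1 := by
  have hle : order g ≤ d - 1 := by
    obtain ⟨α, hα, rfl⟩ := hg
    exact mem_orderLE_iff_order_le.1 (W_mem_orderLE hα.length_eq (by omega))
  refine le_antisymm hle (not_lt.1 fun hlt => ?_)
  have h1 : g ∈ orderLE N (d - 2) := mem_orderLE_iff_order_le.2 (by omega)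
  -- A generator of order at most `d - 2` would be generated in degrees at most `d - 1`. Being
  -- irredundant, it would then be one of those generators, against its degree.
  have h2 := mem_of_mem_adjoin subset_rfl hd hg
    (mem_adjoin_of_mem_diffHom (mem_diffHom_of_mem_G hg) h1)
  obtain ⟨i, hi, hgi⟩ := Set.mem_iUnion₂.1 h2
  rw [Finset.mem_Icc] at hi
  have h3 := totalDegree_of_mem_G hi.1 hgi
  rw [totalDegree_of_mem_G hd hg] at h3
  omega

end Minimality

/-! ### Nilpotent endomorphisms of maximal index and the algebra `ℂ[J]` -/

section Nilpotent

variable {F : Type*} [AddCommGroup F] [Module ℂ F] {k : ℕ} {J : Module.End ℂ F}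

lemma pow_eq_zero_of_isNilpotent (hF : Module.finrank ℂ F = k + 1) (hJ : IsNilpotent J) :
    J ^ (k + 1) = 0 := by
  have : FiniteDimensional ℂ F := FiniteDimensional.of_finrank_pos (by omega)
  obtain ⟨m, hm⟩ := hJ
  have h := Module.End.ker_pow_le_ker_pow_finrank J m
  rw [hm, hF] at h
  ext v
  have : v ∈ LinearMap.ker (J ^ (k + 1)) := h (by simp)
  simpa using this

lemma coeff_eq_zero_of_sum_pow_apply_eq_zero (hJ : J ^ (k + 1) = 0) {v : F} (hv : (J ^ k) v ≠ 0)
    {c : ℕ → ℂ} (h : ∑ l ∈ Finset.range (k + 1), c l • (J ^ l) v = 0) : ∀ l ≤ k, c l = 0 := by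
  intro l
  induction l using Nat.strong_induction_on with
  | _ l ih =>
    intro hl
    have h1 := congrArg (J ^ (k - l)) h
    rw [map_sum, map_zero, Finset.sum_eq_single l] at h1
    · rw [map_smul, ← Module.End.mul_apply, ← pow_add, Nat.sub_add_cancel hl] at h1
      exact (smul_eq_zero.1 h1).resolve_right hv
    · intro m hm hml
      rw [Finset.mem_range] at hm
      rcases Nat.lt_or_ge m l with h2 | h2
      · rw [ih m h2 (by omega), zero_smul, map_zero]
      · rw [map_smul, ← Module.End.mul_apply, ← pow_add,
          pow_eq_zero_of_le (by omega : k + 1 ≤ k - l + m) hJ, LinearMap.zero_apply, smul_zero]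
    · intro h2
      exact absurd (Finset.mem_range.2 (by omega)) h2

lemma exists_pow_apply_ne_zero (h : J ^ k ≠ 0) : ∃ v, (J ^ k) v ≠ 0 := by
  by_contra! hc
  exact h (LinearMap.ext hc)

lemma exists_isAdapted (hF : Module.finrank ℂ F = k + 1) (hJ : IsNilpotent J) (hJk : J ^ k ≠ 0) :
    ∃ f : Module.Basis (Fin (k + 1)) ℂ F, IsAdapted J f := by
  have hJ' := pow_eq_zero_of_isNilpotent hF hJ
  obtain ⟨v, hv⟩ := exists_pow_apply_ne_zero hJk
  -- A Jordan chain through a vector not killed by `J^k`, rescaled by factorials to produce the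
  -- coefficients `j`.
  let g : Fin (k + 1) → F := fun j => ((j : ℕ).factorial : ℂ) • (J ^ (k - j)) v
  have hg : LinearIndependent ℂ g := by
    rw [Fintype.linearIndependent_iff]
    intro c hc
    let c' : ℕ → ℂ := fun l => if h : l < k + 1 then c ⟨l, h⟩ * (l.factorial : ℂ) else 0
    have h1 := coeff_eq_zero_of_sum_pow_apply_eq_zero hJ' hv (c := fun l => c' (k - l)) (by
      rw [← Finset.sum_range_reflect, ← hc, ← Fin.sum_univ_eq_sum_range
        fun l => c' (k - (k + 1 - 1 - l)) • (J ^ (k + 1 - 1 - l)) v]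
      refine Finset.sum_congr rfl fun j _ => ?_
      have hj := j.2
      rw [show k - (k + 1 - 1 - (j : ℕ)) = j by omega, Nat.add_sub_cancel]
      simp only [c', g, dif_pos hj, Fin.eta, smul_smul])
    intro j
    have h2 := h1 (k - j) (by omega)
    have hj := j.2
    simp only [show k - (k - (j : ℕ)) = j by omega, c', dif_pos hj, Fin.eta] at h2
    exact (mul_eq_zero.1 h2).resolve_right (by exact_mod_cast (j : ℕ).factorial_ne_zero)
  refine ⟨basisOfLinearIndependentOfCardEqFinrank hg (by rw [Fintype.card_fin, hF]), fun j => ?_⟩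
  rw [coe_basisOfLinearIndependentOfCardEqFinrank]
  simp only [g]
  rw [map_smul, ← Module.End.mul_apply, ← pow_succ']
  by_cases hj : j = 0
  · subst hj
    simp [hJ']
  · have h0 : (j : ℕ) ≠ 0 := fun h => hj (Fin.ext h)
    rw [Fin.val_sub_one_of_ne_zero hj, smul_smul]
    have hlt := j.2
    congr 2
    · exact_mod_cast (Nat.mul_factorial_pred h0).symm
    · congr 1
      omega

lemma aeval_apply_eq_sum_range (hJ : J ^ (k + 1) = 0) (P : Polynomial ℂ) (v : F) :
    Polynomial.aeval J P v = ∑ l ∈ Finset.range (k + 1), P.coeff l • (J ^ l) v := by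
  rw [Polynomial.aeval_eq_sum_range' (n := max (P.natDegree + 1) (k + 1)) (by omega),
    LinearMap.sum_apply]
  symm
  refine Finset.sum_subset (Finset.range_mono (le_max_right _ _)) fun l _ hl => ?_
  rw [Finset.mem_range, not_lt] at hl
  rw [pow_eq_zero_of_le hl hJ, LinearMap.zero_apply, smul_zero]

lemma aeval_eq_zero_iff_dvd (hJ : J ^ (k + 1) = 0) (hJk : J ^ k ≠ 0) {P : Polynomial ℂ} :
    Polynomial.aeval J P = 0 ↔ Polynomial.X ^ (k + 1) ∣ P := by
  constructor
  · intro h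
    obtain ⟨v, hv⟩ := exists_pow_apply_ne_zero hJk
    have h1 := aeval_apply_eq_sum_range hJ P v
    rw [h, LinearMap.zero_apply] at h1
    refine Polynomial.X_pow_dvd_iff.2 fun l hl => ?_
    exact coeff_eq_zero_of_sum_pow_apply_eq_zero hJ hv h1.symm l (by omega)
  · rintro ⟨Q, rfl⟩
    rw [map_mul, map_pow, Polynomial.aeval_X, hJ, zero_mul]

lemma aeval_mem_adjoin (J : Module.End ℂ F) (P : Polynomial ℂ) :
    Polynomial.aeval J P ∈ Algebra.adjoin ℂ {J} :=
  Polynomial.aeval_mem_adjoin_singleton ℂ J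

/-- Evaluation at `J`, as a map `ℂ[T]/(T^{k+1}) → ℂ[J]`. -/
def evalQuotient (hJ : J ^ (k + 1) = 0) :
    (Polynomial ℂ ⧸ Ideal.span {(Polynomial.X : Polynomial ℂ) ^ (k + 1)}) →+*
      Algebra.adjoin ℂ {J} :=
  Ideal.Quotient.lift _
    ((Polynomial.aeval J).codRestrict (Algebra.adjoin ℂ {J}) (aeval_mem_adjoin J) :
      Polynomial ℂ →+* Algebra.adjoin ℂ {J}) fun P hP => by
      obtain ⟨Q, rfl⟩ := Ideal.mem_span_singleton.1 hP
      refine Subtype.ext ?_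
      change Polynomial.aeval J _ = 0
      rw [map_mul, map_pow, Polynomial.aeval_X, hJ, zero_mul]

lemma coe_evalQuotient_mk (hJ : J ^ (k + 1) = 0) (P : Polynomial ℂ) :
    (evalQuotient hJ (Ideal.Quotient.mk _ P) : Module.End ℂ F) = Polynomial.aeval J P := rfl

lemma evalQuotient_bijective (hJ : J ^ (k + 1) = 0) (hJk : J ^ k ≠ 0) :
    Function.Bijective (evalQuotient hJ) := by
  constructor
  · rw [injective_iff_map_eq_zero]
    intro x hx
    obtain ⟨P, rfl⟩ := Ideal.Quotient.mk_surjective x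
    have h := congrArg Subtype.val hx
    rw [coe_evalQuotient_mk] at h
    rw [Ideal.Quotient.eq_zero_iff_mem, Ideal.mem_span_singleton]
    exact (aeval_eq_zero_iff_dvd hJ hJk).1 h
  · rintro ⟨g, hg⟩
    have hg' := hg
    rw [Algebra.adjoin_singleton_eq_range_aeval] at hg'
    obtain ⟨P, rfl⟩ := hg'
    exact ⟨Ideal.Quotient.mk _ P, Subtype.ext rfl⟩

lemma exists_units_equiv (hJ : J ^ (k + 1) = 0) (hJk : J ^ k ≠ 0) :
    ∃ e : (Polynomial ℂ ⧸ Ideal.span {(Polynomial.X : Polynomial ℂ) ^ (k + 1)})ˣ ≃*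
        (Algebra.adjoin ℂ {J})ˣ,
      ∀ (u : (Polynomial ℂ ⧸ Ideal.span {(Polynomial.X : Polynomial ℂ) ^ (k + 1)})ˣ)
        (P : Polynomial ℂ),
        (u : Polynomial ℂ ⧸ Ideal.span {(Polynomial.X : Polynomial ℂ) ^ (k + 1)}) =
          Ideal.Quotient.mk _ P →
        ((e u : Algebra.adjoin ℂ {J}) : Module.End ℂ F) = Polynomial.aeval J P := by
  refine ⟨Units.mapEquiv
    (RingEquiv.ofBijective (evalQuotient hJ) (evalQuotient_bijective hJ hJk)).toMulEquiv,
    fun u P hu => ?_⟩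
  rw [← coe_evalQuotient_mk hJ, ← hu]
  rfl

/-- A polynomial with nonzero constant term is coprime to `X^(k+1)`, and the Bézout relation
evaluated at `J` gives an inverse inside `ℂ[J]`. -/
lemma exists_unit_of_eval_ne_zero (hJ : J ^ (k + 1) = 0) {P : Polynomial ℂ} (hP : P.eval 0 ≠ 0) :
    ∃ g : (Algebra.adjoin ℂ {J})ˣ,
      Polynomial.aeval J P = ((g : Algebra.adjoin ℂ {J}) : Module.End ℂ F) := by
  have h1 : IsCoprime P (Polynomial.X ^ (k + 1)) := by
    refine IsCoprime.pow_right ⟨Polynomial.C (P.eval 0)⁻¹, -Polynomial.C (P.eval 0)⁻¹ * P.divX, ?_⟩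
    have h2 := P.divX_mul_X_add
    rw [Polynomial.coeff_zero_eq_eval_zero] at h2
    have h3 : Polynomial.C (P.eval 0)⁻¹ * Polynomial.C (P.eval 0) = (1 : Polynomial ℂ) := by
      rw [← Polynomial.C_mul, inv_mul_cancel₀ hP, Polynomial.C_1]
    calc Polynomial.C (P.eval 0)⁻¹ * P + -Polynomial.C (P.eval 0)⁻¹ * P.divX * Polynomial.X
        = Polynomial.C (P.eval 0)⁻¹ * (P - P.divX * Polynomial.X) := by ring
      _ = Polynomial.C (P.eval 0)⁻¹ * Polynomial.C (P.eval 0) := by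
          rw [sub_eq_of_eq_add' h2.symm]
      _ = 1 := h3
  obtain ⟨A, B, hAB⟩ := h1
  have h4 : Polynomial.aeval J A * Polynomial.aeval J P = 1 := by
    have := congrArg (Polynomial.aeval J) hAB
    simpa [hJ] using this
  refine ⟨⟨⟨_, aeval_mem_adjoin J P⟩, ⟨_, aeval_mem_adjoin J A⟩, Subtype.ext ?_, Subtype.ext ?_⟩,
    rfl⟩
  · change Polynomial.aeval J P * Polynomial.aeval J A = 1
    rw [← map_mul, mul_comm, map_mul, h4]
  · exact h4

end Nilpotent

/-! ### Transfer to quasi-invariants in the symmetric algebra -/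

section Transfer

variable {N k : ℕ} {F : Type*} [AddCommGroup F] [Module ℂ F] {J : Module.End ℂ F}

/-- The substitution of the vectors `f_j` of the copies of `F` for the variables. -/
def toSym (N : ℕ) (f : Module.Basis (Fin (k + 1)) ℂ F) : V N →ₐ[ℂ] SymCopies N F :=
  aeval fun v => copyVar N f v.1 v.2

/-- The basis of `F^{N+1}` formed by the vectors of `f` in each copy of `F`. -/
def copiesBasis (N : ℕ) (f : Module.Basis (Fin (k + 1)) ℂ F) :
    Module.Basis (Fin (N + 1) × Fin (k + 1)) ℂ (Fin (N + 1) → F) :=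
  (Pi.basis fun _ : Fin (N + 1) => f).reindex (Equiv.sigmaEquivProd _ _)

lemma copiesBasis_apply (f : Module.Basis (Fin (k + 1)) ℂ F) (v : Fin (N + 1) × Fin (k + 1)) :
    copiesBasis N f v = Pi.single v.1 (f v.2) := by
  rw [copiesBasis, Module.Basis.reindex_apply, Pi.basis_apply]
  rfl

lemma toSym_rename (f : Module.Basis (Fin (k + 1)) ℂ F)
    (q : MvPolynomial (Fin (N + 1) × Fin (k + 1)) ℂ) :
    toSym N f (rename (Prod.map id Fin.val) q) =
      (SymmetricAlgebra.equivMvPolynomial (copiesBasis N f)).symm q := by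
  have h : (toSym N f).comp (rename (Prod.map id Fin.val)) =
      (SymmetricAlgebra.equivMvPolynomial (copiesBasis N f)).symm.toAlgHom := by
    refine MvPolynomial.algHom_ext fun v => ?_
    rw [AlgHom.comp_apply, rename_X, toSym, aeval_X, AlgEquiv.toAlgHom_apply,
      SymmetricAlgebra.equivMvPolynomial_symm_X, copiesBasis_apply, copyVar]
    exact dif_pos v.2.2
  exact DFunLike.congr_fun h q

/-- On polynomials of order at most `k` the substitution is the identification of a symmetric
algebra with the polynomial ring on a basis. It kills the variables of higher order, hence the
restriction. -/
lemma injOn_toSym (f : Module.Basis (Fin (k + 1)) ℂ F) :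
    Set.InjOn (toSym N f) (orderLE N k) := by
  intro P hP Q hQ h
  obtain ⟨p, rfl⟩ := mem_orderLE_iff_exists_rename.1 hP
  obtain ⟨q, rfl⟩ := mem_orderLE_iff_exists_rename.1 hQ
  rw [toSym_rename, toSym_rename] at h
  rw [(AlgEquiv.injective _) h]

lemma exists_toSym_eq (f : Module.Basis (Fin (k + 1)) ℂ F) (v : SymCopies N F) :
    ∃ P ∈ orderLE N k, toSym N f P = v := by
  refine ⟨_, mem_orderLE_iff_exists_rename.2
    ⟨SymmetricAlgebra.equivMvPolynomial (copiesBasis N f) v, rfl⟩, ?_⟩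
  rw [toSym_rename, AlgEquiv.symm_apply_apply]

lemma genFamily_copyVar (f : Module.Basis (Fin (k + 1)) ℂ F) (d : ℕ) :
    genFamily (copyVar N f) d = toSym N f '' G N d := by
  have h : ∀ α, toSym N f (W (fun i j => X (i, j)) α) = W (copyVar N f) α := by
    intro α
    rw [W_eq_colDet, W_eq_colDet]
    refine (map_colDet (toSym N f : V N →+* SymCopies N F) _ _ _).trans ?_
    simp [toSym]
  ext v
  constructor
  · rintro ⟨α, hα, rfl⟩
    exact ⟨_, ⟨α, hα, rfl⟩, h α⟩
  · rintro ⟨_, ⟨α, hα, rfl⟩, rfl⟩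
    exact ⟨α, hα, h α⟩

lemma act_mem_orderLE (α : (PowerSeries ℂ)ˣ) {P : V N} (hP : P ∈ orderLE N k) :
    act α P ∈ orderLE N k := by
  have h : orderLE N k ≤ (orderLE N k).comap (act α) := by
    refine Algebra.adjoin_le ?_
    rintro _ ⟨v, hv, rfl⟩
    change act α (X (v.1, v.2)) ∈ orderLE N k
    rw [act_X]
    refine sum_mem fun l _ => Subalgebra.smul_mem _ ?_ _
    refine Algebra.subset_adjoin ⟨(v.1, v.2 - l), ?_, rfl⟩
    have : v.2 ≤ k := hv
    exact (Nat.sub_le _ _).trans this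
  exact h hP

lemma pow_apply_basis {f : Module.Basis (Fin (k + 1)) ℂ F} (hf : IsAdapted J f)
    {j : ℕ} (hj : j < k + 1) (l : ℕ) :
    (J ^ l) (f ⟨j, hj⟩) = (j.descFactorial l : ℂ) • f ⟨j - l, by omega⟩ := by
  induction l with
  | zero => simp
  | succ l ih =>
    rw [pow_succ', Module.End.mul_apply, ih, map_smul, hf, smul_smul, Nat.descFactorial_succ]
    rcases Nat.eq_zero_or_pos (j - l) with h0 | h0
    · simp [h0]
    · congr 1
      · push_cast
        exact mul_comm _ _
      · congr 1
        refine Fin.ext ?_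
        rw [Fin.val_sub_one_of_ne_zero fun h => h0.ne' (congrArg Fin.val h)]
        exact (Nat.sub_add_eq j l 1).symm

/-- On an adapted basis `J^l f_j` is a falling factorial times `f_{j-l}`, so `P(J) f_j` is the
formula of `act_X` with the coefficients of `P` in place of those of `α`. Only coefficients up to
`k` matter. -/
lemma symAct_toSym {f : Module.Basis (Fin (k + 1)) ℂ F} (hf : IsAdapted J f)
    (hJ : J ^ (k + 1) = 0) {P : Polynomial ℂ} {α : (PowerSeries ℂ)ˣ}
    (hα : ∀ l ≤ k, PowerSeries.coeff l (α : PowerSeries ℂ) = P.coeff l) {Q : V N}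
    (hQ : Q ∈ orderLE N k) :
    symAct N (Polynomial.aeval J P) (toSym N f Q) = toSym N f (act α Q) := by
  obtain ⟨q, rfl⟩ := mem_orderLE_iff_exists_rename.1 hQ
  have h : ((symAct N (Polynomial.aeval J P)).comp (toSym N f)).comp
      (rename (Prod.map id Fin.val)) =
      ((toSym N f).comp (act α)).comp
        (rename (Prod.map id Fin.val : Fin (N + 1) × Fin (k + 1) → _)) := by
    refine MvPolynomial.algHom_ext fun v => ?_
    obtain ⟨i, j, hj⟩ := v
    simp only [AlgHom.comp_apply, rename_X, Prod.map_apply, id]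
    rw [act_X, map_sum]
    have hvar : ∀ m (hm : m < k + 1), toSym N f (X (i, m)) =
        SymmetricAlgebra.ι ℂ (Fin (N + 1) → F) (Pi.single i (f ⟨m, hm⟩)) := by
      intro m hm
      rw [toSym, aeval_X, copyVar]
      exact dif_pos hm
    have hcomp : ∀ (g : Module.End ℂ F) (u : F), LinearMap.compLeft g (Fin (N + 1))
        (Pi.single i u) = Pi.single i (g u) := by
      intro g u
      funext i'
      by_cases h : i' = i
      · subst h; simp
      · simp [Pi.single_eq_of_ne h]
    rw [hvar j hj, symAct, SymmetricAlgebra.lift_ι_apply, LinearMap.comp_apply, hcomp,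
      aeval_apply_eq_sum_range hJ, ← LinearMap.single_apply ℂ (fun _ => F), map_sum, map_sum]
    have hsub : Finset.range (j + 1) ⊆ Finset.range (k + 1) := Finset.range_mono (by omega)
    rw [← Finset.sum_subset hsub]
    · refine Finset.sum_congr rfl fun l hl => ?_
      have hl' : l ≤ k := by have := hsub hl; rw [Finset.mem_range] at this; omega
      rw [pow_apply_basis hf hj, map_smul (LinearMap.single ℂ (fun _ => F) i),
        map_smul (SymmetricAlgebra.ι ℂ (Fin (N + 1) → F)),
        map_smul (LinearMap.single ℂ (fun _ => F) i),
        map_smul (SymmetricAlgebra.ι ℂ (Fin (N + 1) → F)), map_smul (toSym N f),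
        hvar (j - l) (by omega), hα l hl', smul_smul, mul_comm, LinearMap.single_apply]
    · intro l _ hl
      rw [Finset.mem_range, not_lt] at hl
      rw [pow_apply_basis hf hj, Nat.descFactorial_eq_zero_iff_lt.2 (by omega), Nat.cast_zero,
        zero_smul, smul_zero, map_zero, map_zero]
  exact DFunLike.congr_fun h q

/-- With zero constant term, `P(J)` would kill `f_0` and could not be invertible. -/
lemma eval_zero_ne_zero_of_unit {f : Module.Basis (Fin (k + 1)) ℂ F} (hf : IsAdapted J f)
    (hJ : J ^ (k + 1) = 0) {g : (Algebra.adjoin ℂ {J})ˣ} {P : Polynomial ℂ}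
    (h : Polynomial.aeval J P = ((g : Algebra.adjoin ℂ {J}) : Module.End ℂ F)) :
    P.eval 0 ≠ 0 := by
  intro h0
  have h1 : Polynomial.aeval J P (f 0) = 0 := by
    rw [aeval_apply_eq_sum_range hJ]
    refine Finset.sum_eq_zero fun l _ => ?_
    rcases Nat.eq_zero_or_pos l with rfl | hl
    · rw [Polynomial.coeff_zero_eq_eval_zero, h0, zero_smul]
    · have := pow_apply_basis hf (Nat.succ_pos k) l
      rw [Nat.descFactorial_eq_zero_iff_lt.2 hl, Nat.cast_zero, zero_smul] at this
      exact (congrArg _ this).trans (smul_zero _)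
  have h2 : (((g⁻¹ : (Algebra.adjoin ℂ {J})ˣ) : Algebra.adjoin ℂ {J}) : Module.End ℂ F) *
      Polynomial.aeval J P = 1 := by
    rw [h]
    exact congrArg Subtype.val (Units.inv_mul g)
  have h3 := LinearMap.congr_fun h2 (f 0)
  rw [Module.End.mul_apply, h1, map_zero] at h3
  exact f.ne_zero 0 h3.symm

lemma toSym_mem_quasiInv_iff {f : Module.Basis (Fin (k + 1)) ℂ F} (hf : IsAdapted J f)
    (hJ : J ^ (k + 1) = 0) {d : ℕ} {Q : V N} (hQ : Q ∈ orderLE N k) :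
    toSym N f Q ∈ quasiInv N J d ↔ Q ∈ diffHom N d := by
  constructor
  · intro h α
    -- A power series acts on order at most `k` through its truncation; conversely a polynomial with
    -- nonzero value at 0 is a unit as a power series.
    let P : Polynomial ℂ := PowerSeries.trunc (k + 1) (α : PowerSeries ℂ)
    have hP : ∀ l ≤ k, PowerSeries.coeff l (α : PowerSeries ℂ) = P.coeff l := fun l hl => by
      rw [PowerSeries.coeff_trunc, if_pos (by omega)]
    have hP0 : P.eval 0 = PowerSeries.constantCoeff (α : PowerSeries ℂ) := by
      rw [← Polynomial.coeff_zero_eq_eval_zero, ← hP 0 (Nat.zero_le k),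
        PowerSeries.coeff_zero_eq_constantCoeff_apply]
    obtain ⟨g, hg⟩ := exists_unit_of_eval_ne_zero hJ (P := P) (by
      rw [hP0]
      exact (PowerSeries.isUnit_constantCoeff _ α.isUnit).ne_zero)
    have h1 := h g P hg
    rw [← hg, symAct_toSym hf hJ hP hQ, hP0, ← map_smul] at h1
    exact injOn_toSym f (act_mem_orderLE α hQ) (Subalgebra.smul_mem _ hQ _) h1
  · intro h g P hg
    have hP0 := eval_zero_ne_zero_of_unit hf hJ hg
    have hc : PowerSeries.constantCoeff (P : PowerSeries ℂ) = P.eval 0 := by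
      rw [← PowerSeries.coeff_zero_eq_constantCoeff_apply, Polynomial.coeff_coe,
        Polynomial.coeff_zero_eq_eval_zero]
    obtain ⟨α, hα⟩ : IsUnit (P : PowerSeries ℂ) := by
      rw [PowerSeries.isUnit_iff_constantCoeff, hc]
      exact hP0.isUnit
    rw [← hg, symAct_toSym hf hJ (α := α) (fun l _ => by rw [hα, Polynomial.coeff_coe]) hQ, h α,
      map_smul, hα, hc]

lemma quasiInvAlg_eq_map {f : Module.Basis (Fin (k + 1)) ℂ F} (hf : IsAdapted J f)
    (hJ : J ^ (k + 1) = 0) : quasiInvAlg N J = (diffAlgLE N k).map (toSym N f) := by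
  refine le_antisymm ?_ ?_
  · rintro _ ⟨x, rfl⟩
    induction x using DirectSum.induction_on with
    | zero => exact (map_zero (DirectSum.coeAlgHom (quasiInv N J))).symm ▸ zero_mem _
    | of i p =>
      change DirectSum.coeAlgHom (quasiInv N J) (DirectSum.of _ i p) ∈ _
      rw [DirectSum.coeAlgHom_of]
      obtain ⟨P, hP, hPv⟩ := exists_toSym_eq f (p : SymCopies N F)
      refine ⟨P, ⟨diffHom_le_diffAlg (d := i) ((toSym_mem_quasiInv_iff hf hJ hP).1 ?_), hP⟩, hPv⟩
      rw [hPv]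
      exact p.2
    | add x y hx hy =>
      change DirectSum.coeAlgHom (quasiInv N J) (x + y) ∈ _
      rw [map_add]
      exact add_mem hx hy
  · rintro _ ⟨P, hP, rfl⟩
    change toSym N f P ∈ _
    rw [← sum_homogeneousComponent P, map_sum]
    refine sum_mem fun i _ => ?_
    exact ⟨DirectSum.of (fun i => quasiInv N J i) i
      ⟨_, (toSym_mem_quasiInv_iff hf hJ (homogeneousComponent_mem_orderLE hP.2 i)).2
        (mem_diffAlg_iff.1 hP.1 i)⟩, DirectSum.coeAlgHom_of _ _ _⟩

lemma iUnion_G_subset (N k : ℕ) :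
    (⋃ i ∈ Finset.Icc 1 (k + 1), G N i) ⊆ (orderLE N k : Set (V N)) := by
  refine fun P hP => ?_
  have h : P ∈ diffAlgLE N k := by
    rw [← adjoin_G]
    exact Algebra.subset_adjoin hP
  exact h.2

lemma iUnion_genFamily_copyVar (f : Module.Basis (Fin (k + 1)) ℂ F) :
    (⋃ i ∈ Finset.Icc 1 (k + 1), genFamily (copyVar N f) i) =
      toSym N f '' ⋃ i ∈ Finset.Icc 1 (k + 1), G N i := by
  simp only [genFamily_copyVar, Set.image_iUnion]

theorem fg_quasiInvAlg {f : Module.Basis (Fin (k + 1)) ℂ F} (hf : IsAdapted J f)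
    (hJ : J ^ (k + 1) = 0) : (quasiInvAlg N J).FG := by
  rw [quasiInvAlg_eq_map hf hJ]
  exact (fg_diffAlgLE N k).map _

/-- A subfamily of the image is the image of a subfamily `T`. Both `adjoin T` and `diffAlgLE N k`
lie in order at most `k`, where `toSym` is injective, so equality of the images gives equality
upstairs and `minimal_G` applies. -/
theorem minimal_genFamily_copyVar {f : Module.Basis (Fin (k + 1)) ℂ F} (hf : IsAdapted J f)
    (hJ : J ^ (k + 1) = 0) :
    Minimal (fun S : Set (SymCopies N F) => Algebra.adjoin ℂ S = quasiInvAlg N J)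
      (⋃ i ∈ Finset.Icc 1 (k + 1), genFamily (copyVar N f) i) := by
  rw [iUnion_genFamily_copyVar, quasiInvAlg_eq_map hf hJ]
  refine ⟨?_, fun S hS hSle => ?_⟩
  · change Algebra.adjoin ℂ _ = _
    rw [← AlgHom.map_adjoin, adjoin_G]
  · obtain ⟨T, hT, rfl⟩ := Set.subset_image_iff.1 hSle
    refine Set.image_mono ((minimal_G N k).2 ?_ hT)
    have hS' : Algebra.adjoin ℂ (toSym N f '' T) = (diffAlgLE N k).map (toSym N f) := hS
    rw [← AlgHom.map_adjoin] at hS'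
    have hTle : Algebra.adjoin ℂ T ≤ orderLE N k :=
      Algebra.adjoin_le (hT.trans (iUnion_G_subset N k))
    have hset : toSym N f '' (Algebra.adjoin ℂ T : Set (V N)) =
        toSym N f '' (diffAlgLE N k : Set (V N)) := congrArg SetLike.coe hS'
    exact SetLike.coe_injective (((injOn_toSym f).image_eq_image_iff hTle
      (fun P hP => hP.2)).1 hset)

theorem encard_genFamily_copyVar (f : Module.Basis (Fin (k + 1)) ℂ F) {i : ℕ}
    (hi : i ∈ Finset.Icc 1 (k + 1)) :
    (genFamily (copyVar N f) i).encard = (numGen N i : ℕ∞) := by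
  rw [genFamily_copyVar, Set.InjOn.encard_image, encard_G (Finset.mem_Icc.1 hi).1]
  exact (injOn_toSym f).mono
    ((Set.subset_biUnion_of_mem (u := fun i => G N i) hi).trans (iUnion_G_subset N k))

theorem ne_zero_and_mem_quasiInv {f : Module.Basis (Fin (k + 1)) ℂ F} (hf : IsAdapted J f)
    (hJ : J ^ (k + 1) = 0) {i : ℕ} (hi : i ∈ Finset.Icc 1 (k + 1)) {v : SymCopies N F}
    (hv : v ∈ genFamily (copyVar N f) i) : v ≠ 0 ∧ v ∈ quasiInv N J i := by
  rw [genFamily_copyVar] at hv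
  obtain ⟨P, hP, rfl⟩ := hv
  have hPk : P ∈ orderLE N k := iUnion_G_subset N k (Set.mem_biUnion hi hP)
  refine ⟨fun h0 => ?_, (toSym_mem_quasiInv_iff hf hJ hPk).2 (mem_diffHom_of_mem_G hP)⟩
  rw [← map_zero (toSym N f)] at h0
  exact ne_zero_of_mem_G (Finset.mem_Icc.1 hi).1 hP (injOn_toSym f hPk (zero_mem _) h0)

end Transfer

end DiffHom

end

theorem mainTheorem1 (N k : ℕ) :
    ((DiffHom.diffAlgLE N k).FG ∧
      Minimal (fun S : Set (DiffHom.V N) => Algebra.adjoin ℂ S = DiffHom.diffAlgLE N k)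
        (⋃ i ∈ Finset.Icc 1 (k + 1), DiffHom.G N i) ∧
      ∀ i ∈ Finset.Icc 1 (k + 1),
        (DiffHom.G N i).encard = (DiffHom.numGen N i : ℕ∞) ∧
        ∀ P ∈ DiffHom.G N i,
          P ∈ DiffHom.diffHom N i ∧ P.totalDegree = i ∧ DiffHom.order P = i - 1) ∧
    (∀ (F : Type*) [AddCommGroup F] [Module ℂ F] (J : Module.End ℂ F),
      Module.finrank ℂ F = k + 1 → IsNilpotent J → J ^ k ≠ 0 →
        (∃ e : (Polynomial ℂ ⧸ Ideal.span {(Polynomial.X : Polynomial ℂ) ^ (k + 1)})ˣ ≃*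
            (Algebra.adjoin ℂ {J})ˣ,
          ∀ (u : (Polynomial ℂ ⧸ Ideal.span {(Polynomial.X : Polynomial ℂ) ^ (k + 1)})ˣ)
            (P : Polynomial ℂ),
            (u : Polynomial ℂ ⧸ Ideal.span {(Polynomial.X : Polynomial ℂ) ^ (k + 1)}) =
              Ideal.Quotient.mk _ P →
            ((e u : Algebra.adjoin ℂ {J}) : Module.End ℂ F) = Polynomial.aeval J P) ∧
        (∃ f : Module.Basis (Fin (k + 1)) ℂ F, DiffHom.IsAdapted J f) ∧
        ∀ f : Module.Basis (Fin (k + 1)) ℂ F, DiffHom.IsAdapted J f →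
          (DiffHom.quasiInvAlg N J).FG ∧
          Minimal
            (fun S : Set (DiffHom.SymCopies N F) =>
              Algebra.adjoin ℂ S = DiffHom.quasiInvAlg N J)
            (⋃ i ∈ Finset.Icc 1 (k + 1), DiffHom.genFamily (DiffHom.copyVar N f) i) ∧
          ∀ i ∈ Finset.Icc 1 (k + 1),
            (DiffHom.genFamily (DiffHom.copyVar N f) i).encard = (DiffHom.numGen N i : ℕ∞) ∧
            ∀ v ∈ DiffHom.genFamily (DiffHom.copyVar N f) i,
              v ≠ 0 ∧ v ∈ DiffHom.quasiInv N J i) := by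
  refine ⟨⟨DiffHom.fg_diffAlgLE N k, DiffHom.minimal_G N k, fun i hi => ?_⟩, ?_⟩
  · have hi1 := (Finset.mem_Icc.1 hi).1
    exact ⟨DiffHom.encard_G hi1, fun P hP => ⟨DiffHom.mem_diffHom_of_mem_G hP,
      DiffHom.totalDegree_of_mem_G hi1 hP, DiffHom.order_of_mem_G hi1 hP⟩⟩
  · intro F _ _ J hF hJ hJk
    have hJ' := DiffHom.pow_eq_zero_of_isNilpotent hF hJ
    exact ⟨DiffHom.exists_units_equiv hJ' hJk, DiffHom.exists_isAdapted hF hJ hJk, fun f hf =>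
      ⟨DiffHom.fg_quasiInvAlg hf hJ', DiffHom.minimal_genFamily_copyVar hf hJ', fun i hi =>
        ⟨DiffHom.encard_genFamily_copyVar f hi, fun v hv =>
          DiffHom.ne_zero_and_mem_quasiInv hf hJ' hi hv⟩⟩⟩
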